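/- **Definitions.** For $n\ge 2$, a set $P$ of $2n$ points in the plane is in *regular wheel configuration* if $2n-1$ of the points are equally spaced on a circle and the remaining point is the centre of that circle. Let $GW_{2n}$ be the complete geometric graph on $P$: all pairs of points of $P$ are joined by straight-line segments. A geometric graph is *plane* if no two of its edges cross, and an edge of a geometric graph on $P$ is a *boundary edge* if it lies on the boundary of the convex hull of $P$. A *caterpillar* is a tree that becomes a path (possibly a single vertex) when all its vertices of degree $1$ are deleted. A tree $T$ on $2n$ vertices is *$P_4$-symmetric* with respect to a path $u_1u_2u_3u_4$ of $T$ (on four distinct vertices) if, for some $i\in\{2,4\}$, the graph $T-\{u_1u_2,u_2u_3,u_3u_4\}$ obtained by deleting the three edges of the path consists of the two isolated vertices $u_1,u_i$ together with two further components $A\ni u_3$ and $B\ni u_{6-i}$ for which there is a graph isomorphism $\varphi:A\to B$ with $\varphi(u_3)=u_{6-i}$. A *$w$-caterpillar* is a tree $T$ that is $P_4$-symmetric with respect to some path $u_1u_2u_3u_4$ such that $T$ or $T-u_1$ is a caterpillar. **Theorem.** Let $P$ be a set of $2n$ points in regular wheel configuration in the plane, where $n\ge 2$. Suppose that $T_1,\dots,T_n$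 is a partition of the edges of $GW_{2n}$ into plane spanning trees. Then $n-1$ of these trees are pairwise isomorphic $w$-caterpillars, and the remaining tree is a caterpillar with exactly one boundary edge. Conversely, for every $w$-caterpillar $T$ on $2n$ vertices, the edges of $GW_{2n}$ can be partitioned into $n-1$ plane spanning trees, each isomorphic to $T$, together with one plane spanning caterpillar that has exactly one boundary edge. -/

import Mathlib

/-! Geometric graphs on a regular wheel configuration, caterpillars and `w`-caterpillars. -/

/-- `P ⊆ ℂ = ℝ²` consists of `2 * n - 1` points regularly spaced on a circle together with the
centre of that circle. The centre is `c`; the circle has radius `‖z‖` and passes through `c + z`,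
so `z ≠ 0` carries both the radius and the angular position of the points. -/
def IsRegularWheel (n : ℕ) (P : Set ℂ) : Prop :=
  ∃ c z : ℂ, z ≠ 0 ∧
    P = insert c (Set.range fun k : Fin (2 * n - 1) =>
      c + z * Complex.exp (2 * Real.pi * Complex.I * ((k : ℕ) : ℂ) / ((2 * n - 1 : ℕ) : ℂ)))

/-- A geometric graph on the point set `P` (edge `uv` drawn as the straight segment from `u` to `v`)
is plane if no two distinct edges cross, i.e. have a common interior point. -/
def IsPlane {P : Set ℂ} (G : SimpleGraph P) : Prop :=
  ∀ u v w x : P, G.Adj u v → G.Adj w x → s(u, v) ≠ s(w, x) →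
    Disjoint (openSegment ℝ (u : ℂ) (v : ℂ)) (openSegment ℝ (w : ℂ) (x : ℂ))

/-- The edges of the geometric graph `G` on `P` that lie on the boundary of the convex hull
of `P`. -/
def boundaryEdges {P : Set ℂ} (G : SimpleGraph P) : Set (Sym2 P) :=
  {e | ∃ u v : P, e = s(u, v) ∧ G.Adj u v ∧
    segment ℝ (u : ℂ) (v : ℂ) ⊆ frontier (convexHull ℝ P)}

/-- The graphs `T i` partition the edges of the complete graph on `V`: every edge lies in exactly
one of them. -/
def PartitionsComplete {ι V : Type*} (T : ι → SimpleGraph V) : Prop :=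
  ∀ u v : V, u ≠ v → ∃! i, (T i).Adj u v

/-- A caterpillar: a tree that becomes a path when all its vertices of degree `1` are deleted
(a single vertex counts as a path, so stars are caterpillars). -/
def IsCaterpillar {V : Type*} (T : SimpleGraph V) : Prop :=
  T.IsTree ∧ ∃ m : ℕ,
    Nonempty (T.induce {v | (T.neighborSet v).ncard ≠ 1} ≃g SimpleGraph.pathGraph m)

/-- The graph `F` consists of two isolated vertices `p`, `q` together with two further connected
components, one containing `a` and one containing `b`, and there is an isomorphism between these
two components that maps `a` to `b`. -/
def SplitsSymmetrically {V : Type*} (F : SimpleGraph V) (p q a b : V) : Prop :=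
  F.neighborSet p = ∅ ∧ F.neighborSet q = ∅ ∧ p ≠ q ∧
    F.connectedComponentMk a ≠ F.connectedComponentMk b ∧
    (∀ v, v = p ∨ v = q ∨ v ∈ F.connectedComponentMk a ∨ v ∈ F.connectedComponentMk b) ∧
    a ≠ p ∧ a ≠ q ∧ b ≠ p ∧ b ≠ q ∧
    ∃ φ : (F.connectedComponentMk a).toSimpleGraph ≃g (F.connectedComponentMk b).toSimpleGraph,
      φ ⟨a, rfl⟩ = ⟨b, rfl⟩

/-- `T` is a `P₄`-symmetric tree with respect to its path `u₁u₂u₃u₄`: after deletion of the three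
edges of the path, `u₁` and one of `u₄`, `u₂` are isolated, and the remaining two components, which
contain `u₃` and the other one of `u₂`, `u₄`, are isomorphic through a map that matches these two
vertices. -/
def IsP4Symmetric {V : Type*} (T : SimpleGraph V) (u₁ u₂ u₃ u₄ : V) : Prop :=
  T.IsTree ∧ T.Adj u₁ u₂ ∧ T.Adj u₂ u₃ ∧ T.Adj u₃ u₄ ∧ u₁ ≠ u₃ ∧ u₁ ≠ u₄ ∧ u₂ ≠ u₄ ∧
    (SplitsSymmetrically (T.deleteEdges {s(u₁, u₂), s(u₂, u₃), s(u₃, u₄)}) u₁ u₄ u₃ u₂ ∨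
      SplitsSymmetrically (T.deleteEdges {s(u₁, u₂), s(u₂, u₃), s(u₃, u₄)}) u₁ u₂ u₃ u₄)

/-- A `w`-caterpillar: a `P₄`-symmetric tree `T`, with path `u₁u₂u₃u₄`, such that `T` or `T - u₁`
is a caterpillar. -/
def IsWCaterpillar {V : Type*} (T : SimpleGraph V) : Prop :=
  ∃ u₁ u₂ u₃ u₄ : V, IsP4Symmetric T u₁ u₂ u₃ u₄ ∧
    (IsCaterpillar T ∨ IsCaterpillar (T.induce ({u₁}ᶜ : Set V)))

/-! The wheel has `2 m + 2` vertices: the centre `none` and the points `some x` of the circle, with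
`x : ZMod (2 m + 1)` in cyclic order. Planarity becomes the condition `IsNoncrossing`: an edge that
ends strictly inside the arc cut off by a chord stays on this arc.

Consider a partition into `m + 1` noncrossing trees.

* There are `2 m + 1` longest chords, from `x` to `x + m`. Two of them in the same tree share an
  end, and three would form a triangle. So a tree contains at most two, and by counting one tree
  contains one and each other tree contains two.
* The arc below a longest chord contains a side of the polygon from the same tree. These sides are
  different, and there are only `2 m + 1` sides, so there is exactly one in each arc. As every
  chord on the arc has a side below it, all chords of the tree on this arc lie over this one side,
  and they are nested: directly below a chord of length `d + 1` there is one of length `d` with the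
  same left or the same right end.
* This choice is the same for all arcs. If the arc at `x` keeps the left end and the arc at `x - 1`
  keeps the right end, both have chosen the same chord, so their longest chords, which cross, would
  lie in the same tree. Hence a single sequence `a` of left ends, a profile (`IsProfile`),
  describes all chords of all trees (`IsNoncrossingPartition.exists_profile`).
* It remains to place the radii. The tree with only one longest chord needs all points outside its
  arc as neighbours of the centre and one end of its arc, by reflection the left one. Going round
  the circle, this leaves only one radius to every other tree: the longest chords of the tree start
  at some `s` and at `s + m`, and the radius ends at `s`
  (`IsNoncrossingPartition.exists_normal_form`).

So `m` of the trees are rotations of one tree. In this tree the path from the centre through `s`,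
`s + m` and `s + 2 m` exhibits the `P₄`-symmetry, by rotation by `m`. Without the centre it is a
caterpillar, because its chords join the ends of a growing sequence of intervals: below the chord
from `s` to `s + m` these are the nested arcs, and beyond it the complements of the arcs at
`s + m`. The same argument applies to the remaining tree (`isCaterpillar_special`), whose only side is
its shortest chord.

Conversely, every profile yields a partition, and it is enough to find the profile of a
`w`-caterpillar `S`. One component of the symmetric splitting is laid out on an arc by removing one
vertex at a time: at the attaching vertex `r` either a leaf, or, if there is none, `r` itself,
which then has a unique further neighbour since a vertex of a caterpillar has at most two nonleaf
neighbours (`exists_arcModel`). The other component follows by symmetry, and the four vertices of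
the path connect the two arcs and the centre (`exists_iso_of_isWCaterpillar`). -/

open SimpleGraph

namespace WheelPartition

/-! ### Chords of nested arcs -/

section

/-- In a noncrossing relation on an interval of integers with no isolated inner point, every edge
spans an edge between two consecutive integers. -/
lemma exists_consecutive {M : ℕ} {R : ℕ → ℕ → Prop} (hs : ∀ i j, R i j → R j i)
    (hnc : ∀ p q j i, p < j → j < q → q ≤ M → i ≤ M → R p q → R j i → p ≤ i ∧ i ≤ q)
    (hne : ∀ j, 0 < j → j < M → ∃ i ≤ M, i ≠ j ∧ R j i) :
    ∀ p q, p < q → q ≤ M → R p q → ∃ i, p ≤ i ∧ i < q ∧ R i (i + 1) := by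
  intro p q
  induction h : q - p using Nat.strong_induction_on generalizing p q with
  | _ k ih =>
    intro hpq hq hR
    by_cases h1 : q = p + 1
    · exact ⟨p, le_rfl, by omega, h1 ▸ hR⟩
    obtain ⟨i, hi, hne', hRi⟩ := hne (p + 1) (by omega) (by omega)
    obtain ⟨h2, h3⟩ := hnc p q (p + 1) i (by omega) (by omega) hq hi hR hRi
    rcases eq_or_lt_of_le h2 with rfl | h2
    · exact ⟨p, le_rfl, by omega, hs _ _ hRi⟩
    · obtain ⟨j, h4, h5, h6⟩ := ih (i - (p + 1)) (by omega) (p + 1) i rfl (by omega) hi hRi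
      exact ⟨j, by omega, by omega, h6⟩

/-- If all edges of the relation pass over the same unit gap `g`, then directly below an edge
`pq` of length at least `2` there is the edge `p(q-1)` or the edge `(p+1)q`. -/
lemma exists_shorter {M g : ℕ} {R : ℕ → ℕ → Prop} (hs : ∀ i j, R i j → R j i)
    (hnc : ∀ p q j i, p < j → j < q → q ≤ M → i ≤ M → R p q → R j i → p ≤ i ∧ i ≤ q)
    (hne : ∀ j, 0 < j → j < M → ∃ i ≤ M, i ≠ j ∧ R j i)
    (hexit : ∀ p q, p + 2 ≤ q → q ≤ M → R p q → ∃ j, p < j ∧ j < q ∧ (R p j ∨ R j q))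
    (hg : ∀ i, i < M → R i (i + 1) → i = g)
    (p q : ℕ) (hpq : p + 2 ≤ q) (hq : q ≤ M) (hR : R p q) :
    R p (q - 1) ∨ R (p + 1) q := by
  have hgap : ∀ i j, i < j → j ≤ M → R i j → i ≤ g ∧ g < j := by
    intro i j hij hj hR
    obtain ⟨k, h1, h2, h3⟩ := exists_consecutive hs hnc hne i j hij hj hR
    have := hg k (by omega) h3
    omega
  obtain ⟨j, hpj, hjq, hj⟩ := hexit p q hpq hq hR
  rcases hj with hj | hj
  · by_cases hlast : j = q - 1
    · exact Or.inl (hlast ▸ hj)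
    -- The vertex `q - 1` is not isolated and its edge has to pass over `g < j`.
    obtain ⟨i, hi, hne', hRi⟩ := hne (q - 1) (by omega) (by omega)
    obtain ⟨h2, h3⟩ := hnc p q (q - 1) i (by omega) (by omega) hq hi hR hRi
    have hgj := hgap p j hpj (by omega) hj
    rcases lt_or_gt_of_ne hne' with hlt | hgt
    · have h4 := hgap i (q - 1) hlt (by omega) (hs _ _ hRi)
      rcases eq_or_lt_of_le h2 with rfl | h2
      · exact Or.inl (hs _ _ hRi)
      · have := hnc p j i (q - 1) h2 (by omega) (by omega) (by omega) hj (hs _ _ hRi)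
        omega
    · have h4 := hgap (q - 1) i hgt (by omega) hRi
      omega
  · by_cases hfirst : j = p + 1
    · exact Or.inr (hfirst ▸ hj)
    obtain ⟨i, hi, hne', hRi⟩ := hne (p + 1) (by omega) (by omega)
    obtain ⟨h2, h3⟩ := hnc p q (p + 1) i (by omega) (by omega) hq hi hR hRi
    have hgj := hgap j q hjq (by omega) hj
    rcases lt_or_gt_of_ne hne' with hlt | hgt
    · have h4 := hgap i (p + 1) hlt (by omega) (hs _ _ hRi)
      omega
    · have h4 := hgap (p + 1) i hgt (by omega) hRi
      rcases eq_or_lt_of_le h3 with rfl | h3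
      · exact Or.inr hRi
      · have := hnc j q i (p + 1) (by omega) h3 (by omega) (by omega) hj (hs _ _ hRi)
        omega

/-! ### Noncrossing graphs on the wheel -/

variable {m : ℕ}

lemma natCast_inj {i j : ℕ} (hi : i < 2 * m + 1) (hj : j < 2 * m + 1)
    (h : (i : ZMod (2 * m + 1)) = j) : i = j := by
  rw [ZMod.natCast_eq_natCast_iff'] at h
  rwa [Nat.mod_eq_of_lt hi, Nat.mod_eq_of_lt hj] at h

lemma two_mul_add_one_eq_zero : (2 * m + 1 : ZMod (2 * m + 1)) = 0 := by
  have := ZMod.natCast_self (2 * m + 1)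
  push_cast at this
  exact this

lemma exists_eq_add (x y : ZMod (2 * m + 1)) : ∃ i : ℕ, i < 2 * m + 1 ∧ y = x + i :=
  ⟨(y - x).val, ZMod.val_lt _, by rw [ZMod.natCast_zmod_val]; ring⟩

/-- Two points of the circle are the ends of an arc of length at most `m`. -/
lemma exists_chord {x y : ZMod (2 * m + 1)} (h : x ≠ y) :
    ∃ d : ℕ, 1 ≤ d ∧ d ≤ m ∧ (y = x + d ∨ x = y + d) := by
  obtain ⟨i, hi, rfl⟩ := exists_eq_add x y
  have h0 : i ≠ 0 := by rintro rfl; simp at h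
  by_cases him : i ≤ m
  · exact ⟨i, by omega, him, Or.inl rfl⟩
  · refine ⟨2 * m + 1 - i, by omega, by omega, Or.inr ?_⟩
    rw [Nat.cast_sub hi.le]
    push_cast
    linear_combination -(two_mul_add_one_eq_zero (m := m))

/-- The vertices of the wheel: `none` is the centre, `some x` are the points of the circle in
cyclic order. This is the combinatorial form of planarity: an edge that ends strictly inside the
arc cut off by the chord from `x` to `x + d` has both ends on this closed arc. -/
def IsNoncrossing (G : SimpleGraph (Option (ZMod (2 * m + 1)))) : Prop :=
  ∀ (x : ZMod (2 * m + 1)) (d : ℕ), d ≤ m → G.Adj (some x) (some (x + d)) →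
    ∀ j : ℕ, 0 < j → j < d → ∀ w, G.Adj (some (x + j)) w → ∃ i : ℕ, i ≤ d ∧ w = some (x + i)

variable {G : SimpleGraph (Option (ZMod (2 * m + 1)))}

lemma IsNoncrossing.mem_arc (h : IsNoncrossing G) (x : ZMod (2 * m + 1)) {p q j : ℕ} (hpj : p < j)
    (hjq : j < q) (hq : q ≤ p + m) (hR : G.Adj (some (x + p)) (some (x + q)))
    {w : Option (ZMod (2 * m + 1))} (hw : G.Adj (some (x + j)) w) :
    ∃ i : ℕ, p ≤ i ∧ i ≤ q ∧ w = some (x + i) := by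
  have e1 : x + (q : ZMod (2 * m + 1)) = x + p + (q - p : ℕ) := by
    rw [Nat.cast_sub (by omega)]; ring
  have e2 : x + (j : ZMod (2 * m + 1)) = x + p + (j - p : ℕ) := by
    rw [Nat.cast_sub (by omega)]; ring
  rw [e1] at hR
  rw [e2] at hw
  obtain ⟨i, hi, rfl⟩ := h (x + p) (q - p) (by omega) hR (j - p) (by omega) (by omega) w hw
  exact ⟨p + i, by omega, by omega, by push_cast; rw [add_assoc]⟩

lemma IsNoncrossing.mem_arc_index (h : IsNoncrossing G) (x : ZMod (2 * m + 1)) (p q j i : ℕ)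
    (hpj : p < j) (hjq : j < q) (hq : q ≤ m) (hi : i ≤ m)
    (hR : G.Adj (some (x + p)) (some (x + q))) (hw : G.Adj (some (x + j)) (some (x + i))) :
    p ≤ i ∧ i ≤ q := by
  obtain ⟨i', h1, h2, h3⟩ := h.mem_arc x hpj hjq (by omega) hR hw
  have := natCast_inj (by omega) (by omega) (add_left_cancel (Option.some_injective _ h3))
  omega

lemma exists_adj_of_mem_of_notMem {V : Type*} {H : SimpleGraph V} (hH : H.Connected) {S : Set V}
    {u v : V} (hu : u ∈ S) (hv : v ∉ S) : ∃ x ∈ S, ∃ y ∉ S, H.Adj x y := by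
  obtain ⟨w⟩ := hH.preconnected u v
  obtain ⟨d, -, h1, h2⟩ := w.exists_boundary_dart S hu hv
  exact ⟨_, h1, _, h2, d.adj⟩

lemma exists_adj {V : Type*} {H : SimpleGraph V} (hH : H.Connected) {u v : V} (huv : u ≠ v) :
    ∃ y, H.Adj u y := by
  obtain ⟨x, hx, y, -, h⟩ := exists_adj_of_mem_of_notMem hH (S := {u}) rfl huv.symm
  exact ⟨y, by rwa [Set.mem_singleton_iff.mp hx] at h⟩

lemma exists_adj_index (hc : G.Connected) (hn : IsNoncrossing G) {x : ZMod (2 * m + 1)}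
    (hx : G.Adj (some x) (some (x + (m : ℕ)))) (j : ℕ) (h0 : 0 < j) (hj : j < m) :
    ∃ i ≤ m, i ≠ j ∧ G.Adj (some (x + j)) (some (x + i)) := by
  obtain ⟨w, hw⟩ := exists_adj hc (show some (x + (j : ZMod (2 * m + 1))) ≠ none by simp)
  obtain ⟨i, hi, rfl⟩ := hn x m le_rfl hx j h0 hj w hw
  refine ⟨i, hi, ?_, hw⟩
  rintro rfl
  exact hw.ne rfl

lemma exists_boundary_index (hm : 1 ≤ m) (hc : G.Connected) (hn : IsNoncrossing G)
    {x : ZMod (2 * m + 1)} (hx : G.Adj (some x) (some (x + (m : ℕ)))) :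
    ∃ i < m, G.Adj (some (x + (i : ℕ))) (some (x + (i + 1 : ℕ))) := by
  obtain ⟨i, -, h2, h3⟩ := exists_consecutive (M := m)
    (R := fun i j => G.Adj (some (x + (i : ℕ))) (some (x + (j : ℕ)))) (fun _ _ h => h.symm)
    (fun p q j i a b c d e f => hn.mem_arc_index x p q j i a b c d e f)
    (exists_adj_index hc hn hx) 0 m (by omega) le_rfl (by simpa using hx)
  exact ⟨i, h2, h3⟩

/-- Below a chord there is an edge at one of its ends, as the inner points of its arc are connected
to the rest. -/
lemma exists_adj_end (hc : G.Connected) (hn : IsNoncrossing G) {x : ZMod (2 * m + 1)} (p q : ℕ)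
    (hpq : p + 2 ≤ q) (hq : q ≤ m) (hx : G.Adj (some (x + (p : ℕ))) (some (x + (q : ℕ)))) :
    ∃ j, p < j ∧ j < q ∧ (G.Adj (some (x + (p : ℕ))) (some (x + (j : ℕ))) ∨
      G.Adj (some (x + (j : ℕ))) (some (x + (q : ℕ)))) := by
  -- Otherwise no edge leaves the set of points strictly inside the arc.
  obtain ⟨u, ⟨j, h1, h2, rfl⟩, v, hv, huv⟩ := exists_adj_of_mem_of_notMem hc
    (S := {u | ∃ j : ℕ, p < j ∧ j < q ∧ u = some (x + (j : ℕ))}) (u := some (x + (p + 1 : ℕ)))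
    (v := none) ⟨p + 1, by omega, by omega, rfl⟩ (by simp)
  obtain ⟨i, h3, h4, rfl⟩ := hn.mem_arc x h1 h2 (by omega) hx huv
  refine ⟨j, h1, h2, ?_⟩
  rcases eq_or_lt_of_le h3 with rfl | h3
  · exact Or.inl huv.symm
  rcases eq_or_lt_of_le h4 with rfl | h4
  · exact Or.inr huv
  exact (hv ⟨i, h3, h4, rfl⟩).elim

lemma IsNoncrossing.not_adj_of_lt (hn : IsNoncrossing G) {x : ZMod (2 * m + 1)} {i : ℕ} (h0 : 0 < i)
    (hi : i < m) (hx : G.Adj (some x) (some (x + (m : ℕ)))) :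
    ¬ G.Adj (some (x + i)) (some (x + i + (m : ℕ))) := by
  intro h
  obtain ⟨k, hk, h1⟩ := hn x m le_rfl hx i h0 hi _ h
  have h2 : ((i + m : ℕ) : ZMod (2 * m + 1)) = k := by
    push_cast
    linear_combination Option.some_injective _ h1
  have := natCast_inj (by omega) (by omega) h2
  omega

/-- Longest chords in a noncrossing graph share an end. -/
lemma IsNoncrossing.longest (hn : IsNoncrossing G) {x y : ZMod (2 * m + 1)}
    (hx : G.Adj (some x) (some (x + (m : ℕ)))) (hy : G.Adj (some y) (some (y + (m : ℕ))))
    (hxy : x ≠ y) : y = x + (m : ℕ) ∨ x = y + (m : ℕ) := by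
  obtain ⟨i, hi, rfl⟩ := exists_eq_add x y
  have h0 : i ≠ 0 := by rintro rfl; simp at hxy
  rcases lt_trichotomy i m with h | rfl | h
  · exact (hn.not_adj_of_lt (by omega) h hx hy).elim
  · exact Or.inl rfl
  · have e : x = x + i + (2 * m + 1 - i : ℕ) := by
      rw [Nat.cast_sub hi.le]
      push_cast
      linear_combination -(two_mul_add_one_eq_zero (m := m))
    by_cases h1 : i = m + 1
    · right
      rw [show 2 * m + 1 - i = m by omega] at e
      exact e
    · refine (hn.not_adj_of_lt (i := 2 * m + 1 - i) (by omega) (by omega) hy ?_).elim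
      rwa [← e]

/-- The arcs of two different longest chords of a noncrossing graph have no gap in common. -/
lemma IsNoncrossing.eq_of_add_eq (hn : IsNoncrossing G) {x y : ZMod (2 * m + 1)}
    (hx : G.Adj (some x) (some (x + (m : ℕ)))) (hy : G.Adj (some y) (some (y + (m : ℕ))))
    {p q : ℕ} (hp : p < m) (hq : q < m) (h : x + (p : ℕ) = y + (q : ℕ)) : x = y := by
  by_contra hxy
  rcases hn.longest hx hy hxy with rfl | rfl
  · have h2 : (p : ZMod (2 * m + 1)) = (m + q : ℕ) := by
      push_cast
      linear_combination h
    have := natCast_inj (by omega) (by omega) h2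
    omega
  · have h2 : (q : ZMod (2 * m + 1)) = (m + p : ℕ) := by
      push_cast
      linear_combination -h
    have := natCast_inj (by omega) (by omega) h2
    omega

/-! ### Rigidity of partitions -/

/-- A partition of the complete graph on the vertices of the wheel into noncrossing trees. -/
structure IsNoncrossingPartition (T : Fin (m + 1) → SimpleGraph (Option (ZMod (2 * m + 1)))) :
    Prop where
  partitions : PartitionsComplete T
  isTree (t) : (T t).IsTree
  isNoncrossing (t) : IsNoncrossing (T t)

/-- A profile encodes a sequence of nested arcs of lengths `0, …, m` inside the arc from `0` to `m`:
the arc of length `d` runs from `a d` to `a d + d`. -/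
structure IsProfile (m : ℕ) (a : ℕ → ℕ) : Prop where
  top : a m = 0
  step (d) (hd : d < m) : a d = a (d + 1) ∨ a d = a (d + 1) + 1

lemma add_self_ne (hm : 1 ≤ m) (x : ZMod (2 * m + 1)) {d : ℕ} (h1 : 1 ≤ d) (hd : d ≤ m) :
    x ≠ x + (d : ℕ) := by
  intro h
  have h2 : ((0 : ℕ) : ZMod (2 * m + 1)) = d := by
    push_cast
    linear_combination h
  have := natCast_inj (by omega) (by omega) h2
  omega

variable {T : Fin (m + 1) → SimpleGraph (Option (ZMod (2 * m + 1)))}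

lemma _root_.PartitionsComplete.eq {ι V : Type*} {T : ι → SimpleGraph V} (h : PartitionsComplete T)
    {s t : ι} {u v : V} (hs : (T s).Adj u v) (ht : (T t).Adj u v) : s = t :=
  (h u v hs.ne).unique hs ht

/-- The longest chords are coloured by the trees: `τ x` is the tree with the chord from `x` to
`x + m`. -/
lemma exists_longest_color (hm : 1 ≤ m) (hT : PartitionsComplete T) :
    ∃ τ : ZMod (2 * m + 1) → Fin (m + 1),
      ∀ x t, (T t).Adj (some x) (some (x + (m : ℕ))) ↔ t = τ x := by
  choose τ hτ using fun x : ZMod (2 * m + 1) =>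
    (hT (some x) (some (x + (m : ℕ))) (by simpa using add_self_ne hm x hm le_rfl)).exists
  exact ⟨τ, fun x t => ⟨fun h => hT.eq h (hτ x), fun h => h ▸ hτ x⟩⟩

/-- Counting boundary edges: each of the `2m + 1` arcs cut off by a longest chord contains a
boundary edge of the same tree, these are all different, and so there are no others. -/
lemma IsNoncrossingPartition.exists_unique_gap (hm : 1 ≤ m) (hT : IsNoncrossingPartition T)
    {τ : ZMod (2 * m + 1) → Fin (m + 1)}
    (hτ : ∀ x t, (T t).Adj (some x) (some (x + (m : ℕ))) ↔ t = τ x) (x : ZMod (2 * m + 1)) :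
    ∃ g : ℕ, ∀ i < m,
      (T (τ x)).Adj (some (x + (i : ℕ))) (some (x + (i + 1 : ℕ))) → i = g := by
  have hτ' := fun x => (hτ x _).2 rfl
  choose β hβ hβ' using fun y =>
    exists_boundary_index hm (hT.isTree (τ y)).connected (hT.isNoncrossing _) (hτ' y)
  have hsame : ∀ (y z : ZMod (2 * m + 1)) {p q : ℕ}, τ y = τ z → p < m → q < m →
      y + (p : ℕ) = z + (q : ℕ) → y = z := by
    intro y z p q h hp hq e
    have hz := hτ' z
    rw [← h] at hz
    exact (hT.isNoncrossing _).eq_of_add_eq (hτ' y) hz hp hq e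
  have hcol : ∀ (y z : ZMod (2 * m + 1)) {p q : ℕ}, y + (p : ℕ) = z + (q : ℕ) →
      (T (τ y)).Adj (some (y + (p : ℕ))) (some (y + (p + 1 : ℕ))) →
      (T (τ z)).Adj (some (z + (q : ℕ))) (some (z + (q + 1 : ℕ))) → τ y = τ z := by
    intro y z p q e h1 h2
    refine hT.partitions.eq h1 ?_
    convert h2 using 2
    push_cast
    linear_combination e
  have hsurj : Function.Surjective fun y => y + (β y : ℕ) := by
    refine Finite.injective_iff_surjective.1 fun y z h => ?_
    exact hsame y z (hcol y z h (hβ' y) (hβ' z)) (hβ y) (hβ z) h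
  refine ⟨β x, fun i hi h => ?_⟩
  obtain ⟨y, hy⟩ := hsurj (x + (i : ℕ))
  obtain rfl := hsame y x (hcol y x hy (hβ' y) h) (hβ y) hi hy
  exact (natCast_inj (by have := hβ y; omega) (by omega) (add_left_cancel hy)).symm

/-- The rigidity step: if all arcs have their chord of length `d + 1` at the same place, then they
have their chord of length `d` at the same place. -/
lemma IsNoncrossingPartition.step (hT : IsNoncrossingPartition T)
    {τ : ZMod (2 * m + 1) → Fin (m + 1)}
    (hτ : ∀ x t, (T t).Adj (some x) (some (x + (m : ℕ))) ↔ t = τ x) {d α : ℕ} (hd : 1 ≤ d)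
    (hα : α + (d + 1) ≤ m)
    (h : ∀ x, (T (τ x)).Adj (some (x + (α : ℕ))) (some (x + (α + (d + 1) : ℕ)))) :
    (∀ x, (T (τ x)).Adj (some (x + (α : ℕ))) (some (x + (α + d : ℕ)))) ∨
      ∀ x, (T (τ x)).Adj (some (x + (α + 1 : ℕ))) (some (x + (α + 1 + d : ℕ))) := by
  have hτ' := fun x => (hτ x _).2 rfl
  have key : ∀ x, (T (τ x)).Adj (some (x + (α : ℕ))) (some (x + (α + d : ℕ))) ∨
      (T (τ x)).Adj (some (x + (α + 1 : ℕ))) (some (x + (α + 1 + d : ℕ))) := by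
    intro x
    have hc := (hT.isTree (τ x)).connected
    have hn := hT.isNoncrossing (τ x)
    obtain ⟨g, hg⟩ := hT.exists_unique_gap (by omega) hτ x
    have := exists_shorter (M := m) (g := g)
      (R := fun i j => (T (τ x)).Adj (some (x + (i : ℕ))) (some (x + (j : ℕ))))
      (fun _ _ h => h.symm) (fun p q j i a b c d e f => hn.mem_arc_index x p q j i a b c d e f)
      (exists_adj_index hc hn (hτ' x)) (exists_adj_end hc hn) hg α (α + (d + 1)) (by omega) hα (h x)
    rwa [show α + (d + 1) - 1 = α + d by omega, show α + (d + 1) = α + 1 + d by omega] at this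
  by_cases hex : ∃ x, (T (τ x)).Adj (some (x + (α : ℕ))) (some (x + (α + d : ℕ)))
  · left
    obtain ⟨x₀, hx₀⟩ := hex
    -- If `x` keeps the start and `x - 1` does not, the two chords coincide, so `x` and `x - 1`
    -- belong to the same tree; but the longest chords at `x` and `x - 1` cross.
    have hprev : ∀ x, (T (τ x)).Adj (some (x + (α : ℕ))) (some (x + (α + d : ℕ))) →
        (T (τ (x - 1))).Adj (some (x - 1 + (α : ℕ))) (some (x - 1 + (α + d : ℕ))) := by
      intro x hx
      refine (key (x - 1)).resolve_right fun h1 => ?_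
      have e1 : x - 1 + (α + 1 : ℕ) = x + (α : ℕ) := by push_cast; ring
      have e2 : x - 1 + (α + 1 + d : ℕ) = x + (α + d : ℕ) := by push_cast; ring
      rw [e1, e2] at h1
      have h2 := hT.partitions.eq hx h1
      have h3 := hτ' (x - 1)
      rw [← h2] at h3
      refine (hT.isNoncrossing (τ x)).not_adj_of_lt (x := x - 1) (i := 1) (by omega) (by omega) h3
        ?_
      simpa using hτ' x
    have hall : ∀ i : ℕ, (T (τ (x₀ - i))).Adj (some (x₀ - i + (α : ℕ)))
        (some (x₀ - i + (α + d : ℕ))) := by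
      intro i
      induction i with
      | zero => simpa using hx₀
      | succ i ih =>
        have := hprev _ ih
        rwa [show x₀ - (i : ZMod (2 * m + 1)) - 1 = x₀ - (i + 1 : ℕ) by push_cast; ring] at this
    intro x
    obtain ⟨i, -, hi⟩ := exists_eq_add x x₀
    have := hall i
    rwa [show x₀ - (i : ZMod (2 * m + 1)) = x by rw [hi]; ring] at this
  · right
    exact fun x => (key x).resolve_left fun h => hex ⟨x, h⟩

/-- All trees follow one profile: every chord of length `d` at `x + a d` lies in the tree of the
longest chord at `x`. -/
theorem IsNoncrossingPartition.exists_profile (hT : IsNoncrossingPartition T)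
    {τ : ZMod (2 * m + 1) → Fin (m + 1)}
    (hτ : ∀ x t, (T t).Adj (some x) (some (x + (m : ℕ))) ↔ t = τ x) :
    ∃ a, IsProfile m a ∧ ∀ d, 1 ≤ d → d ≤ m → ∀ x,
      (T (τ x)).Adj (some (x + (a d : ℕ))) (some (x + (a d + d : ℕ))) := by
  classical
  let P : ℕ → ℕ → Prop := fun d α =>
    ∀ x, (T (τ x)).Adj (some (x + (α : ℕ))) (some (x + (α + d : ℕ)))
  let b : ℕ → ℕ := fun k =>
    Nat.rec 0 (fun k α => if P (m - (k + 1)) α then α else α + 1) k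
  have hb : ∀ k, b (k + 1) = if P (m - (k + 1)) (b k) then b k else b k + 1 := fun k => rfl
  have hP : ∀ k, k + 1 ≤ m → b k ≤ k ∧ P (m - k) (b k) := by
    intro k
    induction k with
    | zero => exact fun _ => ⟨le_rfl, fun x => by simpa [b] using (hτ x _).2 rfl⟩
    | succ k ih =>
      intro hk
      obtain ⟨h1, h2⟩ := ih (by omega)
      have h3 := hT.step hτ (d := m - (k + 1)) (α := b k) (by omega) (by omega)
        (by rw [show m - (k + 1) + 1 = m - k by omega]; exact h2)
      rw [hb]
      split_ifs with h4
      · exact ⟨by omega, h4⟩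
      · exact ⟨by omega, h3.resolve_left h4⟩
  refine ⟨fun d => b (m - d), ⟨by simp [b], fun d hd => ?_⟩, fun d h1 hd => ?_⟩
  · have := hb (m - (d + 1))
    rw [show m - (d + 1) + 1 = m - d by omega] at this
    simp only [this]
    split_ifs <;> simp
  · have := (hP (m - d) (by omega)).2
    rwa [show m - (m - d) = d by omega] at this

end

/-! ### The shape of the trees of a partition -/

section

variable {m : ℕ} {G : SimpleGraph (Option (ZMod (2 * m + 1)))}
  {T : Fin (m + 1) → SimpleGraph (Option (ZMod (2 * m + 1)))}

lemma add_natCast_inj {x : ZMod (2 * m + 1)} {i j : ℕ} (h : x + (i : ℕ) = x + (j : ℕ))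
    (hi : i < 2 * m + 1) (hj : j < 2 * m + 1) : i = j :=
  natCast_inj hi hj (add_left_cancel h)

lemma add_natCast_mod (x : ZMod (2 * m + 1)) {i j : ℕ} (h : i = j + (2 * m + 1)) :
    x + (i : ℕ) = x + (j : ℕ) := by
  subst h
  push_cast
  linear_combination two_mul_add_one_eq_zero (m := m)

lemma IsProfile.le {a : ℕ → ℕ} (ha : IsProfile m a) {d : ℕ} (hd : d ≤ m) : a d + d ≤ m := by
  induction hd using Nat.decreasingInduction with
  | self => simp [ha.top]
  | of_succ k hk ih => rcases ha.step k hk with h | h <;> omega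

/-- The graph on the vertices of the wheel with the radii to the points of `R` and with, for each
`x ∈ J`, the chords of the nested arcs of the profile `a` in the arc from `x` to `x + m`. -/
def profileGraph (a : ℕ → ℕ) (J R : Set (ZMod (2 * m + 1))) :
    SimpleGraph (Option (ZMod (2 * m + 1))) :=
  SimpleGraph.fromRel fun u v =>
    (∃ x ∈ J, ∃ d, 1 ≤ d ∧ d ≤ m ∧ u = some (x + (a d : ℕ)) ∧ v = some (x + (a d + d : ℕ))) ∨
      ∃ x ∈ R, u = none ∧ v = some x

lemma profileGraph_adj_none {a : ℕ → ℕ} {J R : Set (ZMod (2 * m + 1))} {x : ZMod (2 * m + 1)} :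
    (profileGraph a J R).Adj none (some x) ↔ x ∈ R := by
  simp [profileGraph]

lemma profileGraph_adj_some {a : ℕ → ℕ} {J R : Set (ZMod (2 * m + 1))} {y z : ZMod (2 * m + 1)} :
    (profileGraph a J R).Adj (some y) (some z) ↔ ∃ x ∈ J, ∃ d, 1 ≤ d ∧ d ≤ m ∧
      ((y = x + (a d : ℕ) ∧ z = x + (a d + d : ℕ)) ∨
        (z = x + (a d : ℕ) ∧ y = x + (a d + d : ℕ))) := by
  simp only [profileGraph, fromRel_adj, ne_eq, Option.some.injEq, reduceCtorEq, false_and,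
    and_false, exists_false, or_false]
  constructor
  · rintro ⟨-, ⟨x, hx, d, h1, h2, h⟩ | ⟨x, hx, d, h1, h2, h⟩⟩
    · exact ⟨x, hx, d, h1, h2, Or.inl h⟩
    · exact ⟨x, hx, d, h1, h2, Or.inr h⟩
  · rintro ⟨x, hx, d, h1, h2, h⟩
    refine ⟨?_, ?_⟩
    · have := add_self_ne (h1.trans h2) (x + (a d : ℕ)) h1 h2
      push_cast at h
      rw [← add_assoc] at h
      rcases h with ⟨rfl, rfl⟩ | ⟨rfl, rfl⟩
      · exact this
      · exact this.symm
    · rcases h with h | h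
      · exact Or.inl ⟨x, hx, d, h1, h2, h⟩
      · exact Or.inr ⟨x, hx, d, h1, h2, h⟩

lemma profileGraph_adj_chord {a : ℕ → ℕ} {J R : Set (ZMod (2 * m + 1))} {y : ZMod (2 * m + 1)}
    {d : ℕ} (h1 : 1 ≤ d) (h2 : d ≤ m) :
    (profileGraph a J R).Adj (some y) (some (y + (d : ℕ))) ↔ y - (a d : ℕ) ∈ J := by
  rw [profileGraph_adj_some]
  constructor
  · rintro ⟨x, hx, e, h3, h4, ⟨rfl, h⟩ | ⟨h, h5⟩⟩
    · have h6 : x + (a e : ℕ) + (d : ℕ) = x + (a e : ℕ) + (e : ℕ) := by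
        rw [h]; push_cast; ring
      obtain rfl := add_natCast_inj h6 (by omega) (by omega)
      simpa using hx
    · have h6 : y + ((d + e : ℕ) : ZMod (2 * m + 1)) = y + (0 : ℕ) := by
        push_cast at h5 ⊢
        linear_combination h - h5
      have := add_natCast_inj h6 (by omega) (by omega)
      omega
  · intro h
    exact ⟨_, h, d, h1, h2, Or.inl ⟨by ring, by push_cast; ring⟩⟩

/-- The radii are coloured by the trees: `ρ x` is the tree with the radius to `x`. -/
lemma exists_radius_color (hT : PartitionsComplete T) :
    ∃ ρ : ZMod (2 * m + 1) → Fin (m + 1), ∀ x t, (T t).Adj none (some x) ↔ t = ρ x := by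
  choose ρ hρ using fun x : ZMod (2 * m + 1) => (hT none (some x) (by simp)).exists
  exact ⟨ρ, fun x t => ⟨fun h => hT.eq h (hρ x), fun h => h ▸ hρ x⟩⟩

lemma graph_ext {G H : SimpleGraph (Option (ZMod (2 * m + 1)))}
    (h1 : ∀ x, G.Adj none (some x) ↔ H.Adj none (some x))
    (h2 : ∀ x (d : ℕ), 1 ≤ d → d ≤ m →
      (G.Adj (some x) (some (x + (d : ℕ))) ↔ H.Adj (some x) (some (x + (d : ℕ))))) : G = H := by
  ext u v
  match u, v with
  | none, none => simp
  | none, some x => exact h1 x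
  | some x, none => rw [G.adj_comm, H.adj_comm]; exact h1 x
  | some x, some y =>
    by_cases hxy : x = y
    · subst hxy; simp
    obtain ⟨d, hd, hd', rfl | rfl⟩ := exists_chord hxy
    · exact h2 x d hd hd'
    · rw [G.adj_comm, H.adj_comm]; exact h2 y d hd hd'

theorem IsNoncrossingPartition.exists_eq_profileGraph (hT : IsNoncrossingPartition T)
    {τ ρ : ZMod (2 * m + 1) → Fin (m + 1)}
    (hτ : ∀ x t, (T t).Adj (some x) (some (x + (m : ℕ))) ↔ t = τ x)
    (hρ : ∀ x t, (T t).Adj none (some x) ↔ t = ρ x) :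
    ∃ a, IsProfile m a ∧ ∀ t, T t = profileGraph a (τ ⁻¹' {t}) (ρ ⁻¹' {t}) := by
  obtain ⟨a, ha, h⟩ := hT.exists_profile hτ
  refine ⟨a, ha, fun t => graph_ext (fun x => ?_) fun x d h1 h2 => ?_⟩
  · rw [hρ, profileGraph_adj_none]
    exact eq_comm
  · rw [profileGraph_adj_chord h1 h2]
    have h3 := h d h1 h2 (x - (a d : ℕ))
    rw [show x - (a d : ZMod (2 * m + 1)) + (a d : ℕ) = x by ring,
      show x - (a d : ZMod (2 * m + 1)) + (a d + d : ℕ) = x + d by push_cast; ring] at h3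
    constructor
    · exact fun h4 => hT.partitions.eq h3 h4
    · rintro rfl
      exact h3

lemma IsNoncrossingPartition.eq_of_color_eq (hT : IsNoncrossingPartition T)
    {τ : ZMod (2 * m + 1) → Fin (m + 1)}
    (hτ : ∀ x t, (T t).Adj (some x) (some (x + (m : ℕ))) ↔ t = τ x) {x y : ZMod (2 * m + 1)}
    (h : τ x = τ y) (hxy : x ≠ y) : y = x + (m : ℕ) ∨ x = y + (m : ℕ) :=
  (hT.isNoncrossing (τ x)).longest ((hτ _ _).2 rfl) ((hτ _ _).2 h) hxy

/-- The longest chords at two different points at distance less than `m` cross. -/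
lemma IsNoncrossingPartition.color_ne (hT : IsNoncrossingPartition T)
    {τ : ZMod (2 * m + 1) → Fin (m + 1)}
    (hτ : ∀ x t, (T t).Adj (some x) (some (x + (m : ℕ))) ↔ t = τ x) (x : ZMod (2 * m + 1))
    {i j : ℕ} (hij : i < j) (hj : j < i + m) : τ (x + (i : ℕ)) ≠ τ (x + (j : ℕ)) := by
  intro h
  have e : x + (j : ℕ) = x + (i : ℕ) + (j - i : ℕ) := by
    rw [Nat.cast_sub hij.le]; ring
  refine (hT.isNoncrossing (τ (x + (i : ℕ)))).not_adj_of_lt (x := x + (i : ℕ)) (i := j - i)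
    (by omega) (by omega) ((hτ _ _).2 rfl) ?_
  rw [← e]
  exact (hτ _ _).2 h

/-- A noncrossing tree contains at most two longest chords. Two longest chords share an end, so
three of them form a triangle. -/
lemma IsNoncrossingPartition.card_color_le (hm : 1 ≤ m) (hT : IsNoncrossingPartition T)
    {τ : ZMod (2 * m + 1) → Fin (m + 1)}
    (hτ : ∀ x t, (T t).Adj (some x) (some (x + (m : ℕ))) ↔ t = τ x) (t : Fin (m + 1)) :
    (Finset.univ.filter fun x => τ x = t).card ≤ 2 := by
  by_contra! hcard
  obtain ⟨x, y, z, hx, hy, hz, hxy, hxz, hyz⟩ := Finset.two_lt_card_iff.1 hcard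
  simp only [Finset.mem_filter, Finset.mem_univ, true_and] at hx hy hz
  have h0 := two_mul_add_one_eq_zero (m := m)
  have hneg : ∀ u : ZMod (2 * m + 1), u = u + (m : ℕ) → False := fun u h =>
    add_self_ne hm u hm le_rfl h
  -- Up to renaming, the chords start at `u`, `u + m` and `u + 2m`.
  have key : ∀ u, τ u = t → τ (u + (m : ℕ)) = t → τ (u + (m : ℕ) + (m : ℕ)) = t → False := by
    intro u h1 h2 h3
    rcases hT.eq_of_color_eq hτ (h1.trans h3.symm) (by
      intro h
      have h4 : u + (0 : ℕ) = u + (2 * m : ℕ) := by push_cast; linear_combination h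
      have := add_natCast_inj h4 (by omega) (by omega)
      omega) with h | h
    · exact hneg (u + (m : ℕ)) h.symm
    have e1 := (hτ u t).2 h1.symm
    have e2 := (hτ _ t).2 h2.symm
    have e3 := (hτ _ t).2 h3.symm
    rw [← h] at e3
    refine (hT.isTree t).isAcyclic.cliqueFree (n := 3) le_rfl {some u, some (u + (m : ℕ)),
      some (u + (m : ℕ) + (m : ℕ))} ?_
    rw [is3Clique_triple_iff]
    exact ⟨e1, e3.symm, e2⟩
  have hR := fun {u v : ZMod (2 * m + 1)} (h1 : τ u = t) (h2 : τ v = t) (h : u ≠ v) =>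
    hT.eq_of_color_eq hτ (h1.trans h2.symm) h
  have hinj : ∀ {u v : ZMod (2 * m + 1)}, u + (m : ℕ) = v + (m : ℕ) → u = v :=
    fun h => add_right_cancel h
  have key2 : ∀ u v w, τ u = t → τ v = t → τ w = t → u ≠ v → u ≠ w → v ≠ w → v = u + (m : ℕ) →
      False := by
    intro u v w hu hv hw huv huw hvw h
    subst h
    rcases hR hu hw huw with h1 | rfl
    · exact hvw h1.symm
    · exact key w hw hu hv
  rcases hR hx hy hxy with h | h
  · exact key2 x y z hx hy hz hxy hxz hyz h
  · exact key2 y x z hy hx hz hxy.symm hyz hxz h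

/-- By counting, exactly one tree contains only one longest chord; all others contain two. -/
lemma IsNoncrossingPartition.exists_special (hm : 1 ≤ m) (hT : IsNoncrossingPartition T)
    {τ : ZMod (2 * m + 1) → Fin (m + 1)}
    (hτ : ∀ x t, (T t).Adj (some x) (some (x + (m : ℕ))) ↔ t = τ x) :
    ∃ k, (Finset.univ.filter fun x => τ x = k).card = 1 ∧
      ∀ t ≠ k, (Finset.univ.filter fun x => τ x = t).card = 2 := by
  set F : Fin (m + 1) → ℕ := fun t => (Finset.univ.filter fun x => τ x = t).card with hF
  have hle : ∀ t, F t ≤ 2 := hT.card_color_le hm hτ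
  have hsum : ∑ t, F t = 2 * m + 1 := by
    have := Finset.card_eq_sum_card_fiberwise (f := τ) (s := Finset.univ) (t := Finset.univ)
      (fun _ _ => Finset.mem_coe.2 (Finset.mem_univ _))
    rw [Finset.card_univ, ZMod.card] at this
    exact this.symm
  have hsum2 : ∑ t, (2 - F t) = 1 := by
    have : ∑ t, (2 - F t) + ∑ t, F t = ∑ _t : Fin (m + 1), 2 := by
      rw [← Finset.sum_add_distrib]
      exact Finset.sum_congr rfl fun t _ => Nat.sub_add_cancel (hle t)
    rw [hsum] at this
    simp at this
    omega
  obtain ⟨k, -, hk⟩ := Finset.exists_ne_zero_of_sum_ne_zero (hsum2.trans_ne one_ne_zero)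
  rw [← Finset.add_sum_erase _ _ (Finset.mem_univ k)] at hsum2
  refine ⟨k, ?_, fun t ht => ?_⟩
  · have := hle k
    change F k = 1
    omega
  · have h0 : ∑ t ∈ Finset.univ.erase k, (2 - F t) = 0 := by omega
    have := (Finset.sum_eq_zero_iff.1 h0) t (by simp [ht])
    have := hle t
    change F t = 2
    omega

section Special

variable {τ ρ : ZMod (2 * m + 1) → Fin (m + 1)} {k : Fin (m + 1)} {x₀ : ZMod (2 * m + 1)}

/-- The longest chords of the other trees are paired as `x₀ + j`, `x₀ + j + m` for `1 ≤ j ≤ m`. -/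
lemma IsNoncrossingPartition.color_add (hm : 1 ≤ m) (hT : IsNoncrossingPartition T)
    (hτ : ∀ x t, (T t).Adj (some x) (some (x + (m : ℕ))) ↔ t = τ x)
    (hx₀ : ∀ x, τ x = k ↔ x = x₀)
    (hcard : ∀ t ≠ k, (Finset.univ.filter fun x => τ x = t).card = 2) {j : ℕ} (hj : j ≤ m) :
    1 ≤ j → τ (x₀ + (j + m : ℕ)) = τ (x₀ + (j : ℕ)) := by
  -- Each chord other than the one at `x₀` has a partner.
  have hpartner : ∀ x, x ≠ x₀ → τ (x + (m : ℕ)) = τ x ∨ ∃ y, τ y = τ x ∧ x = y + (m : ℕ) := by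
    intro x hx
    have h2 := hcard (τ x) (fun h => hx ((hx₀ x).1 h))
    obtain ⟨y, hy, hyx⟩ := Finset.exists_mem_ne
      (show 1 < (Finset.univ.filter fun y => τ y = τ x).card by omega) x
    simp only [Finset.mem_filter, Finset.mem_univ, true_and] at hy
    rcases hT.eq_of_color_eq hτ hy.symm hyx.symm with rfl | h
    · exact Or.inl hy
    · exact Or.inr ⟨y, hy, h⟩
  have hne : ∀ j : ℕ, 1 ≤ j → j ≤ m → x₀ + (j : ℕ) ≠ x₀ := fun j h1 h2 h =>
    add_self_ne hm x₀ h1 h2 h.symm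
  induction hj using Nat.decreasingInduction with
  | self =>
    intro hm
    rcases hpartner (x₀ + (m : ℕ)) (hne m hm le_rfl) with h | ⟨y, hy, h⟩
    · rw [← h]; push_cast; rw [add_assoc]
    · have := add_right_cancel h
      rw [← this, (hx₀ x₀).2 rfl] at hy
      exact (hne m hm le_rfl ((hx₀ _).1 hy.symm)).elim
  | of_succ j hj ih =>
    intro h1
    rcases hpartner (x₀ + (j : ℕ)) (hne j h1 hj.le) with h | ⟨y, hy, h⟩
    · rw [← h]; push_cast; rw [add_assoc]
    · have e : y = x₀ + (j + 1 + m : ℕ) := by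
        push_cast
        linear_combination -h - two_mul_add_one_eq_zero (m := m)
      rw [e, ih (by omega)] at hy
      exact (hT.color_ne hτ x₀ (i := j) (j := j + 1) (by omega) (by omega) hy.symm).elim

/-- The radii of the special tree outside the arc of its longest chord. -/
lemma IsNoncrossingPartition.radius_color_of_lt (hT : IsNoncrossingPartition T)
    (hτ : ∀ x t, (T t).Adj (some x) (some (x + (m : ℕ))) ↔ t = τ x)
    (hρ : ∀ x t, (T t).Adj none (some x) ↔ t = ρ x) (hx₀ : ∀ x, τ x = k ↔ x = x₀) {i : ℕ}
    (hi : m < i) (hi' : i < 2 * m + 1) : ρ (x₀ + (i : ℕ)) = k := by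
  obtain ⟨a, ha, h⟩ := hT.exists_eq_profileGraph hτ hρ
  obtain ⟨w, hw⟩ := exists_adj (hT.isTree k).connected
    (show some (x₀ + (i : ZMod (2 * m + 1))) ≠ none by simp)
  match w with
  | none => exact ((hρ _ _).1 hw.symm).symm
  | some y =>
    rw [h, profileGraph_adj_some] at hw
    obtain ⟨x, hx, d, -, hd, h1⟩ := hw
    obtain rfl := (hx₀ x).1 hx
    have := ha.le hd
    rcases h1 with ⟨h1, -⟩ | ⟨-, h1⟩
    · have := add_natCast_inj h1 (by omega) (by omega)
      omega
    · have := add_natCast_inj h1 (by omega) (by omega)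
      omega

/-- The special tree has a further radius to an end of its longest chord. -/
lemma IsNoncrossingPartition.radius_color_end (hT : IsNoncrossingPartition T)
    (hτ : ∀ x t, (T t).Adj (some x) (some (x + (m : ℕ))) ↔ t = τ x)
    (hρ : ∀ x t, (T t).Adj none (some x) ↔ t = ρ x) (hx₀ : ∀ x, τ x = k ↔ x = x₀) :
    ρ x₀ = k ∨ ρ (x₀ + (m : ℕ)) = k := by
  obtain ⟨a, ha, h⟩ := hT.exists_eq_profileGraph hτ hρ
  obtain ⟨u, ⟨i, hi, rfl⟩, v, hv, huv⟩ := exists_adj_of_mem_of_notMem (hT.isTree k).connected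
    (S := {u | ∃ i : ℕ, i ≤ m ∧ u = some (x₀ + (i : ℕ))}) (u := some (x₀ + (0 : ℕ))) (v := none)
    ⟨0, by omega, rfl⟩ (by simp)
  match v with
  | none =>
    rcases Nat.eq_zero_or_pos i with rfl | h0
    · left; simpa using ((hρ _ _).1 huv.symm).symm
    rcases eq_or_lt_of_le hi with rfl | him
    · right; exact ((hρ _ _).1 huv.symm).symm
    obtain ⟨j, -, hj⟩ := hT.isNoncrossing k x₀ m le_rfl ((hτ _ _).2 ((hx₀ _).2 rfl).symm) i h0 him
      _ huv
    simp at hj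
  | some y =>
    rw [h, profileGraph_adj_some] at huv
    obtain ⟨x, hx, d, -, hd, h1⟩ := huv
    obtain rfl := (hx₀ x).1 hx
    have := ha.le hd
    rcases h1 with ⟨-, h1⟩ | ⟨h1, -⟩
    · exact (hv ⟨_, this, by rw [h1]⟩).elim
    · exact (hv ⟨a d, by omega, by rw [h1]⟩).elim

/-- If the further radius of the special tree ends at `x₀`, the radii of all other trees are
determined one after the other: the tree with longest chords at `x₀ + j` and `x₀ + j + m` can only
have a radius to `x₀ + j - 1` or `x₀ + j`. -/
lemma IsNoncrossingPartition.radius_color_eq (hm : 1 ≤ m) (hT : IsNoncrossingPartition T)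
    (hτ : ∀ x t, (T t).Adj (some x) (some (x + (m : ℕ))) ↔ t = τ x)
    (hρ : ∀ x t, (T t).Adj none (some x) ↔ t = ρ x) (hx₀ : ∀ x, τ x = k ↔ x = x₀)
    (hcard : ∀ t ≠ k, (Finset.univ.filter fun x => τ x = t).card = 2) (h0 : ρ x₀ = k) {j : ℕ}
    (h1 : 1 ≤ j) (hj : j ≤ m) : ρ (x₀ + (j : ℕ)) = τ (x₀ + (j : ℕ)) := by
  induction j with
  | zero => omega
  | succ j ih =>
    set t := τ (x₀ + (j + 1 : ℕ)) with ht
    have htk : t ≠ k := fun h => add_self_ne hm x₀ (by omega) hj ((hx₀ _).1 h).symm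
    obtain ⟨w, hw⟩ := exists_adj (hT.isTree t).connected
      (show none ≠ some (x₀ : ZMod (2 * m + 1)) by simp)
    match w with
    | none => exact (hw.ne rfl).elim
    | some x =>
      have hρx := (hρ _ _).1 hw
      obtain ⟨i, hi, rfl⟩ := exists_eq_add x₀ x
      have him : i ≤ m := by
        by_contra! h
        exact htk (hρx.trans (hT.radius_color_of_lt hτ hρ hx₀ h hi))
      have hi0 : i ≠ 0 := by
        rintro rfl
        rw [Nat.cast_zero, add_zero] at hρx
        exact htk (hρx.trans h0)
      have hle : i ≤ j + 1 := by
        by_contra! h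
        have hR : (T t).Adj (some (x₀ + (j + 1 : ℕ))) (some (x₀ + (j + 1 + m : ℕ))) := by
          rw [Nat.cast_add (j + 1) m, ← add_assoc]
          exact (hτ _ _).2 ht
        obtain ⟨_, -, -, h2⟩ := (hT.isNoncrossing t).mem_arc x₀ (j := i) h (by omega) (by omega) hR
          hw.symm
        simp at h2
      have hge : j ≤ i := by
        by_contra! h
        have hR : (T t).Adj (some (x₀ + (j + 1 + m : ℕ))) (some (x₀ + (j + 1 + m + m : ℕ))) := by
          rw [Nat.cast_add (j + 1 + m) m, ← add_assoc]
          exact (hτ _ _).2 (by rw [hT.color_add hm hτ hx₀ hcard hj h1])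
        rw [← add_natCast_mod x₀ (i := i + (2 * m + 1)) rfl] at hw
        obtain ⟨_, -, -, h2⟩ := (hT.isNoncrossing t).mem_arc x₀ (j := i + (2 * m + 1)) (by omega)
          (by omega) (by omega) hR hw.symm
        simp at h2
      rcases eq_or_lt_of_le hge with rfl | hlt
      · have h2 := ih (by omega) (by omega)
        exact (hT.color_ne hτ x₀ (i := j) (j := j + 1) (by omega) (by omega)
          (h2.symm.trans hρx.symm)).elim
      · obtain rfl : i = j + 1 := by omega
        exact hρx.symm

/-- The points on the circle that are joined to the centre in the special tree. -/
def specialRadii (x₀ : ZMod (2 * m + 1)) : Set (ZMod (2 * m + 1)) :=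
  {x | x = x₀ ∨ ∃ i : ℕ, m < i ∧ i < 2 * m + 1 ∧ x = x₀ + (i : ℕ)}

/-- The special tree of a partition, with its longest chord at `x₀`. -/
abbrev specialTree (a : ℕ → ℕ) (x₀ : ZMod (2 * m + 1)) :
    SimpleGraph (Option (ZMod (2 * m + 1))) :=
  profileGraph a {x₀} (specialRadii x₀)

/-- The other trees of a partition, with longest chords at `s` and `s + m` and a radius to `s`. -/
abbrev rotatedTree (a : ℕ → ℕ) (s : ZMod (2 * m + 1)) :
    SimpleGraph (Option (ZMod (2 * m + 1))) :=
  profileGraph a {s, s + (m : ℕ)} {s}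

/-- The normal form of a partition whose special tree has a radius to the start `x₀` of its longest
chord. -/
lemma IsNoncrossingPartition.exists_normal_form_aux (hm : 1 ≤ m) (hT : IsNoncrossingPartition T)
    (hτ : ∀ x t, (T t).Adj (some x) (some (x + (m : ℕ))) ↔ t = τ x)
    (hρ : ∀ x t, (T t).Adj none (some x) ↔ t = ρ x) (hx₀ : ∀ x, τ x = k ↔ x = x₀)
    (hcard : ∀ t ≠ k, (Finset.univ.filter fun x => τ x = t).card = 2) (h0 : ρ x₀ = k) :
    ∃ a, IsProfile m a ∧ T k = specialTree a x₀ ∧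
      ∀ t ≠ k, ∃ s : ZMod (2 * m + 1), T t = rotatedTree a s := by
  obtain ⟨a, ha, h⟩ := hT.exists_eq_profileGraph hτ hρ
  have hρj := fun j h1 h2 => hT.radius_color_eq hm hτ hρ hx₀ hcard h0 (j := j) h1 h2
  have hadd := fun j h1 h2 => hT.color_add hm hτ hx₀ hcard (j := j) h1 h2
  have hne : ∀ j : ℕ, 1 ≤ j → j ≤ m → τ (x₀ + (j : ℕ)) ≠ k := fun j h1 h2 h =>
    add_self_ne hm x₀ h1 h2 ((hx₀ _).1 h).symm
  have hcases : ∀ x, x = x₀ ∨ (∃ j : ℕ, 1 ≤ j ∧ j ≤ m ∧ x = x₀ + (j : ℕ)) ∨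
      ∃ j : ℕ, 1 ≤ j ∧ j ≤ m ∧ x = x₀ + (j + m : ℕ) := by
    intro x
    obtain ⟨i, hi, rfl⟩ := exists_eq_add x₀ x
    rcases Nat.eq_zero_or_pos i with rfl | h1
    · exact Or.inl (by simp)
    by_cases h2 : i ≤ m
    · exact Or.inr (Or.inl ⟨i, h1, h2, rfl⟩)
    · exact Or.inr (Or.inr ⟨i - m, by omega, by omega, by rw [Nat.sub_add_cancel (by omega)]⟩)
  have hinj : ∀ i j : ℕ, 1 ≤ i → i ≤ m → 1 ≤ j → j ≤ m → τ (x₀ + (i : ℕ)) = τ (x₀ + (j : ℕ)) →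
      i = j := by
    intro i j h1 h2 h3 h4 h5
    rcases lt_trichotomy i j with h | h | h
    · exact (hT.color_ne hτ x₀ h (by omega) h5).elim
    · exact h
    · exact (hT.color_ne hτ x₀ h (by omega) h5.symm).elim
  have hρ2 : ∀ j, 1 ≤ j → j ≤ m → ρ (x₀ + (j + m : ℕ)) = k := fun j h1 h2 =>
    hT.radius_color_of_lt hτ hρ hx₀ (by omega) (by omega)
  refine ⟨a, ha, ?_, fun t ht => ?_⟩
  · rw [h k]
    unfold specialTree
    congr 1
    · ext x; simp [hx₀]
    · ext x
      simp only [Set.mem_preimage, Set.mem_singleton_iff, specialRadii, Set.mem_ofPred_eq]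
      constructor
      · intro hx
        rcases hcases x with rfl | ⟨j, h1, h2, rfl⟩ | ⟨j, h1, h2, rfl⟩
        · exact Or.inl rfl
        · exact (hne j h1 h2 ((hρj j h1 h2).symm.trans hx)).elim
        · exact Or.inr ⟨j + m, by omega, by omega, rfl⟩
      · rintro (rfl | ⟨i, h1, h2, rfl⟩)
        · exact h0
        · exact hT.radius_color_of_lt hτ hρ hx₀ h1 h2
  · have ht2 := hcard t ht
    obtain ⟨x, hx⟩ := Finset.card_pos.1 (by omega : 0 < (Finset.univ.filter fun x => τ x = t).card)
    obtain ⟨j, h1, h2, rfl⟩ : ∃ j : ℕ, 1 ≤ j ∧ j ≤ m ∧ t = τ (x₀ + (j : ℕ)) := by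
      simp only [Finset.mem_filter, Finset.mem_univ, true_and] at hx
      rcases hcases x with rfl | ⟨j, h1, h2, rfl⟩ | ⟨j, h1, h2, rfl⟩
      · exact (ht (hx.symm.trans ((hx₀ x).2 rfl))).elim
      · exact ⟨j, h1, h2, hx.symm⟩
      · exact ⟨j, h1, h2, by rw [← hx, hadd j h2 h1]⟩
    refine ⟨x₀ + (j : ℕ), ?_⟩
    rw [h]
    unfold rotatedTree
    congr 1
    · ext x
      simp only [Set.mem_preimage, Set.mem_singleton_iff, Set.mem_insert_iff]
      rw [add_assoc, ← Nat.cast_add]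
      constructor
      · intro hx
        rcases hcases x with rfl | ⟨i, h3, h4, rfl⟩ | ⟨i, h3, h4, rfl⟩
        · exact (ht (hx.symm.trans ((hx₀ x).2 rfl))).elim
        · exact Or.inl (by rw [hinj i j h3 h4 h1 h2 hx])
        · rw [hadd i h4 h3] at hx
          exact Or.inr (by rw [hinj i j h3 h4 h1 h2 hx])
      · rintro (rfl | rfl)
        · rfl
        · exact hadd j h2 h1
    · ext x
      simp only [Set.mem_preimage, Set.mem_singleton_iff]
      constructor
      · intro hx
        rcases hcases x with rfl | ⟨i, h3, h4, rfl⟩ | ⟨i, h3, h4, rfl⟩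
        · exact (ht (hx.symm.trans h0)).elim
        · rw [hρj i h3 h4] at hx
          rw [hinj i j h3 h4 h1 h2 hx]
        · exact (ht (hx.symm.trans (hρ2 i h3 h4))).elim
      · rintro rfl
        exact hρj j h1 h2

end Special

/-- The reflection of the wheel that fixes the centre and the point `0`. -/
def reflection (m : ℕ) : Option (ZMod (2 * m + 1)) ≃ Option (ZMod (2 * m + 1)) :=
  (Equiv.neg _).optionCongr

@[simp] lemma reflection_none : reflection m none = none := rfl

@[simp] lemma reflection_some (x : ZMod (2 * m + 1)) : reflection m (some x) = some (-x) := rfl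

lemma IsNoncrossing.comap_reflection (h : IsNoncrossing G) :
    IsNoncrossing (G.comap (reflection m)) := by
  intro x d hd hx j h0 hj w hw
  simp only [comap_adj, reflection_some] at hx hw
  rw [show -(x + (d : ZMod (2 * m + 1))) = -(x + d) from rfl] at hx
  have e1 : -(x + (j : ℕ)) = -(x + (d : ℕ)) + (d - j : ℕ) := by
    rw [Nat.cast_sub hj.le]; ring
  have e2 : -x = -(x + (d : ℕ)) + (d : ℕ) := by ring
  rw [e1] at hw
  rw [e2] at hx
  obtain ⟨i, hi, h1⟩ := h _ d hd hx.symm (d - j) (by omega) (by omega) _ hw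
  refine ⟨d - i, by omega, ?_⟩
  apply (reflection m).injective
  rw [h1, reflection_some, Nat.cast_sub hi]
  congr 1
  ring

lemma IsNoncrossingPartition.comap_reflection (hT : IsNoncrossingPartition T) :
    IsNoncrossingPartition fun t => (T t).comap (reflection m) where
  partitions _ _ huv := hT.partitions _ _ ((reflection m).injective.ne huv)
  isTree t := (Iso.comap (reflection m) (T t)).isTree_iff.2 (hT.isTree t)
  isNoncrossing t := (hT.isNoncrossing t).comap_reflection

/-- After a reflection, the special tree contains the radius to the start of its longest chord, and
then the partition is determined by the profile and the place of the longest chord of the special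
tree. -/
theorem IsNoncrossingPartition.exists_normal_form (hm : 1 ≤ m) (hT : IsNoncrossingPartition T) :
    ∃ e, (e = Equiv.refl _ ∨ e = reflection m) ∧ ∃ a k x₀, IsProfile m a ∧
      (T k).comap e = specialTree a x₀ ∧
      ∀ t ≠ k, ∃ s : ZMod (2 * m + 1), (T t).comap e = rotatedTree a s := by
  obtain ⟨τ, hτ⟩ := exists_longest_color hm hT.partitions
  obtain ⟨ρ, hρ⟩ := exists_radius_color hT.partitions
  obtain ⟨k, hk, hcard⟩ := hT.exists_special hm hτ
  obtain ⟨x₀, hx₀⟩ := Finset.card_eq_one.1 hk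
  replace hx₀ : ∀ x, τ x = k ↔ x = x₀ := fun x => by
    simpa using Finset.ext_iff.1 hx₀ x
  rcases hT.radius_color_end hτ hρ hx₀ with h0 | h0
  · obtain ⟨a, ha, h1, h2⟩ := hT.exists_normal_form_aux hm hτ hρ hx₀ hcard h0
    exact ⟨Equiv.refl _, Or.inl rfl, a, k, x₀, ha, h1, h2⟩
  · have hneg : ∀ x : ZMod (2 * m + 1), -(x + (m : ℕ)) + (m : ℕ) = -x := fun x => by ring
    obtain ⟨a, ha, h1, h2⟩ := hT.comap_reflection.exists_normal_form_aux hm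
      (τ := fun x => τ (-(x + (m : ℕ)))) (ρ := fun x => ρ (-x)) (k := k) (x₀ := -(x₀ + (m : ℕ)))
      (fun x t => by
        rw [← hτ, hneg, adj_comm]
        rfl)
      (fun x t => by rw [← hρ]; rfl)
      (fun x => by
        rw [hx₀]
        constructor
        · rintro rfl; ring
        · rintro rfl; ring)
      (fun t ht => by
        refine (Finset.card_bij (fun (x : ZMod (2 * m + 1)) _ => -(x + (m : ℕ))) (by simp) (by simp)
          fun y hy => ?_).trans (hcard t ht)
        refine ⟨-(y + (m : ℕ)), ?_, by ring⟩
        simp only [Finset.mem_filter, Finset.mem_univ, true_and] at hy ⊢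
        rw [← hy]
        congr 1
        ring)
      (by simpa using h0)
    exact ⟨reflection m, Or.inr rfl, a, k, _, ha, h1, h2⟩

end

/-! ### Caterpillars -/

section

lemma _root_.IsCaterpillar.of_iso {V W : Type*} {G : SimpleGraph V} {H : SimpleGraph W} (e : G ≃g H)
    (h : IsCaterpillar H) : IsCaterpillar G := by
  obtain ⟨ht, k, ⟨φ⟩⟩ := h
  have hdeg : ∀ v, (G.neighborSet v).ncard = (H.neighborSet (e v)).ncard := by
    intro v
    exact Nat.card_congr (e.mapNeighborSet v)
  let ψ : G.induce {v | (G.neighborSet v).ncard ≠ 1} ≃g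
      H.induce {v | (H.neighborSet v).ncard ≠ 1} :=
    ⟨e.toEquiv.subtypeEquiv fun v => by simp only [Set.mem_ofPred_eq, hdeg]; rfl,
      fun {_ _} => e.map_adj_iff⟩
  exact ⟨e.isTree_iff.2 ht, k, ⟨ψ.trans φ⟩⟩

/-- A connected graph on `L + 1` vertices whose edges are numbered from `1` to `L` is a tree. -/
lemma isTree_of_card {V : Type*} {G : SimpleGraph V} {L : ℕ} [Finite V] (hG : G.Connected)
    (hcard : Nat.card V = L + 1) (f : ℕ → Sym2 V)
    (hf : ∀ e ∈ G.edgeSet, ∃ i, 1 ≤ i ∧ i ≤ L ∧ f i = e) : G.IsTree := by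
  rw [isTree_iff_connected_and_card]
  refine ⟨hG, le_antisymm ?_ hG.card_vert_le_card_edgeSet_add_one⟩
  rw [hcard, Nat.add_le_add_iff_right]
  have h1 : G.edgeSet ⊆ f '' (Finset.Icc 1 L) := fun e he => by
    obtain ⟨i, h1, h2, h3⟩ := hf e he
    exact ⟨i, by simp [h1, h2], h3⟩
  calc Nat.card G.edgeSet = G.edgeSet.ncard := rfl
    _ ≤ (f '' (Finset.Icc 1 L)).ncard := Set.ncard_le_ncard h1
    _ ≤ (Finset.Icc 1 L : Set ℕ).ncard := Set.ncard_image_le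
    _ = L := by rw [Set.ncard_coe_finset]; simp

/-- A graph whose vertices are added one at a time, each new vertex being joined either to the
neighbour of the preceding one or to the preceding one itself, is a caterpillar. -/
lemma isCaterpillar_of_parent {L : ℕ} (H : SimpleGraph (Fin (L + 1))) (par : ℕ → ℕ)
    (h1 : par 1 = 0) (hpar : ∀ i, 1 ≤ i → par (i + 1) = par i ∨ par (i + 1) = i)
    (hadj : ∀ i j : Fin (L + 1), H.Adj i j ↔
      (1 ≤ j.val ∧ par j = i.val) ∨ (1 ≤ i.val ∧ par i = j.val)) : IsCaterpillar H := by
  have hlt : ∀ i, 1 ≤ i → par i < i := by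
    intro i hi
    induction i, hi using Nat.le_induction with
    | base => omega
    | succ i hi ih => rcases hpar i hi with h | h <;> omega
  have hmono : ∀ i j, 1 ≤ i → i ≤ j → par i ≤ par j := by
    intro i j hi hij
    induction j, hij using Nat.le_induction with
    | base => exact le_rfl
    | succ j hj ih =>
      have := hlt j (by omega)
      rcases hpar j (by omega) with h | h <;> omega
  -- A vertex with a later neighbour is the parent of its successor.
  have hsucc : ∀ x y, 1 ≤ x → 1 ≤ y → par y = x → par (x + 1) = x := by
    intro x y hx hy hxy
    refine (hpar x hx).resolve_left fun h => ?_
    have hxl := hlt x hx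
    have : ∀ j, x + 1 ≤ j → par j ≠ x := by
      intro j hj
      induction j, hj using Nat.le_induction with
      | base => omega
      | succ j hj ih => rcases hpar j (by omega) with h | h <;> omega
    have := hlt y hy
    exact ‹∀ j, x + 1 ≤ j → par j ≠ x› y (by omega) hxy
  have htree : H.IsTree := by
    refine isTree_of_card ?_ (by simp) (L := L)
      (fun i => s(Fin.ofNat (L + 1) (par i), Fin.ofNat (L + 1) i)) ?_
    · have h0 : ∀ i (hi : i < L + 1), H.Reachable ⟨i, hi⟩ 0 := by
        intro i
        induction i using Nat.strong_induction_on with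
        | _ i ih =>
          intro hi
          rcases Nat.eq_zero_or_pos i with rfl | hpos
          · rfl
          · have hp := hlt i hpos
            refine Reachable.trans (Adj.reachable ?_) (ih (par i) hp (by omega))
            exact (hadj _ _).2 (Or.inr ⟨hpos, rfl⟩)
      exact ⟨fun i j => (h0 i i.2).trans (h0 j j.2).symm⟩
    · rintro e he
      induction e with
      | _ i j =>
        have hij := (hadj _ _).1 he
        have hval : ∀ i : Fin (L + 1), Fin.ofNat (L + 1) i.val = i := fun i => by
          ext; simp
        rcases hij with ⟨h2, h3⟩ | ⟨h2, h3⟩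
        · exact ⟨j, h2, by omega, by rw [h3, hval, hval]⟩
        · exact ⟨i, h2, by omega, by rw [h3, hval, hval, Sym2.eq_swap]⟩
  have hleaf : ∀ x : Fin (L + 1), 1 ≤ x.val → ((H.neighborSet x).ncard ≠ 1 ↔
      ∃ y : Fin (L + 1), 1 ≤ y.val ∧ par y = x.val) := by
    intro x hx
    have hp := hlt x hx
    have hpx : H.Adj x ⟨par x, by omega⟩ := (hadj _ _).2 (Or.inr ⟨hx, rfl⟩)
    constructor
    · intro h
      by_contra! hno
      refine h (Set.ncard_eq_one.2 ⟨⟨par x, by omega⟩, ?_⟩)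
      ext y
      simp only [mem_neighborSet, Set.mem_singleton_iff]
      constructor
      · intro hxy
        rcases (hadj _ _).1 hxy with ⟨h2, h3⟩ | ⟨h2, h3⟩
        · exact (hno y h2 h3).elim
        · ext; exact h3.symm
      · rintro rfl; exact hpx
    · rintro ⟨y, hy, hyx⟩ h
      obtain ⟨z, hz⟩ := Set.ncard_eq_one.1 h
      have h2 : y ∈ H.neighborSet x := (hadj _ _).2 (Or.inl ⟨hy, hyx⟩)
      have h3 : (⟨par x, by omega⟩ : Fin (L + 1)) ∈ H.neighborSet x := hpx
      rw [hz, Set.mem_singleton_iff] at h2 h3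
      have h4 := hlt y hy
      have h5 : par x = y.val := by rw [h2, ← h3]
      omega
  refine ⟨htree, ?_⟩
  classical
  set S : Set (Fin (L + 1)) := {v | (H.neighborSet v).ncard ≠ 1} with hS
  let e := Fintype.orderIsoFinOfCardEq S rfl
  -- Two nonleaves are adjacent exactly if they are consecutive among the nonleaves.
  have key : ∀ x y : S, x < y → (H.Adj x y ↔ x ⋖ y) := by
    rintro ⟨x, hx⟩ ⟨y, hy⟩ hxy
    replace hxy : x.val < y.val := hxy
    have hadj' : H.Adj x y ↔ par y = x.val := by
      rw [hadj]
      constructor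
      · rintro (⟨-, h⟩ | ⟨h2, h⟩)
        · exact h
        · have := hlt x h2; omega
      · exact fun h => Or.inl ⟨by omega, h⟩
    refine hadj'.trans ⟨fun h => ⟨hxy, ?_⟩, fun h => ?_⟩
    · rintro ⟨z, hz⟩ h2 h3
      replace h2 : x.val < z.val := h2
      replace h3 : z.val < y.val := h3
      obtain ⟨c, hc, hcz⟩ := (hleaf z (by omega)).1 hz
      have h4 := hsucc z c (by omega) hc hcz
      have h5 := hmono (z.val + 1) y (by omega) (by omega)
      omega
    · have hp := hlt y (by omega)
      have hxp : x.val ≤ par y := by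
        rcases Nat.eq_zero_or_pos x.val with h0 | h0
        · omega
        obtain ⟨c, hc, hcz⟩ := (hleaf x h0).1 hx
        have h4 := hsucc x c h0 hc hcz
        have h5 := hmono (x.val + 1) y (by omega) (by omega)
        omega
      by_contra hne
      refine h.2 (c := ⟨⟨par y, by omega⟩, ?_⟩) (show x.val < par y by omega) hp
      exact (hleaf ⟨par y, by omega⟩ (show 1 ≤ par y by omega)).2 ⟨y, by omega, rfl⟩
  refine ⟨Fintype.card S, ⟨⟨e.symm.toEquiv, ?_⟩⟩⟩
  intro x y
  change (hasse _).Adj (e.symm x) (e.symm y) ↔ H.Adj x y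
  rw [hasse_adj, apply_covBy_apply_iff, apply_covBy_apply_iff]
  rcases lt_trichotomy x y with h | h | h
  · rw [key x y h]
    exact ⟨fun h' => h'.resolve_right fun h2 => h.not_gt h2.lt, Or.inl⟩
  · subst h
    simp
  · rw [H.adj_comm, key y x h]
    exact ⟨fun h' => h'.resolve_left fun h2 => h.not_gt h2.lt, Or.inr⟩

/-- A graph whose edges join the ends of the intervals of a growing sequence of integer intervals
with `2, 3, …, L + 1` elements is a caterpillar. -/
lemma isCaterpillar_of_intervals {V : Type*} {G : SimpleGraph V} {L : ℕ} (b : ℕ → ℤ)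
    (hb : ∀ d < L, b (d + 1) = b d ∨ b (d + 1) = b d - 1) (w : ℤ → V)
    (hw : ∀ x, ∃ i, b L ≤ i ∧ i ≤ b L + L ∧ w i = x) (hcard : Nat.card V = L + 1)
    (hadj : ∀ x y, G.Adj x y ↔ ∃ d, 1 ≤ d ∧ d ≤ L ∧ s(x, y) = s(w (b d), w (b d + d))) :
    IsCaterpillar G := by
  classical
  -- `new d` is the end of the `d`-th interval that is not in the preceding interval.
  let new : ℕ → ℤ := fun d => if b d = b (d - 1) then b d + d else b d
  let old : ℕ → ℤ := fun d => if b d = b (d - 1) then b d else b d + d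
  let par : ℕ → ℕ := fun k =>
    Nat.rec 0 (fun d p => if d < L ∧ (b (d + 1) = b d ↔ b d = b (d - 1)) then p else d) k
  have hpar : ∀ d, par (d + 1) =
    if d < L ∧ (b (d + 1) = b d ↔ b d = b (d - 1)) then par d else d := fun d => rfl
  have hold : ∀ d, d + 1 ≤ L → old (d + 1) = new (par (d + 1)) := by
    intro d
    induction d with
    | zero =>
      intro hL
      have : par (0 + 1) = 0 := by rw [hpar]; split_ifs <;> rfl
      rw [this]
      simp only [old, new]
      have := hb 0 (by omega)
      split_ifs <;> simp_all
    | succ d ih =>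
      intro hL
      have h1 := ih (by omega)
      have h2 := hb (d + 1) (by omega)
      have hL' : d + 1 < L := by omega
      rw [hpar]
      simp only [hL', true_and]
      by_cases h3 : b (d + 1 + 1) = b (d + 1) <;> by_cases h4 : b (d + 1) = b d
      · simp only [h3, h4, Nat.add_sub_cancel, if_true]
        rw [← h1]
        simp [old, h3, h4]
      · simp [h3, h4, old, new]
      · simp only [h4, Nat.add_sub_cancel, iff_true]
        replace h2 := h2.resolve_left h3
        rw [h4] at h3 h2
        simp only [old, new, Nat.add_sub_cancel, h4, h3, if_false, if_true]
        rw [h2]; push_cast; ring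
      · simp only [h3, h4, Nat.add_sub_cancel, if_true]
        rw [← h1]
        replace h2 := h2.resolve_left h3
        simp only [old, Nat.add_sub_cancel, h3, h4, if_false]
        rw [h2]; push_cast; ring
  have hpair : ∀ d, s(w (b d), w (b d + d)) = s(w (old d), w (new d)) := by
    intro d
    simp only [old, new]
    split_ifs
    · rfl
    · exact Sym2.eq_swap
  have hcover : ∀ d ≤ L, ∀ x, b d ≤ x → x ≤ b d + d → ∃ i ≤ d, new i = x := by
    intro d
    induction d with
    | zero =>
      intro _ x h1 h2
      exact ⟨0, le_rfl, by simp [new] at *; omega⟩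
    | succ d ih =>
      intro hd x h1 h2
      push_cast at h2
      by_cases hx : b d ≤ x ∧ x ≤ b d + d
      · obtain ⟨i, hi, rfl⟩ := ih (by omega) x hx.1 hx.2
        exact ⟨i, by omega, rfl⟩
      · refine ⟨d + 1, le_rfl, ?_⟩
        have := hb d (by omega)
        simp only [new, Nat.add_sub_cancel]
        split_ifs <;> push_cast <;> omega
  have : Finite V := Nat.finite_of_card_ne_zero (by omega)
  have hsurj : Function.Surjective fun i : Fin (L + 1) => w (new i) := by
    intro x
    obtain ⟨y, h1, h2, rfl⟩ := hw x
    obtain ⟨i, hi, rfl⟩ := hcover L le_rfl y h1 h2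
    exact ⟨⟨i, by omega⟩, rfl⟩
  have hbij : Function.Bijective fun i : Fin (L + 1) => w (new i) :=
    (Nat.bijective_iff_surjective_and_card _).2 ⟨hsurj, by simp [hcard]⟩
  let f : Fin (L + 1) ≃ V := Equiv.ofBijective _ hbij
  have hparlt : ∀ d, par (d + 1) ≤ d := by
    intro d
    induction d with
    | zero => rw [hpar]; split_ifs <;> exact le_rfl
    | succ d ih => rw [hpar]; split_ifs <;> omega
  have hpar1 : par 1 = 0 := by
    have := hparlt 0
    simpa using this
  refine IsCaterpillar.of_iso (Iso.comap f G).symm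
    (isCaterpillar_of_parent (G.comap f) par hpar1 (fun i hi => ?_) fun i j => ?_)
  · rw [hpar]
    split_ifs
    · exact Or.inl rfl
    · exact Or.inr rfl
  · have hedge : ∀ d (h1 : 1 ≤ d) (h2 : d ≤ L), s(w (b d), w (b d + d)) =
        s(f ⟨par d, by have := hparlt (d - 1); rw [Nat.sub_add_cancel h1] at this; omega⟩,
          f ⟨d, by omega⟩) := by
      intro d h1 h2
      have := hold (d - 1) (by omega)
      rw [Nat.sub_add_cancel h1] at this
      rw [hpair, this]
      rfl
    rw [comap_adj, hadj]
    constructor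
    · rintro ⟨d, h1, h2, h3⟩
      rw [hedge d h1 h2, Sym2.eq_iff] at h3
      rcases h3 with ⟨h3, h4⟩ | ⟨h3, h4⟩
      · obtain rfl := f.injective h3
        obtain rfl := f.injective h4
        exact Or.inl ⟨h1, rfl⟩
      · obtain rfl := f.injective h3
        obtain rfl := f.injective h4
        exact Or.inr ⟨h1, rfl⟩
    · rintro (⟨h1, h2⟩ | ⟨h1, h2⟩)
      · refine ⟨j, h1, by omega, ?_⟩
        rw [hedge j h1 (by omega)]
        simp only [h2]
      · refine ⟨i, h1, by omega, ?_⟩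
        rw [hedge i h1 (by omega), Sym2.eq_swap]
        simp only [h2]

end

/-! ### The special tree is a caterpillar -/

section

variable {m : ℕ}

lemma IsProfile.nested {a : ℕ → ℕ} (ha : IsProfile m a) {d e : ℕ} (hde : d ≤ e) (he : e ≤ m) :
    a e ≤ a d ∧ a d + d ≤ a e + e := by
  induction hde using Nat.decreasingInduction with
  | self => exact ⟨le_rfl, le_rfl⟩
  | of_succ k hk ih => rcases ha.step k (by omega) with h | h <;> omega

lemma profileGraph_adj {a : ℕ → ℕ} {J R : Set (ZMod (2 * m + 1))}
    {u v : Option (ZMod (2 * m + 1))} : (profileGraph a J R).Adj u v ↔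
      (∃ x ∈ J, ∃ d, 1 ≤ d ∧ d ≤ m ∧ s(u, v) = s(some (x + (a d : ℕ)), some (x + (a d + d : ℕ)))) ∨
        ∃ x ∈ R, s(u, v) = s(none, some x) := by
  match u, v with
  | none, none => simp
  | none, some x => simp [profileGraph_adj_none]
  | some x, none => rw [adj_comm]; simp [profileGraph_adj_none]
  | some x, some y => simp [profileGraph_adj_some, and_comm (a := y = _)]

lemma sym2_apply_eq {V W : Type*} (q : V ≃ W) (u v u' v' : V) :
    s(q u, q v) = s(q u', q v') ↔ s(u, v) = s(u', v') := by
  simp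

variable {V : Type*} {T : SimpleGraph V} (q : Option (ZMod (2 * m + 1)) ≃ V) {a : ℕ → ℕ}

lemma natCard_eq (q : Option (ZMod (2 * m + 1)) ≃ V) : Nat.card V = 2 * m + 2 := by
  rw [← Nat.card_congr q]
  simp

lemma exists_int_eq (s : ZMod (2 * m + 1)) (lo : ℤ) (y : ZMod (2 * m + 1)) :
    ∃ i : ℤ, lo ≤ i ∧ i ≤ lo + (2 * m : ℕ) ∧ s + (i : ZMod (2 * m + 1)) = y := by
  obtain ⟨k, hk, rfl⟩ := exists_eq_add (s + (lo : ZMod (2 * m + 1))) y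
  exact ⟨lo + k, by omega, by push_cast; omega, by push_cast; ring⟩

/-- In the cyclic order of the points, with the centre inserted between `x₀ + m` and `x₀ + m + 1`,
the edges of the special tree join the ends of growing intervals: first of the nested arcs, and then
of intervals with the centre at their right end. -/
theorem isCaterpillar_special {x₀ : ZMod (2 * m + 1)} (ha : IsProfile m a)
    (hT : T.comap q = specialTree a x₀) : IsCaterpillar T := by
  let b : ℕ → ℤ := fun d => if d ≤ m then a d else m + 1 - d
  let w : ℤ → V := fun i => if i = m + 1 then q none else q (some (x₀ + (i : ZMod (2 * m + 1))))
  have hw' : ∀ i : ℤ, i ≠ m + 1 → w i = q (some (x₀ + (i : ZMod (2 * m + 1)))) := fun i hi => by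
    simp [w, hi]
  have hw0 : w (m + 1) = q none := by simp [w]
  have hb1 : ∀ d ≤ m, b d = a d := fun d hd => by simp [b, hd]
  have hb2 : ∀ d, m < d → b d = m + 1 - d := fun d hd => by simp [b, hd.not_ge]
  refine isCaterpillar_of_intervals (L := 2 * m + 1) b (fun d hd => ?_) w (fun x => ?_)
    (natCard_eq q) fun x y => ?_
  · rcases lt_trichotomy d m with h | rfl | h
    · rw [hb1 (d + 1) h, hb1 d h.le]
      have := ha.step d h
      omega
    · rw [hb1 _ le_rfl, hb2 _ (by omega), ha.top]
      push_cast
      omega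
    · rw [hb2 _ h, hb2 _ (by omega)]
      push_cast
      omega
  · rw [hb2 _ (by omega)]
    obtain ⟨u, rfl⟩ := q.surjective x
    match u with
    | none => exact ⟨m + 1, by push_cast; omega, by push_cast; omega, hw0⟩
    | some y =>
      obtain ⟨i, h1, h2, rfl⟩ := exists_int_eq x₀ (-m) y
      exact ⟨i, by push_cast; omega, by push_cast at *; omega, hw' i (by push_cast at h2; omega)⟩
  · obtain ⟨u, rfl⟩ := q.surjective x
    obtain ⟨v, rfl⟩ := q.surjective y
    have hadj : T.Adj (q u) (q v) ↔ (specialTree a x₀).Adj u v := by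
      rw [← hT]; rfl
    rw [hadj, profileGraph_adj]
    have e1 : ∀ d, 1 ≤ d → d ≤ m → s(w (b d), w (b d + d)) =
        s(q (some (x₀ + (a d : ℕ))), q (some (x₀ + (a d + d : ℕ)))) := by
      intro d h1 h2
      have := ha.le h2
      rw [hb1 d h2, hw' _ (by omega), hw' _ (by omega)]
      push_cast
      rfl
    have e2 : ∀ d, m < d → s(w (b d), w (b d + d)) =
        s(q (some (x₀ + ((m + 1 - d : ℤ) : ZMod (2 * m + 1)))), q none) := by
      intro d h1
      rw [hb2 d h1, hw' _ (by omega), show (m + 1 - d + d : ℤ) = m + 1 by ring, hw0]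
    constructor
    · rintro (⟨x, rfl, d, h1, h2, h⟩ | ⟨x, hx, h⟩)
      · refine ⟨d, h1, by omega, ?_⟩
        rw [e1 d h1 h2, sym2_apply_eq, h]
      · rcases hx with rfl | ⟨i, h1, h2, rfl⟩
        · refine ⟨m + 1, by omega, by omega, ?_⟩
          rw [e2 _ (by omega), sym2_apply_eq, h, Sym2.eq_swap]
          simp
        · refine ⟨3 * m + 2 - i, by omega, by omega, ?_⟩
          rw [e2 _ (by omega), sym2_apply_eq, h, Sym2.eq_swap]
          congr 3
          rw [Nat.cast_sub (by omega)]
          push_cast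
          linear_combination (two_mul_add_one_eq_zero (m := m))
    · rintro ⟨d, h1, h2, h⟩
      by_cases hd : d ≤ m
      · rw [e1 d h1 hd, sym2_apply_eq] at h
        exact Or.inl ⟨x₀, rfl, d, h1, hd, h⟩
      · rw [e2 d (by omega), sym2_apply_eq, Sym2.eq_swap (a := some _)] at h
        refine Or.inr ⟨_, ?_, h⟩
        by_cases hd1 : d = m + 1
        · left; subst hd1; simp
        · right
          refine ⟨3 * m + 2 - d, by omega, by omega, ?_⟩
          rw [Nat.cast_sub (by omega)]
          push_cast
          linear_combination -(two_mul_add_one_eq_zero (m := m))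

/-! ### The other trees are `w`-caterpillars -/

/-- Without the centre, a rotated tree is a caterpillar. -/
theorem isCaterpillar_rotated_sub {s : ZMod (2 * m + 1)} (ha : IsProfile m a)
    (hT : T.comap q = rotatedTree a s) :
    IsCaterpillar (T.induce ({q none}ᶜ : Set V)) := by
  -- The arcs in the second half are replaced by the complementary ones.
  let b : ℕ → ℤ := fun d => if d ≤ m then a d else a (2 * m + 1 - d) + m - d
  have hmem : ∀ y : ZMod (2 * m + 1), q (some y) ∈ ({q none}ᶜ : Set V) := fun y => by simp
  let w : ℤ → ({q none}ᶜ : Set V) := fun i => ⟨q (some (s + (i : ZMod (2 * m + 1)))), hmem _⟩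
  have hb1 : ∀ d ≤ m, b d = a d := fun d hd => by simp [b, hd]
  have hb2 : ∀ d, m < d → b d = a (2 * m + 1 - d) + m - d := fun d hd => by simp [b, hd.not_ge]
  have : Finite V := Finite.of_equiv _ q
  refine isCaterpillar_of_intervals (L := 2 * m) b (fun d hd => ?_) w (fun x => ?_) ?_ fun x y => ?_
  · rcases lt_trichotomy d m with h | rfl | h
    · rw [hb1 (d + 1) h, hb1 d h.le]
      have := ha.step d h
      omega
    · rw [hb1 _ le_rfl, hb2 _ (by omega), show 2 * d + 1 - (d + 1) = d by omega, ha.top]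
      push_cast
      omega
    · rw [hb2 _ h, hb2 _ (by omega)]
      have := ha.step (2 * m + 1 - (d + 1)) (by omega)
      rw [show 2 * m + 1 - (d + 1) + 1 = 2 * m + 1 - d by omega] at this
      push_cast at this ⊢
      omega
  · obtain ⟨x, hx⟩ := x
    obtain ⟨u, rfl⟩ := q.surjective x
    match u with
    | none => simp at hx
    | some y =>
      obtain ⟨i, h1, h2, rfl⟩ := exists_int_eq s (b (2 * m)) y
      exact ⟨i, h1, h2, rfl⟩
  · have h1 := Set.ncard_add_ncard_compl ({q none} : Set V)
    rw [Set.ncard_singleton, natCard_eq q] at h1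
    change ({q none}ᶜ : Set V).ncard = _
    omega
  · obtain ⟨x, hx⟩ := x
    obtain ⟨y, hy⟩ := y
    obtain ⟨u, rfl⟩ := q.surjective x
    obtain ⟨v, rfl⟩ := q.surjective y
    match u, v with
    | none, _ => simp at hx
    | _, none => simp at hy
    | some y, some z =>
    have hadj : T.Adj (q (some y)) (q (some z)) ↔
        (rotatedTree a s).Adj (some y) (some z) := by
      rw [← hT]; rfl
    have e0 : ∀ i j : ℤ, s((⟨q (some y), hx⟩ : ({q none}ᶜ : Set V)), ⟨q (some z), hy⟩) =
        s(w i, w j) ↔ s(y, z) = s(s + (i : ZMod (2 * m + 1)), s + (j : ZMod (2 * m + 1))) := by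
      intro i j
      simp [w]
    have e1 : ∀ d ≤ m, s(s + (b d : ZMod (2 * m + 1)), s + ((b d + d : ℤ) : ZMod (2 * m + 1))) =
        s(s + (a d : ℕ), s + (a d + d : ℕ)) := by
      intro d h2
      rw [hb1 d h2]
      push_cast
      rfl
    have e2 : ∀ d ≤ m, s(s + (b (2 * m + 1 - d) : ZMod (2 * m + 1)),
        s + ((b (2 * m + 1 - d) + (2 * m + 1 - d : ℕ) : ℤ) : ZMod (2 * m + 1))) =
        s(s + (m : ℕ) + (a d : ℕ), s + (m : ℕ) + (a d + d : ℕ)) := by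
      intro d h2
      rw [hb2 _ (by omega), show 2 * m + 1 - (2 * m + 1 - d) = d by omega, Sym2.eq_swap,
        Nat.cast_sub (by omega)]
      push_cast
      congr 1
      · ring
      · linear_combination -(two_mul_add_one_eq_zero (m := m))
    rw [comap_adj]
    change T.Adj (q (some y)) (q (some z)) ↔ _
    rw [hadj, profileGraph_adj]
    simp only [e0]
    have e3 : ∀ y' z' : ZMod (2 * m + 1), s(some y, some z) = s(some y', some z') ↔
        s(y, z) = s(y', z') := by intro y' z'; simp
    simp only [e3]
    constructor
    · rintro (⟨x, rfl | rfl, d, h1, h2, h⟩ | ⟨x, hx, h⟩)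
      · exact ⟨d, h1, by omega, by rw [e1 d h2, h]⟩
      · exact ⟨2 * m + 1 - d, by omega, by omega, by rw [e2 d h2, h]⟩
      · simp at h
    · rintro ⟨d, h1, h2, h⟩
      left
      by_cases hd : d ≤ m
      · rw [e1 d hd] at h
        exact ⟨s, Or.inl rfl, d, h1, hd, h⟩
      · have := e2 (2 * m + 1 - d) (by omega)
        rw [show 2 * m + 1 - (2 * m + 1 - d) = d by omega] at this
        rw [this] at h
        exact ⟨_, Or.inr rfl, 2 * m + 1 - d, by omega, by omega, h⟩

end

section

variable {m : ℕ}

lemma _root_.SplitsSymmetrically.symm {V : Type*} {F : SimpleGraph V} {p q a b : V}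
    (h : SplitsSymmetrically F p q a b) : SplitsSymmetrically F p q b a := by
  obtain ⟨h1, h2, h3, h4, h5, h6, h7, h8, h9, φ, hφ⟩ := h
  refine ⟨h1, h2, h3, h4.symm, fun v => ?_, h8, h9, h6, h7, φ.symm, ?_⟩
  · rcases h5 v with h | h | h | h
    exacts [Or.inl h, Or.inr (Or.inl h), Or.inr (Or.inr (Or.inr h)), Or.inr (Or.inr (Or.inl h))]
  · rw [← hφ, RelIso.symm_apply_apply]

/-- The component of `a` is the set `A` if no edge leaves `A` and all points of `A` are
reachable. -/
lemma mem_component_iff {V : Type*} {F : SimpleGraph V} {a : V} {A : Set V} (ha : a ∈ A)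
    (hc : ∀ x ∈ A, ∀ y, F.Adj x y → y ∈ A) (hr : ∀ x ∈ A, F.Reachable a x) (v : V) :
    v ∈ F.connectedComponentMk a ↔ v ∈ A := by
  change F.connectedComponentMk v = F.connectedComponentMk a ↔ _
  rw [ConnectedComponent.eq]
  refine ⟨fun h => ?_, fun h => (hr v h).symm⟩
  by_contra hv
  obtain ⟨w⟩ := h.symm
  obtain ⟨d, -, h1, h2⟩ := w.exists_boundary_dart A ha hv
  exact h2 (hc _ h1 _ d.adj)

/-- A criterion for symmetric splitting in terms of the two vertex sets `A`, `B` of the components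
and of a permutation `θ` of all vertices that maps `A` onto `B`. -/
lemma splitsSymmetrically_of_equiv {V : Type*} {F : SimpleGraph V} {p q a b : V} (A B : Set V)
    (θ : V ≃ V) (ha : a ∈ A) (hb : b ∈ B) (hp : ∀ y, ¬ F.Adj p y) (hq : ∀ y, ¬ F.Adj q y)
    (hpq : p ≠ q) (hpA : p ∉ A) (hqA : q ∉ A) (hpB : p ∉ B) (hqB : q ∉ B)
    (hcover : ∀ v, v = p ∨ v = q ∨ v ∈ A ∨ v ∈ B) (hdisj : Disjoint A B)
    (hAc : ∀ x ∈ A, ∀ y, F.Adj x y → y ∈ A) (hBc : ∀ x ∈ B, ∀ y, F.Adj x y → y ∈ B)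
    (hAr : ∀ x ∈ A, F.Reachable a x) (hBr : ∀ x ∈ B, F.Reachable b x)
    (hθ : ∀ x, θ x ∈ B ↔ x ∈ A) (hadj : ∀ x ∈ A, ∀ y ∈ A, (F.Adj (θ x) (θ y) ↔ F.Adj x y))
    (hab : θ a = b) : SplitsSymmetrically F p q a b := by
  have hA := mem_component_iff ha hAc hAr
  have hB := mem_component_iff hb hBc hBr
  refine ⟨Set.eq_empty_of_forall_notMem hp, Set.eq_empty_of_forall_notMem hq, hpq, ?_, fun v => ?_,
    fun h => hpA (h ▸ ha), fun h => hqA (h ▸ ha), fun h => hpB (h ▸ hb), fun h => hqB (h ▸ hb),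
    ⟨θ.subtypeEquiv fun x => ?_, ?_⟩, ?_⟩
  · intro h
    have h1 : a ∈ F.connectedComponentMk b := h
    rw [hB] at h1
    exact Set.disjoint_left.1 hdisj ha h1
  · rw [hA, hB]; exact hcover v
  · exact (hA x).trans ((hθ x).symm.trans (hB _).symm)
  · rintro ⟨x, hx⟩ ⟨y, hy⟩
    exact hadj x ((hA x).1 hx) y ((hA y).1 hy)
  · exact Subtype.ext hab

/-- The nested chords of a profile connect all points of the longest arc. -/
lemma reachable_of_profile {V : Type*} {F : SimpleGraph V} {a : ℕ → ℕ} {D : ℕ} (w : ℕ → V)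
    (ha : ∀ d < D, a d = a (d + 1) ∨ a d = a (d + 1) + 1)
    (hF : ∀ d, 1 ≤ d → d ≤ D → F.Adj (w (a d)) (w (a d + d))) {d : ℕ} (hd : d ≤ D) :
    ∀ i j, a d ≤ i → i ≤ a d + d → a d ≤ j → j ≤ a d + d → F.Reachable (w i) (w j) := by
  induction d with
  | zero =>
    intro i j h1 h2 h3 h4
    rw [show i = j by omega]
  | succ d ih =>
    have hadj := (hF (d + 1) (by omega) hd).reachable
    have ih := ih (by omega)
    -- All points of the longer arc reach the end that it has in common with the shorter one.
    obtain ⟨c, hc⟩ : ∃ c, ∀ i, a (d + 1) ≤ i → i ≤ a (d + 1) + (d + 1) →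
        F.Reachable (w i) (w c) := by
      rcases ha d (by omega) with h | h
      · refine ⟨a d, fun i h1 h2 => ?_⟩
        by_cases hi : i = a (d + 1) + (d + 1)
        · rw [hi, h]; exact hadj.symm
        · exact ih i _ (by omega) (by omega) (by omega) (by omega)
      · refine ⟨a d + d, fun i h1 h2 => ?_⟩
        by_cases hi : i = a (d + 1)
        · rw [hi, h, show a (d + 1) + 1 + d = a (d + 1) + (d + 1) by omega]; exact hadj
        · exact ih i _ (by omega) (by omega) (by omega) (by omega)
    exact fun i j h1 h2 h3 h4 => (hc i h1 h2).trans (hc j h3 h4).symm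

variable {V : Type*} {T : SimpleGraph V} (q : Option (ZMod (2 * m + 1)) ≃ V) {a : ℕ → ℕ}

lemma chord_length_inj {y z : ZMod (2 * m + 1)} {d e : ℕ} (hd : 1 ≤ d) (hd' : d ≤ m) (he' : e ≤ m)
    (h : s(y, y + (d : ℕ)) = s(z, z + (e : ℕ))) : d = e := by
  rw [Sym2.eq_iff] at h
  rcases h with ⟨rfl, h⟩ | ⟨rfl, h⟩
  · exact add_natCast_inj h (by omega) (by omega)
  · have h2 : z + ((d + e : ℕ) : ZMod (2 * m + 1)) = z + (0 : ℕ) := by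
      push_cast
      linear_combination h
    have := add_natCast_inj h2 (by omega) (by omega)
    omega

/-- In the tree with longest chords at `s` and `s + m` and with the radius to `s`, the path from
the centre through `s`, `s + m` and `s + 2m` witnesses the symmetry: without its edges, the tree
consists of the graphs on two arcs of `m` points, which differ by a rotation by `m`, the centre, and
one end of the path on the circle. -/
theorem isP4Symmetric_rotated {s : ZMod (2 * m + 1)} (hm : 1 ≤ m) (ha : IsProfile m a)
    (hT : T.comap q = rotatedTree a s) (htree : T.IsTree) :
    IsP4Symmetric T (q none) (q (some (s + (0 : ℕ)))) (q (some (s + (m : ℕ))))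
      (q (some (s + (m + m : ℕ)))) := by
  have hadj : ∀ u v, T.Adj (q u) (q v) ↔ (rotatedTree a s).Adj u v := by
    intro u v; rw [← hT]; rfl
  have hinj : ∀ {i j : ℕ}, i < 2 * m + 1 → j < 2 * m + 1 →
      q (some (s + (i : ℕ))) = q (some (s + (j : ℕ))) → i = j := fun hi hj h =>
    add_natCast_inj (Option.some_injective _ (q.injective h)) hi hj
  set F := T.deleteEdges {s(q none, q (some (s + (0 : ℕ)))),
    s(q (some (s + (0 : ℕ))), q (some (s + (m : ℕ)))),
    s(q (some (s + (m : ℕ))), q (some (s + (m + m : ℕ))))} with hF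
  have hFadj : ∀ u v, F.Adj (q u) (q v) ↔ ∃ c, (c = 0 ∨ c = m) ∧ ∃ d, 1 ≤ d ∧ d < m ∧
      s(u, v) = s(some (s + (c + a d : ℕ)), some (s + (c + a d + d : ℕ))) := by
    intro u v
    rw [hF, deleteEdges_adj, hadj, profileGraph_adj]
    simp only [Set.mem_insert_iff, Set.mem_singleton_iff, sym2_apply_eq, not_or]
    constructor
    · rintro ⟨⟨x, hx, d, h1, h2, h⟩ | ⟨x, rfl, h⟩, h3, h4, h5⟩
      · have hx' : ∃ c, (c = 0 ∨ c = m) ∧ x = s + (c : ℕ) := by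
          rcases hx with rfl | rfl
          · exact ⟨0, Or.inl rfl, by simp⟩
          · exact ⟨m, Or.inr rfl, rfl⟩
        obtain ⟨c, hc, rfl⟩ := hx'
        refine ⟨c, hc, d, h1, lt_of_le_of_ne h2 ?_, ?_⟩
        · rintro rfl
          rw [ha.top] at h
          rcases hc with rfl | rfl
          · exact h4 (by rw [h]; simp)
          · exact h5 (by rw [h]; push_cast; simp [add_assoc])
        · rw [h]; push_cast; simp only [add_assoc]
      · exact (h3 (by rw [h]; simp)).elim
    · rintro ⟨c, hc, d, h1, h2, h⟩
      have hlen : ∀ y : ZMod (2 * m + 1), s(u, v) ≠ s(some y, some (y + (m : ℕ))) := by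
        intro y h3
        rw [h] at h3
        have h4 : s(s + (c + a d : ℕ), s + (c + a d : ℕ) + (d : ℕ)) = s(y, y + (m : ℕ)) := by
          rw [Nat.cast_add (c + a d) d] at h3
          simpa [add_assoc] using h3
        have := chord_length_inj h1 h2.le le_rfl h4
        omega
      refine ⟨Or.inl ⟨s + (c : ℕ), ?_, d, h1, h2.le, ?_⟩, ?_, ?_, ?_⟩
      · rcases hc with rfl | rfl
        · left; simp
        · right; rfl
      · rw [h]; push_cast; simp only [add_assoc]
      · rw [h]; simp
      · have := hlen s
        simpa using this
      · have := hlen (s + (m : ℕ))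
        rwa [add_assoc, ← Nat.cast_add] at this
  refine ⟨htree, ?_, ?_, ?_, ?_, ?_, ?_, ?_⟩
  · rw [hadj, profileGraph_adj_none]; simp
  · rw [hadj, Nat.cast_zero, add_zero, profileGraph_adj_chord hm le_rfl, ha.top]; simp
  · rw [hadj, Nat.cast_add, ← add_assoc, profileGraph_adj_chord hm le_rfl, ha.top]; simp
  · simp
  · simp
  · intro h
    have := hinj (by omega) (by omega) h
    omega
  -- The second longest arc leaves out one end of the longest arc.
  obtain ⟨α, hα⟩ : ∃ α, a (m - 1) = α := ⟨_, rfl⟩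
  have hα1 : α = 0 ∨ α = 1 := by
    have := ha.step (m - 1) (by omega)
    rw [Nat.sub_add_cancel hm, ha.top] at this
    omega
  have hbound : ∀ d < m, α ≤ a d ∧ a d + d < α + m := by
    intro d hd
    have := ha.nested (show d ≤ m - 1 by omega) (by omega)
    omega
  let arc : ℕ → Set V := fun c => {v | ∃ i : ℕ, i < m ∧ v = q (some (s + (c + α + i : ℕ)))}
  have hnone : ∀ c, q none ∉ arc c := by
    rintro c ⟨i, -, h⟩
    simp at h
  let θ : V ≃ V := q.symm.trans (((Equiv.addRight (m : ZMod (2 * m + 1))).optionCongr).trans q)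
  have hθ : ∀ i : ℕ, θ (q (some (s + (i : ℕ)))) = q (some (s + (m + i : ℕ))) := by
    intro i
    simp only [θ, Equiv.trans_apply, Equiv.symm_apply_apply, Equiv.optionCongr_apply,
      Option.map_some, Equiv.coe_addRight]
    congr 2
    push_cast
    ring
  have hmem : ∀ {c i : ℕ}, (c = 0 ∨ c = m) → i < 2 * m + 1 →
      (q (some (s + (i : ℕ))) ∈ arc c ↔ c + α ≤ i ∧ i < c + α + m) := by
    intro c i hc hi
    constructor
    · rintro ⟨j, hj, h⟩
      have := hinj hi (by omega) h
      omega
    · rintro ⟨h1, h2⟩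
      exact ⟨i - (c + α), by omega, by rw [Nat.add_sub_cancel' h1]⟩
  have hind : ∀ y, ∃ i : ℕ, i < 2 * m + 1 ∧ y = s + (i : ℕ) := exists_eq_add s
  have hFarc : ∀ u v, F.Adj (q u) (q v) →
      ∃ c, (c = 0 ∨ c = m) ∧ q u ∈ arc c ∧ q v ∈ arc c := by
    intro u v h
    obtain ⟨c, hc, d, h1, h2, h⟩ := (hFadj u v).1 h
    have hb := hbound d h2
    have e1 := (hmem hc (i := c + a d) (by omega)).2 ⟨by omega, by omega⟩
    have e2 := (hmem hc (i := c + a d + d) (by omega)).2 ⟨by omega, by omega⟩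
    rw [Sym2.eq_iff] at h
    rcases h with ⟨rfl, rfl⟩ | ⟨rfl, rfl⟩
    · exact ⟨c, hc, e1, e2⟩
    · exact ⟨c, hc, e2, e1⟩
  have hdisj : Disjoint (arc 0) (arc m) := by
    rw [Set.disjoint_left]
    rintro _ ⟨i, hi, rfl⟩ h
    have := (hmem (Or.inr rfl) (by omega)).1 h
    omega
  have hclosed : ∀ c, (c = 0 ∨ c = m) → ∀ x ∈ arc c, ∀ y, F.Adj x y → y ∈ arc c := by
    intro c hc x hx y hxy
    obtain ⟨u, rfl⟩ := q.surjective x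
    obtain ⟨v, rfl⟩ := q.surjective y
    obtain ⟨c', hc', h1, h2⟩ := hFarc u v hxy
    rcases hc with rfl | rfl <;> rcases hc' with rfl | rfl
    · exact h2
    · exact (Set.disjoint_left.1 hdisj hx h1).elim
    · exact (Set.disjoint_left.1 hdisj h1 hx).elim
    · exact h2
  have hreach : ∀ c, (c = 0 ∨ c = m) → ∀ x ∈ arc c, ∀ y ∈ arc c, F.Reachable x y := by
    rintro c hc _ ⟨i, hi, rfl⟩ _ ⟨j, hj, rfl⟩
    have := reachable_of_profile (F := F) (D := m - 1) (a := a)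
      (fun i => q (some (s + (c + i : ℕ)))) (fun d hd => ha.step d (by omega)) (fun d h1 h2 => by
        rw [hFadj]
        exact ⟨c, hc, d, h1, by omega, by simp only [add_assoc]⟩) le_rfl (α + i) (α + j) (by omega)
      (by omega) (by omega) (by omega)
    simpa only [← add_assoc] using this
  have hsplit : ∀ l r : ℕ, (α = 0 ∧ l = m + m ∧ r = 0) ∨ (α = 1 ∧ l = 0 ∧ r = m) →
      SplitsSymmetrically F (q none) (q (some (s + (l : ℕ)))) (q (some (s + (r : ℕ))))
        (q (some (s + (m + r : ℕ)))) := by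
    intro l r hlr
    have hl : l < 2 * m + 1 := by omega
    have hl0 : q (some (s + (l : ℕ))) ∉ arc 0 := by
      rw [hmem (Or.inl rfl) hl]; omega
    have hlm : q (some (s + (l : ℕ))) ∉ arc m := by
      rw [hmem (Or.inr rfl) hl]; omega
    have hr0 : q (some (s + (r : ℕ))) ∈ arc 0 := by
      rw [hmem (Or.inl rfl) (by omega)]; omega
    have hrm : q (some (s + (m + r : ℕ))) ∈ arc m := by
      rw [hmem (Or.inr rfl) (by omega)]; omega
    refine splitsSymmetrically_of_equiv (arc 0) (arc m) θ hr0 hrm (fun y h => ?_) (fun y h => ?_)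
      (by simp) (hnone 0) hl0 (hnone m) hlm (fun v => ?_) hdisj (hclosed 0 (Or.inl rfl))
      (hclosed m (Or.inr rfl)) (fun x hx => hreach 0 (Or.inl rfl) _ hr0 _ hx)
      (fun x hx => hreach m (Or.inr rfl) _ hrm _ hx) (fun x => ?_) (fun x hx y hy => ?_) (hθ r)
    · obtain ⟨v, rfl⟩ := q.surjective y
      obtain ⟨c, -, h1, -⟩ := hFarc _ _ h
      exact hnone c h1
    · obtain ⟨v, rfl⟩ := q.surjective y
      obtain ⟨c, rfl | rfl, h1, -⟩ := hFarc _ _ h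
      · exact hl0 h1
      · exact hlm h1
    · obtain ⟨u, rfl⟩ := q.surjective v
      match u with
      | none => exact Or.inl rfl
      | some y =>
        obtain ⟨i, hi, rfl⟩ := hind y
        right
        rw [hmem (Or.inl rfl) hi, hmem (Or.inr rfl) hi]
        by_cases hil : i = l
        · left; rw [hil]
        · right; omega
    · obtain ⟨u, rfl⟩ := q.surjective x
      match u with
      | none =>
        have : θ (q none) = q none := by simp [θ]
        rw [this]
        exact ⟨fun h => (hnone _ h).elim, fun h => (hnone _ h).elim⟩
      | some y =>
        constructor
        · rintro ⟨i, hi, h⟩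
          rw [add_assoc, ← hθ] at h
          rw [θ.injective h]
          exact ⟨i, hi, by rw [Nat.zero_add]⟩
        · rintro ⟨i, hi, h⟩
          rw [h, hθ]
          exact ⟨i, hi, by rw [Nat.zero_add, add_assoc]⟩
    · obtain ⟨i, hi, rfl⟩ := hx
      obtain ⟨j, hj, rfl⟩ := hy
      rw [hθ, hθ]
      have hshift : ∀ d : ℕ, s(some (s + (m + (0 + α + i) : ℕ)), some (s + (m + (0 + α + j) : ℕ))) =
          s(some (s + (m + a d : ℕ)), some (s + (m + a d + d : ℕ))) ↔
          s(some (s + (0 + α + i : ℕ)), some (s + (0 + α + j : ℕ))) =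
          s(some (s + (0 + a d : ℕ)), some (s + (0 + a d + d : ℕ))) := by
        intro d
        simp only [Sym2.eq_iff, Option.some.injEq, add_right_inj, Nat.cast_add,
          zero_add, add_assoc]
      constructor
      · intro h
        obtain ⟨c, hc, d, h1, h2, h3⟩ := (hFadj _ _).1 h
        have hc' : c = m := by
          rcases hc with rfl | rfl
          · have e1 : q (some (s + (m + (0 + α + i) : ℕ))) ∈ arc m := ⟨i, hi, by congr 4; omega⟩
            have := hbound d h2
            have e2 : q (some (s + (m + (0 + α + i) : ℕ))) ∈ arc 0 := by
              have h4 := Sym2.eq_iff.1 h3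
              rcases h4 with ⟨h4, -⟩ | ⟨h4, -⟩
              · rw [h4, hmem (Or.inl rfl) (by omega)]; omega
              · rw [h4, hmem (Or.inl rfl) (by omega)]; omega
            exact (Set.disjoint_left.1 hdisj e2 e1).elim
          · rfl
        subst hc'
        exact (hFadj _ _).2 ⟨0, Or.inl rfl, d, h1, h2, (hshift d).1 h3⟩
      · intro h
        obtain ⟨c, hc, d, h1, h2, h3⟩ := (hFadj _ _).1 h
        have hc' : c = 0 := by
          rcases hc with rfl | rfl
          · rfl
          · have e1 : q (some (s + (0 + α + i : ℕ))) ∈ arc 0 := ⟨i, hi, rfl⟩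
            have := hbound d h2
            have e2 : q (some (s + (0 + α + i : ℕ))) ∈ arc c := by
              have h4 := Sym2.eq_iff.1 h3
              rcases h4 with ⟨h4, -⟩ | ⟨h4, -⟩
              · rw [h4, hmem (Or.inr rfl) (by omega)]; omega
              · rw [h4, hmem (Or.inr rfl) (by omega)]; omega
            exact (Set.disjoint_left.1 hdisj e1 e2).elim
        subst hc'
        exact (hFadj _ _).2 ⟨m, Or.inr rfl, d, h1, h2, (hshift d).2 h3⟩
  rcases hα1 with h | h
  · exact Or.inl (hsplit (m + m) 0 (Or.inl ⟨h, rfl, rfl⟩)).symm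
  · exact Or.inr (hsplit 0 m (Or.inr ⟨h, rfl, rfl⟩))

theorem isWCaterpillar_rotated {s : ZMod (2 * m + 1)} (hm : 1 ≤ m) (ha : IsProfile m a)
    (hT : T.comap q = rotatedTree a s) (htree : T.IsTree) :
    IsWCaterpillar T :=
  ⟨_, _, _, _, isP4Symmetric_rotated q hm ha hT htree, Or.inr (isCaterpillar_rotated_sub q ha hT)⟩

end

/-! ### Rooted caterpillars as nested arcs -/

section

variable {m : ℕ}

/-- The map `f` from `{0, …, k}` onto `C` sends the chords of the nested arcs of the profile `a` to
edges of `G`. -/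
structure IsArcModel {V : Type*} (G : SimpleGraph V) (k : ℕ) (a : ℕ → ℕ) (f : ℕ → V)
    (C : Finset V) : Prop where
  isProfile : IsProfile k a
  mem (i) (hi : i ≤ k) : f i ∈ C
  surj (v) (hv : v ∈ C) : ∃ i ≤ k, f i = v
  adj (d) (h1 : 1 ≤ d) (h2 : d ≤ k) : G.Adj (f (a d)) (f (a d + d))

section ArcModel

variable {V : Type*} [DecidableEq V] {G : SimpleGraph V} {k : ℕ} {a : ℕ → ℕ} {f : ℕ → V}
  {C : Finset V} {v : V}

lemma IsArcModel.append (h : IsArcModel G k a f C) (hv : G.Adj (f 0) v) :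
    ∃ a' f', IsArcModel G (k + 1) a' f' (insert v C) ∧ f' 0 = f 0 ∧ f' (k + 1) = v := by
  refine ⟨fun d => if d ≤ k then a d else 0, fun i => if i ≤ k then f i else v,
    ⟨⟨by simp, fun d hd => ?_⟩, fun i hi => ?_, fun x hx => ?_, fun d h1 h2 => ?_⟩, by simp,
    by simp⟩
  · rcases eq_or_lt_of_le (Nat.lt_succ_iff.1 hd) with rfl | hd
    · simp [h.isProfile.top]
    · simpa [hd.le, Nat.succ_le_of_lt hd] using h.isProfile.step d hd
  · split_ifs with h1
    · exact Finset.mem_insert_of_mem (h.mem i h1)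
    · exact Finset.mem_insert_self _ _
  · rcases Finset.mem_insert.1 hx with rfl | hx
    · exact ⟨k + 1, le_rfl, by simp⟩
    · obtain ⟨i, hi, rfl⟩ := h.surj x hx
      exact ⟨i, by omega, by simp [hi]⟩
  · by_cases hd : d ≤ k
    · have := h.isProfile.le hd
      simpa [hd, this, (by omega : a d ≤ k)] using h.adj d h1 hd
    · obtain rfl : d = k + 1 := by omega
      simpa using hv

lemma IsArcModel.prepend (h : IsArcModel G k a f C) (hv : G.Adj (f k) v) :
    ∃ a' f', IsArcModel G (k + 1) a' f' (insert v C) ∧ f' 0 = v ∧ f' (k + 1) = f k := by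
  refine ⟨fun d => if d ≤ k then a d + 1 else 0, fun i => if i = 0 then v else f (i - 1),
    ⟨⟨by simp, fun d hd => ?_⟩, fun i hi => ?_, fun x hx => ?_, fun d h1 h2 => ?_⟩, by simp,
    by simp⟩
  · rcases eq_or_lt_of_le (Nat.lt_succ_iff.1 hd) with rfl | hd
    · simp [h.isProfile.top]
    · simpa [hd.le, Nat.succ_le_of_lt hd] using h.isProfile.step d hd
  · split_ifs with h1
    · exact Finset.mem_insert_self _ _
    · exact Finset.mem_insert_of_mem (h.mem _ (by omega))
  · rcases Finset.mem_insert.1 hx with rfl | hx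
    · exact ⟨0, by omega, by simp⟩
    · obtain ⟨i, hi, rfl⟩ := h.surj x hx
      exact ⟨i + 1, by omega, by simp⟩
  · by_cases hd : d ≤ k
    · have := h.adj d h1 hd
      simpa [hd, show a d + 1 + d - 1 = a d + d by omega] using this
    · obtain rfl : d = k + 1 := by omega
      simpa using hv.symm

/-- A nonleaf of `G`. -/
def IsInner (G : SimpleGraph V) (v : V) : Prop := ∃ x y, x ≠ y ∧ G.Adj v x ∧ G.Adj v y

/-- A connected part `C` of a caterpillar `G` that is attached to the rest at a single vertex `r`,
where `r` has an inner neighbour outside `C`, is given by nested arcs with `r` at a prescribed end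
of the longest arc. The outermost chord joins `r` either to a leaf, or, if `r` has no leaf in `C`
as a neighbour, to its only neighbour in `C`; in the first case the leaf is removed, in the second
case `r` is. -/
lemma exists_arcModel (hG : ∀ v x y z, x ≠ y → x ≠ z → y ≠ z → G.Adj v x → G.Adj v y → G.Adj v z →
      IsInner G x → IsInner G y → IsInner G z → False) (k : ℕ) :
    ∀ (C : Finset V) (r : V), r ∈ C → C.card = k + 1 →
      (1 ≤ k → ∃ o ∉ C, G.Adj r o ∧ IsInner G o) →
      (∀ x ∈ C, ∀ y ∉ C, G.Adj x y → x = r) →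
      (∀ D ⊆ C, r ∈ D → (∀ x ∈ D, ∀ y ∈ C, G.Adj x y → y ∈ D) → D = C) →
      (∃ a f, IsArcModel G k a f C ∧ f 0 = r) ∧ ∃ a f, IsArcModel G k a f C ∧ f k = r := by
  induction k with
  | zero =>
    intro C r hr hC _ _ _
    obtain ⟨x, rfl⟩ := Finset.card_eq_one.1 hC
    obtain rfl := Finset.mem_singleton.1 hr
    have : IsArcModel G 0 (fun _ => 0) (fun _ => r) {r} :=
      ⟨⟨rfl, fun d hd => by omega⟩, by simp, by simp, fun d h1 h2 => by omega⟩
    exact ⟨⟨_, _, this, rfl⟩, ⟨_, _, this, rfl⟩⟩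
  | succ k ih =>
    intro C r hr hC ho hout hconn
    obtain ⟨o, hoC, hro, ho⟩ := ho (by omega)
    by_cases hleaf : ∃ l ∈ C, G.Adj r l ∧ ¬ IsInner G l
    · obtain ⟨l, hl, hrl, hl'⟩ := hleaf
      have hl1 : ∀ x, G.Adj l x → x = r := by
        intro x hx
        by_contra hne
        exact hl' ⟨x, r, hne, hx, hrl.symm⟩
      have hins : insert l (C.erase l) = C := Finset.insert_erase hl
      obtain ⟨⟨a, f, h, h0⟩, ⟨a', f', h', h0'⟩⟩ := ih (C.erase l) r
        (Finset.mem_erase.2 ⟨hrl.ne, hr⟩) (by rw [Finset.card_erase_of_mem hl, hC]; rfl)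
        (fun _ => ⟨o, fun h => hoC (Finset.mem_of_mem_erase h), hro, ho⟩)
        (fun x hx y hy hxy => by
          by_cases hyl : y = l
          · subst hyl; exact hl1 x hxy.symm
          · exact hout x (Finset.mem_of_mem_erase hx) y (fun h => hy (Finset.mem_erase.2 ⟨hyl, h⟩))
              hxy)
        (fun D hD hrD hcl => by
          have := hconn (insert l D) (by
            rw [← hins]; exact Finset.insert_subset_insert _ hD) (Finset.mem_insert_of_mem hrD)
            (fun x hx y hy hxy => by
              rcases Finset.mem_insert.1 hx with rfl | hx
              · rw [hl1 y hxy]; exact Finset.mem_insert_of_mem hrD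
              · by_cases hyl : y = l
                · rw [hyl]; exact Finset.mem_insert_self _ _
                · exact Finset.mem_insert_of_mem (hcl x hx y (Finset.mem_erase.2 ⟨hyl, hy⟩) hxy))
          rw [← this, Finset.erase_insert fun h => (Finset.mem_erase.1 (hD h)).1 rfl])
      rw [← h0] at hrl
      obtain ⟨a₁, f₁, h1, h2, -⟩ := h.append hrl
      rw [h0, ← h0'] at hrl
      obtain ⟨a₂, f₂, h3, -, h4⟩ := h'.prepend hrl
      rw [hins] at h1 h3
      exact ⟨⟨a₁, f₁, h1, h2.trans h0⟩, ⟨a₂, f₂, h3, h4.trans h0'⟩⟩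
    · push Not at hleaf
      obtain ⟨x, hx, hrx⟩ : ∃ x ∈ C, G.Adj r x := by
        by_contra! hno
        have := hconn {r} (Finset.singleton_subset_iff.2 hr) (Finset.mem_singleton_self r)
          (fun x hx y hy hxy => by
            rw [Finset.mem_singleton.1 hx] at hxy
            exact (hno y hy hxy).elim)
        rw [← this, Finset.card_singleton] at hC
        omega
      have huniq : ∀ y ∈ C, G.Adj r y → y = x := by
        intro y hy hry
        by_contra hne
        exact hG r x y o (Ne.symm hne) (fun h => hoC (h ▸ hx)) (fun h => hoC (h ▸ hy)) hrx hry hro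
          (hleaf x hx hrx) (hleaf y hy hry) ho
      have hins : insert r (C.erase r) = C := Finset.insert_erase hr
      obtain ⟨⟨a, f, h, h0⟩, ⟨a', f', h', h0'⟩⟩ := ih (C.erase r) x
        (Finset.mem_erase.2 ⟨hrx.ne', hx⟩) (by rw [Finset.card_erase_of_mem hr, hC]; rfl)
        (fun _ => ⟨r, by simp, hrx.symm, x, o, fun h => hoC (h ▸ hx), hrx, hro⟩)
        (fun v hv y hy hvy => by
          by_cases hyr : y = r
          · subst hyr; exact huniq v (Finset.mem_of_mem_erase hv) hvy.symm
          · exact ((Finset.mem_erase.1 hv).1 (hout v (Finset.mem_of_mem_erase hv) y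
              (fun h => hy (Finset.mem_erase.2 ⟨hyr, h⟩)) hvy)).elim)
        (fun D hD hxD hcl => by
          have := hconn (insert r D) (by
            rw [← hins]; exact Finset.insert_subset_insert _ hD) (Finset.mem_insert_self _ _)
            (fun v hv y hy hvy => by
              rcases Finset.mem_insert.1 hv with rfl | hv
              · rw [huniq y hy hvy]; exact Finset.mem_insert_of_mem hxD
              · by_cases hyr : y = r
                · rw [hyr]; exact Finset.mem_insert_self _ _
                · exact Finset.mem_insert_of_mem (hcl v hv y (Finset.mem_erase.2 ⟨hyr, hy⟩) hvy))
          rw [← this, Finset.erase_insert fun h => (Finset.mem_erase.1 (hD h)).1 rfl])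
      replace hrx := hrx.symm
      rw [← h0] at hrx
      obtain ⟨a₁, f₁, h1, -, h2⟩ := h.append hrx
      rw [h0, ← h0'] at hrx
      obtain ⟨a₂, f₂, h3, h4, -⟩ := h'.prepend hrx
      rw [hins] at h1 h3
      exact ⟨⟨a₂, f₂, h3, h4⟩, ⟨a₁, f₁, h1, h2⟩⟩

end ArcModel

/-! ### Every `w`-caterpillar is a tree of nested arcs -/

lemma rotatedTree_connected {a : ℕ → ℕ} (hm : 1 ≤ m) (ha : IsProfile m a) :
    (rotatedTree (m := m) a 0).Connected := by
  set G := rotatedTree (m := m) a 0 with hG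
  have hr : ∀ c, (c = 0 ∨ c = m) → ∀ i j, i ≤ m → j ≤ m →
      G.Reachable (some ((c + i : ℕ) : ZMod (2 * m + 1))) (some ((c + j : ℕ))) := by
    intro c hc i j hi hj
    refine reachable_of_profile (D := m) (a := a) (fun i => some ((c + i : ℕ) : ZMod (2 * m + 1)))
      (fun d hd => ha.step d hd) (fun d h1 h2 => ?_) le_rfl i j ?_ ?_ ?_ ?_
    · rw [← add_assoc, Nat.cast_add (c + a d) d, hG, profileGraph_adj_chord h1 h2]
      rcases hc with rfl | rfl
      · left; simp
      · right; simp
    all_goals rw [ha.top]; omega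
  have hr' : ∀ x, G.Reachable x (some 0) := by
    intro x
    match x with
    | none => exact (show G.Adj none (some 0) from profileGraph_adj_none.2 rfl).reachable
    | some y =>
      obtain ⟨i, hi, rfl⟩ := exists_eq_add 0 y
      rw [zero_add]
      by_cases him : i ≤ m
      · simpa using hr 0 (Or.inl rfl) i 0 him (by omega)
      · have h1 := hr m (Or.inr rfl) (i - m) 0 (by omega) (by omega)
        have h2 := hr 0 (Or.inl rfl) m 0 (by omega) (by omega)
        rw [Nat.add_sub_cancel' (by omega)] at h1
        simp only [add_zero, zero_add, Nat.cast_zero] at h1 h2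
        exact h1.trans h2
  exact ⟨fun x y => (hr' x).trans (hr' y).symm⟩

/-- A tree is isomorphic to a rotated tree as soon as an enumeration of its vertices maps edges to
edges. -/
lemma nonempty_iso_of_surj {V : Type*} {S : SimpleGraph V} {a : ℕ → ℕ} (hm : 1 ≤ m)
    (ha : IsProfile m a) (hS : S.IsTree) (hcard : Nat.card V = 2 * m + 2) (c : V) (g : ℕ → V)
    (hsurj : ∀ v, v = c ∨ ∃ i, i < 2 * m + 1 ∧ g i = v) (h0 : S.Adj c (g 0))
    (h1 : ∀ d, 1 ≤ d → d ≤ m → S.Adj (g (a d)) (g (a d + d)))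
    (h2 : ∀ d, 1 ≤ d → d ≤ m → S.Adj (g (m + a d)) (g (m + a d + d))) :
    Nonempty (rotatedTree (m := m) a 0 ≃g S) := by
  have : Finite V := Nat.finite_of_card_ne_zero (by omega)
  let ω : Option (ZMod (2 * m + 1)) → V := fun x => x.elim c fun y => g y.val
  have hω : ∀ i : ℕ, i < 2 * m + 1 → ω (some (i : ZMod (2 * m + 1))) = g i := fun i hi => by
    simp [ω, ZMod.val_cast_of_lt hi]
  have hbij : Function.Bijective ω := by
    refine (Nat.bijective_iff_surjective_and_card _).2 ⟨fun v => ?_, by rw [hcard]; simp⟩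
    rcases hsurj v with rfl | ⟨i, hi, rfl⟩
    · exact ⟨none, rfl⟩
    · exact ⟨some i, hω i hi⟩
  let e := Equiv.ofBijective ω hbij
  have htree : (S.comap e).IsTree := (Iso.comap e S).isTree_iff.2 hS
  have hle : rotatedTree (m := m) a 0 ≤ S.comap e := by
    have hchord : ∀ x : ZMod (2 * m + 1), x = 0 ∨ x = 0 + (m : ℕ) → ∀ d, 1 ≤ d → d ≤ m →
        S.Adj (ω (some (x + (a d : ℕ)))) (ω (some (x + (a d + d : ℕ)))) := by
      intro x hx d hd1 hd2
      have := ha.le hd2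
      rcases hx with rfl | rfl
      · rw [zero_add, zero_add, hω _ (by omega), hω _ (by omega)]
        exact h1 d hd1 hd2
      · rw [zero_add, ← Nat.cast_add, ← Nat.cast_add, hω _ (by omega), hω _ (by omega),
          ← add_assoc]
        exact h2 d hd1 hd2
    intro u v huv
    match u, v with
    | none, none => exact (huv.ne rfl).elim
    | none, some x =>
      rw [profileGraph_adj_none, Set.mem_singleton_iff] at huv
      subst huv
      change S.Adj (ω none) (ω (some 0))
      have := hω 0 (by omega)
      rw [Nat.cast_zero] at this
      rw [this]
      exact h0
    | some x, none =>
      rw [adj_comm, profileGraph_adj_none, Set.mem_singleton_iff] at huv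
      subst huv
      change S.Adj (ω (some 0)) (ω none)
      have := hω 0 (by omega)
      rw [Nat.cast_zero] at this
      rw [this]
      exact h0.symm
    | some y, some z =>
      obtain ⟨x, hx, d, hd1, hd2, ⟨rfl, rfl⟩ | ⟨rfl, rfl⟩⟩ := profileGraph_adj_some.1 huv
      · exact hchord x hx d hd1 hd2
      · exact (hchord x hx d hd1 hd2).symm
  -- A connected spanning subgraph of a tree is the whole tree.
  have heq : rotatedTree (m := m) a 0 = S.comap e :=
    le_antisymm hle
      ((isTree_iff_minimal_connected.1 htree).le_of_le (rotatedTree_connected hm ha) hle)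
  rw [heq]
  exact ⟨Iso.comap e S⟩

lemma IsInner.ncard_ne {V : Type*} {G : SimpleGraph V} {v : V} (h : IsInner G v) :
    (G.neighborSet v).ncard ≠ 1 := by
  obtain ⟨x, y, hxy, hx, hy⟩ := h
  intro h1
  obtain ⟨z, hz⟩ := Set.ncard_eq_one.1 h1
  have hx' : x ∈ G.neighborSet v := hx
  have hy' : y ∈ G.neighborSet v := hy
  rw [hz] at hx' hy'
  exact hxy (hx'.trans hy'.symm)

/-- A vertex of a caterpillar has at most two nonleaf neighbours. -/
lemma _root_.IsCaterpillar.not_three_inner {V : Type*} {G : SimpleGraph V} (h : IsCaterpillar G)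
    (v x y z : V) (hxy : x ≠ y) (hxz : x ≠ z) (hyz : y ≠ z) (hx : G.Adj v x) (hy : G.Adj v y)
    (hz : G.Adj v z) (hx' : IsInner G x) (hy' : IsInner G y) (hz' : IsInner G z) : False := by
  obtain ⟨-, k, ⟨φ⟩⟩ := h
  have hv' : IsInner G v := ⟨x, y, hxy, hx, hy⟩
  have hadj : ∀ w (hw : IsInner G w), G.Adj v w →
      (φ ⟨v, hv'.ncard_ne⟩).val + 1 = (φ ⟨w, hw.ncard_ne⟩).val ∨
        (φ ⟨w, hw.ncard_ne⟩).val + 1 = (φ ⟨v, hv'.ncard_ne⟩).val := by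
    intro w hw hvw
    have : (pathGraph k).Adj (φ ⟨v, hv'.ncard_ne⟩) (φ ⟨w, hw.ncard_ne⟩) := φ.map_adj_iff.2 hvw
    exact pathGraph_adj.1 this
  have hne : ∀ w w' (hw : IsInner G w) (hw' : IsInner G w'), w ≠ w' →
      (φ ⟨w, hw.ncard_ne⟩).val ≠ (φ ⟨w', hw'.ncard_ne⟩).val := by
    intro w w' hw hw' hne h
    exact hne (congrArg Subtype.val (φ.injective (Fin.ext h)))
  have h1 := hadj x hx' hx
  have h2 := hadj y hy' hy
  have h3 := hadj z hz' hz
  have h4 := hne x y hx' hy' hxy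
  have h5 := hne x z hx' hz' hxz
  have h6 := hne y z hy' hz' hyz
  omega

/-- The graph `S` without the edges at `u`. -/
def isolate {V : Type*} (S : SimpleGraph V) (u : V) : SimpleGraph V where
  Adj x y := S.Adj x y ∧ x ≠ u ∧ y ≠ u
  symm := ⟨fun _ _ h => ⟨h.1.symm, h.2.2, h.2.1⟩⟩
  loopless := ⟨fun _ h => h.1.ne rfl⟩

/-- Both alternatives in the definition of a `w`-caterpillar give the same local condition. -/
lemma isolate_not_three_inner {V : Type*} {S : SimpleGraph V} {u : V}
    (h : IsCaterpillar S ∨ IsCaterpillar (S.induce ({u}ᶜ : Set V))) (v x y z : V) (hxy : x ≠ y)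
    (hxz : x ≠ z) (hyz : y ≠ z) (hx : (isolate S u).Adj v x) (hy : (isolate S u).Adj v y)
    (hz : (isolate S u).Adj v z) (hx' : IsInner (isolate S u) x) (hy' : IsInner (isolate S u) y)
    (hz' : IsInner (isolate S u) z) : False := by
  rcases h with h | h
  · have hinner : ∀ w, IsInner (isolate S u) w → IsInner S w := by
      rintro w ⟨a, b, hab, ha, hb⟩
      exact ⟨a, b, hab, ha.1, hb.1⟩
    exact h.not_three_inner v x y z hxy hxz hyz hx.1 hy.1 hz.1 (hinner x hx') (hinner y hy')
      (hinner z hz')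
  · have hne : ∀ {x y : V} {hx : x ∈ ({u}ᶜ : Set V)} {hy : y ∈ ({u}ᶜ : Set V)}, x ≠ y →
        (⟨x, hx⟩ : ({u}ᶜ : Set V)) ≠ ⟨y, hy⟩ := fun h h' => h (congrArg Subtype.val h')
    have hinner : ∀ w (hw : w ≠ u), IsInner (isolate S u) w →
        IsInner (S.induce ({u}ᶜ : Set V)) ⟨w, hw⟩ := by
      rintro w hw ⟨a, b, hab, ha, hb⟩
      exact ⟨⟨a, ha.2.2⟩, ⟨b, hb.2.2⟩, hne hab, ha.1, hb.1⟩
    exact h.not_three_inner ⟨v, hx.2.1⟩ ⟨x, hx.2.2⟩ ⟨y, hy.2.2⟩ ⟨z, hz.2.2⟩ (hne hxy) (hne hxz)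
      (hne hyz) hx.1 hy.1 hz.1 (hinner x _ hx') (hinner y _ hy') (hinner z _ hz')

lemma exists_adj_of_reachable {V : Type*} {F : SimpleGraph V} {x y : V} (h : F.Reachable x y)
    (hxy : x ≠ y) : ∃ z, F.Adj x z := by
  obtain ⟨w⟩ := h
  cases w with
  | nil => exact (hxy rfl).elim
  | cons h _ => exact ⟨_, h⟩

/-- Two copies `f`, `g` of the same nested arcs fill the two components of a symmetric splitting. -/
structure IsDoubleModel {V : Type*} (S : SimpleGraph V) (m : ℕ) (p q : V) (α : ℕ → ℕ)
    (f g : ℕ → V) : Prop where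
  isProfile : IsProfile (m - 1) α
  surj (v) : v = p ∨ v = q ∨ (∃ i < m, f i = v) ∨ ∃ i < m, g i = v
  adj_left (d) (h1 : 1 ≤ d) (h2 : d < m) : S.Adj (f (α d)) (f (α d + d))
  adj_right (d) (h1 : 1 ≤ d) (h2 : d < m) : S.Adj (g (α d)) (g (α d + d))

/-- The component of `a` in a symmetric splitting is laid out on an arc with `a` at a prescribed
end, and the isomorphism of the splitting carries this over to the component of `b`. -/
lemma exists_doubleModel {V : Type*} {S F : SimpleGraph V} {p q a b : V} (hm : 1 ≤ m)
    (hcard : Nat.card V = 2 * m + 2) (hF : SplitsSymmetrically F p q a b)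
    (hFS : ∀ x y, F.Adj x y → S.Adj x y)
    (hSF : ∀ x y, S.Adj x y → ¬ F.Adj x y →
      (x = p ∨ x = q ∨ x = a ∨ x = b) ∧ (y = p ∨ y = q ∨ y = a ∨ y = b))
    (hab : S.Adj a b) (hcat : IsCaterpillar S ∨ IsCaterpillar (S.induce ({p}ᶜ : Set V))) :
    (∃ α f g, IsDoubleModel S m p q α f g ∧ f 0 = a ∧ g 0 = b) ∧
      ∃ α f g, IsDoubleModel S m p q α f g ∧ f (m - 1) = a ∧ g (m - 1) = b := by
  classical
  have : Finite V := Nat.finite_of_card_ne_zero (by omega)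
  have := Fintype.ofFinite V
  obtain ⟨hp, hq, hpq, hne, hcover, hap, haq, hbp, hbq, φ, hφ⟩ := hF
  have hp' : ∀ y, ¬ F.Adj p y := fun y h => Set.eq_empty_iff_forall_notMem.1 hp y h
  have hq' : ∀ y, ¬ F.Adj q y := fun y h => Set.eq_empty_iff_forall_notMem.1 hq y h
  have hmem : ∀ x y, x ∈ F.connectedComponentMk y ↔ F.Reachable x y := fun x y =>
    ConnectedComponent.eq
  have hmemadj : ∀ {x y c}, F.Adj x y → x ∈ F.connectedComponentMk c →
      y ∈ F.connectedComponentMk c := by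
    intro x y c hxy hx
    rw [hmem] at hx ⊢
    exact hxy.reachable.symm.trans hx
  have hiso : ∀ x c, (∀ y, ¬ F.Adj x y) → c ≠ x → x ∉ F.connectedComponentMk c := by
    intro x c hx hc h
    rw [hmem] at h
    obtain ⟨z, hz⟩ := exists_adj_of_reachable h hc.symm
    exact hx z hz
  have hdisj : ∀ x, x ∈ F.connectedComponentMk a → x ∈ F.connectedComponentMk b → False := by
    intro x h1 h2
    rw [hmem] at h1 h2
    exact hne (ConnectedComponent.eq.2 (h1.symm.trans h2))
  have haa : a ∈ F.connectedComponentMk a := rfl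
  have hbb : b ∈ F.connectedComponentMk b := rfl
  set A := Finset.univ.filter fun x => x ∈ F.connectedComponentMk a with hA
  set B := Finset.univ.filter fun x => x ∈ F.connectedComponentMk b with hB
  have hAB : A.card = B.card :=
    Finset.card_bij (fun x hx => (φ ⟨x, by simpa [hA] using hx⟩).1)
      (fun x hx => by simp [hB])
      (fun x hx y hy h => by simpa using φ.injective (Subtype.ext h))
      (fun y hy => ⟨(φ.symm ⟨y, by simpa [hB] using hy⟩).1,
        by simp [hA], by simp⟩)
  have hAm : A.card = m := by
    have h1 : Disjoint A B := by
      rw [Finset.disjoint_left]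
      intro x hx hx'
      exact hdisj x (by simpa [hA] using hx) (by simpa [hB] using hx')
    have h2 : Disjoint ({p, q} : Finset V) (A ∪ B) := by
      rw [Finset.disjoint_left]
      intro x hx hx'
      simp only [hA, hB, Finset.mem_union, Finset.mem_filter, Finset.mem_univ, true_and] at hx'
      rcases Finset.mem_insert.1 hx with rfl | hx
      · exact hx'.elim (hiso _ _ hp' hap) (hiso _ _ hp' hbp)
      · rw [Finset.mem_singleton.1 hx] at hx'
        exact hx'.elim (hiso _ _ hq' haq) (hiso _ _ hq' hbq)
    have h3 : ({p, q} : Finset V) ∪ (A ∪ B) = Finset.univ := by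
      ext v
      have := hcover v
      simp only [hA, hB, Finset.mem_union, Finset.mem_insert, Finset.mem_singleton,
        Finset.mem_filter, Finset.mem_univ, true_and, iff_true]
      tauto
    have h4 := congrArg Finset.card h3
    rw [Finset.card_union_of_disjoint h2, Finset.card_union_of_disjoint h1, Finset.card_pair hpq,
      Finset.card_univ, ← Nat.card_eq_fintype_card, hcard] at h4
    omega
  have hroot : ∀ x, x ∈ F.connectedComponentMk a → (x = p ∨ x = q ∨ x = a ∨ x = b) → x = a := by
    rintro x hx (rfl | rfl | h | rfl)
    · exact (hiso _ _ hp' hap hx).elim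
    · exact (hiso _ _ hq' haq hx).elim
    · exact h
    · exact (hdisj _ hx hbb).elim
  have hmodel := exists_arcModel (G := isolate S p) (isolate_not_three_inner hcat) (m - 1) A a
    (by simp [hA, haa]) (by omega) (fun h1 => ?_) (fun x hx y hy hxy => ?_) fun D hD haD hcl => ?_
  · -- The second component is a copy of the first one.
    have build : ∀ α f, IsArcModel (isolate S p) (m - 1) α f A →
        ∃ g, IsDoubleModel S m p q α f g ∧ ∀ i, f i = a → g i = b := by
      intro α f h
      have hf : ∀ i, i ≤ m - 1 → f i ∈ F.connectedComponentMk a := fun i hi => by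
        simpa [hA] using h.mem i hi
      refine ⟨fun i => if hi : f i ∈ F.connectedComponentMk a then (φ ⟨f i, hi⟩).1 else b,
        ⟨h.isProfile, fun v => ?_, fun d h1 h2 => (h.adj d h1 (by omega)).1, fun d h1 h2 => ?_⟩,
        fun i hi => ?_⟩
      · rcases hcover v with hv | hv | hv | hv
        · exact Or.inl hv
        · exact Or.inr (Or.inl hv)
        · obtain ⟨i, hi, rfl⟩ := h.surj v (by simpa [hA] using hv)
          exact Or.inr (Or.inr (Or.inl ⟨i, by omega, rfl⟩))
        · have hw := (φ.symm ⟨v, hv⟩).2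
          obtain ⟨i, hi, hfi⟩ := h.surj (φ.symm ⟨v, hv⟩).1 (by simp [hA])
          refine Or.inr (Or.inr (Or.inr ⟨i, by omega, ?_⟩))
          simp only [hfi]
          rw [dif_pos hw]
          simp
      · have hle := h.isProfile.le (show d ≤ m - 1 by omega)
        have hm1 := hf (α d) (by omega)
        have hm2 := hf (α d + d) hle
        have hadj := (h.adj d h1 (by omega)).1
        have hFadj : F.Adj (f (α d)) (f (α d + d)) := by
          by_contra hn
          obtain ⟨h3, h4⟩ := hSF _ _ hadj hn
          exact hadj.ne ((hroot _ hm1 h3).trans (hroot _ hm2 h4).symm)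
        simp only [dif_pos hm1, dif_pos hm2]
        refine hFS _ _ ?_
        have : (F.connectedComponentMk b).toSimpleGraph.Adj (φ ⟨_, hm1⟩) (φ ⟨_, hm2⟩) :=
          φ.map_adj_iff.2 hFadj
        exact this
      · simp only [hi]
        rw [dif_pos haa, hφ]
    obtain ⟨⟨α, f, h1, h2⟩, ⟨α', f', h3, h4⟩⟩ := hmodel
    obtain ⟨g, hg, hg'⟩ := build α f h1
    obtain ⟨g', hg1, hg1'⟩ := build α' f' h3
    exact ⟨⟨α, f, g, hg, h2, hg' _ h2⟩, ⟨α', f', g', hg1, h4, hg1' _ h4⟩⟩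
  · refine ⟨b, fun h => hdisj b (by simpa [hA] using h) hbb, ⟨hab, hap, hbp⟩, ?_⟩
    obtain ⟨x, hx, hxb⟩ := Finset.exists_mem_ne (show 1 < B.card by omega) b
    rw [hB, Finset.mem_filter, hmem] at hx
    obtain ⟨y, hy⟩ := exists_adj_of_reachable hx.2.symm hxb.symm
    refine ⟨a, y, ?_, ⟨hab.symm, hbp, hap⟩, hFS _ _ hy, hbp, ?_⟩
    · rintro rfl
      exact hdisj _ haa (hmemadj hy hbb)
    · rintro rfl
      exact hp' _ hy.symm
  · simp only [hA, Finset.mem_filter, Finset.mem_univ, true_and] at hx hy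
    refine hroot x hx (hSF x y hxy.1 fun h => hy (hmemadj h hx)).1
  · refine Finset.Subset.antisymm hD fun x hx => ?_
    by_contra hxD
    simp only [hA, Finset.mem_filter, Finset.mem_univ, true_and] at hx
    obtain ⟨w⟩ := ((hmem _ _).1 hx).symm
    obtain ⟨d, -, h1, h2⟩ := w.exists_boundary_dart (D : Set V) haD hxD
    have h3 : d.fst ∈ F.connectedComponentMk a := by simpa [hA] using hD h1
    have h4 := hmemadj d.adj h3
    refine h2 (hcl _ h1 _ (by simpa [hA] using h4) ⟨hFS _ _ d.adj, ?_, ?_⟩)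
    · intro h; exact hp' _ (h ▸ d.adj)
    · intro h; exact hp' _ (h ▸ d.adj.symm)

/-- Every `w`-caterpillar is a rotated tree: the path `u₁u₂u₃u₄` becomes the centre, `0`, `m`, `2m`,
and the two components of the splitting fill the rest of the circle. -/
theorem exists_iso_of_isWCaterpillar {V : Type*} {S : SimpleGraph V} (hm : 1 ≤ m)
    (hcard : Nat.card V = 2 * m + 2) (hS : IsWCaterpillar S) :
    ∃ a, IsProfile m a ∧ Nonempty (rotatedTree (m := m) a 0 ≃g S) := by
  obtain ⟨u₁, u₂, u₃, u₄, ⟨htree, h12, h23, h34, h13, h14, h24, hsplit⟩, hcat⟩ := hS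
  set E : Set (Sym2 V) := {s(u₁, u₂), s(u₂, u₃), s(u₃, u₄)} with hE
  have hFS : ∀ x y, (S.deleteEdges E).Adj x y → S.Adj x y := fun x y h =>
    (deleteEdges_adj.1 h).1
  have hSF : ∀ x y, S.Adj x y → ¬ (S.deleteEdges E).Adj x y →
      (x = u₁ ∨ x = u₂ ∨ x = u₃ ∨ x = u₄) ∧ (y = u₁ ∨ y = u₂ ∨ y = u₃ ∨ y = u₄) := by
    intro x y hxy hn
    rw [deleteEdges_adj, not_and, not_not] at hn
    have := hn hxy
    simp only [hE, Set.mem_insert_iff, Set.mem_singleton_iff, Sym2.eq_iff] at this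
    tauto
  have hstep : ∀ {α : ℕ → ℕ} (c : ℕ) (hα : IsProfile (m - 1) α) (hc : c = 0 ∨ c = 1),
      IsProfile m fun d => if d < m then α d + c else 0 := by
    refine fun c hα hc => ⟨by simp, fun d hd => ?_⟩
    by_cases hd' : d + 1 < m
    · have := hα.step d (by omega)
      simp only [hd, hd', if_true]
      omega
    · obtain rfl : d = m - 1 := by omega
      simp only [hd, hd', if_true, if_false, hα.top]
      omega
  rcases hsplit with h | h
  · obtain ⟨⟨α, f, g, hM, hf, hg⟩, -⟩ := exists_doubleModel hm hcard h hFS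
      (fun x y h1 h2 => by have := hSF x y h1 h2; tauto) h23.symm hcat
    obtain ⟨w, hw1, hw2, hw3⟩ : ∃ w : ℕ → V, (∀ i < m, w i = g i) ∧ (∀ i < m, w (m + i) = f i) ∧
        w (m + m) = u₄ := by
      refine ⟨fun i => if i < m then g i else if i < m + m then f (i - m) else u₄, fun i hi => ?_,
        fun i hi => ?_, ?_⟩
      · simp [hi]
      · simp [hi]
      · simp
    have h0 : w 0 = u₂ := (hw1 0 (by omega)).trans hg
    have hm0 : w m = u₃ := (hw2 0 (by omega)).trans hf
    refine ⟨_, hstep 0 hM.isProfile (Or.inl rfl), nonempty_iso_of_surj hm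
      (hstep 0 hM.isProfile (Or.inl rfl)) htree hcard u₁ w (fun v => ?_) (by rwa [h0])
      (fun d h1 h2 => ?_) fun d h1 h2 => ?_⟩
    · rcases hM.surj v with hv | rfl | ⟨i, hi, rfl⟩ | ⟨i, hi, rfl⟩
      · exact Or.inl hv
      · exact Or.inr ⟨m + m, by omega, hw3⟩
      · exact Or.inr ⟨m + i, by omega, hw2 i hi⟩
      · exact Or.inr ⟨i, by omega, hw1 i hi⟩
    · by_cases hd : d < m
      · have := hM.isProfile.le (show d ≤ m - 1 by omega)
        simp only [hd, if_true]
        rw [add_zero, hw1 _ (by omega), hw1 _ (by omega)]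
        exact hM.adj_right d h1 hd
      · obtain rfl : d = m := by omega
        simp only [hd, if_false]
        rwa [zero_add, h0, hm0]
    · by_cases hd : d < m
      · have := hM.isProfile.le (show d ≤ m - 1 by omega)
        simp only [hd, if_true]
        rw [add_zero, add_assoc, hw2 _ (by omega), hw2 _ (by omega)]
        exact hM.adj_left d h1 hd
      · obtain rfl : d = m := by omega
        simp only [hd, if_false]
        rwa [add_zero, hm0, hw3]
  · obtain ⟨-, ⟨α, f, g, hM, hf, hg⟩⟩ := exists_doubleModel hm hcard h hFS
      (fun x y h1 h2 => by have := hSF x y h1 h2; tauto) h34 hcat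
    obtain ⟨w, h0, hw1, hw2⟩ : ∃ w : ℕ → V, w 0 = u₂ ∧ (∀ i < m, w (i + 1) = f i) ∧
        ∀ i < m, w (m + (i + 1)) = g i := by
      refine ⟨fun i => if i = 0 then u₂ else if i < m + 1 then f (i - 1) else g (i - (m + 1)),
        by simp, fun i hi => ?_, fun i hi => ?_⟩
      · simp [hi]
      · have h1 : ¬ m + (i + 1) < m + 1 := by omega
        have h2 : m + (i + 1) ≠ 0 := by omega
        simp only [h1, h2, if_false]
        congr 1
        omega
    have hm0 : w m = u₃ := by
      have := hw1 (m - 1) (by omega)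
      rwa [Nat.sub_add_cancel hm, hf] at this
    have hm1 : w (m + m) = u₄ := by
      have := hw2 (m - 1) (by omega)
      rwa [Nat.sub_add_cancel hm, hg] at this
    refine ⟨_, hstep 1 hM.isProfile (Or.inr rfl), nonempty_iso_of_surj hm
      (hstep 1 hM.isProfile (Or.inr rfl)) htree hcard u₁ w (fun v => ?_) (by rwa [h0])
      (fun d h1 h2 => ?_) fun d h1 h2 => ?_⟩
    · rcases hM.surj v with hv | rfl | ⟨i, hi, rfl⟩ | ⟨i, hi, rfl⟩
      · exact Or.inl hv
      · exact Or.inr ⟨0, by omega, h0⟩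
      · exact Or.inr ⟨i + 1, by omega, hw1 i hi⟩
      · exact Or.inr ⟨m + (i + 1), by omega, hw2 i hi⟩
    · by_cases hd : d < m
      · have := hM.isProfile.le (show d ≤ m - 1 by omega)
        simp only [hd, if_true]
        rw [hw1 _ (by omega), add_right_comm, hw1 _ (by omega)]
        exact hM.adj_left d h1 hd
      · obtain rfl : d = m := by omega
        simp only [hd, if_false]
        rwa [zero_add, h0, hm0]
    · by_cases hd : d < m
      · have := hM.isProfile.le (show d ≤ m - 1 by omega)
        simp only [hd, if_true]
        rw [hw2 _ (by omega), add_assoc, add_right_comm, hw2 _ (by omega)]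
        exact hM.adj_right d h1 hd
      · obtain rfl : d = m := by omega
        simp only [hd, if_false]
        rwa [add_zero, hm0, hm1]

end

/-! ### Partitions from a profile -/

section

variable {m : ℕ}

/-- The arcs from `x` to `x + m` with `x ∈ J` do not overlap, and no point strictly inside one of
them lies in `R`. -/
def AreArcsSeparate (J R : Set (ZMod (2 * m + 1))) : Prop :=
  ∀ x ∈ J, ∀ j : ℕ, 0 < j → j < m → x + (j : ℕ) ∉ R ∧
    ∀ x' ∈ J, ∀ i : ℕ, i ≤ m → x + (j : ℕ) = x' + (i : ℕ) → x' = x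

lemma isNoncrossing_profileGraph {a : ℕ → ℕ} (ha : IsProfile m a) {J R : Set (ZMod (2 * m + 1))}
    (h : AreArcsSeparate J R) : IsNoncrossing (profileGraph a J R) := by
  intro y d hd hy j h0 hj w hw
  rw [profileGraph_adj_chord (by omega) hd] at hy
  obtain ⟨x, hx⟩ : ∃ x, y - (a d : ℕ) = x := ⟨_, rfl⟩
  obtain rfl : y = x + (a d : ℕ) := by rw [← hx]; ring
  rw [hx] at hy
  have had := ha.le hd
  have e : ∀ i : ℕ, x + (a d : ℕ) + (i : ℕ) = x + (a d + i : ℕ) := fun i => by push_cast; ring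
  obtain ⟨h1, h2⟩ := h x hy (a d + j) (by omega) (by omega)
  rw [e] at hw
  match w with
  | none => exact (h1 (profileGraph_adj_none.1 hw.symm)).elim
  | some y =>
    obtain ⟨x', hx', f, hf1, hf2, hf⟩ := profileGraph_adj_some.1 hw
    have haf := ha.le hf2
    obtain rfl : x' = x := by
      rcases hf with ⟨h3, -⟩ | ⟨-, h3⟩
      · exact h2 x' hx' _ (by omega) h3
      · exact h2 x' hx' _ haf h3
    rcases hf with ⟨h3, rfl⟩ | ⟨rfl, h3⟩
    · have h4 := add_natCast_inj h3 (by omega) (by omega)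
      rcases le_total d f with hle | hle
      · have := ha.nested hle hf2
        omega
      · have := ha.nested hle hd
        exact ⟨a f + f - a d, by omega, by rw [e, Nat.add_sub_cancel' (by omega)]⟩
    · have h4 := add_natCast_inj h3 (by omega) (by omega)
      rcases le_total d f with hle | hle
      · have := ha.nested hle hf2
        omega
      · have := ha.nested hle hd
        exact ⟨a f - a d, by omega, by rw [e, Nat.add_sub_cancel' (by omega)]⟩

lemma isNoncrossing_specialTree {a : ℕ → ℕ} (ha : IsProfile m a) (x₀ : ZMod (2 * m + 1)) :
    IsNoncrossing (specialTree a x₀) := by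
  refine isNoncrossing_profileGraph ha ?_
  rintro x rfl j h0 hj
  refine ⟨?_, by rintro x' rfl i - -; rfl⟩
  rintro (h | ⟨i, h1, h2, h⟩)
  · have h3 : x + (j : ℕ) = x + (0 : ℕ) := by simpa using h
    have := add_natCast_inj h3 (by omega) (by omega)
    omega
  · have := add_natCast_inj h (by omega) (by omega)
    omega

lemma isNoncrossing_rotatedTree {a : ℕ → ℕ} (ha : IsProfile m a) (s : ZMod (2 * m + 1)) :
    IsNoncrossing (rotatedTree a s) := by
  refine isNoncrossing_profileGraph ha ?_
  have e : ∀ i : ℕ, s + (m : ℕ) + (i : ℕ) = s + (m + i : ℕ) := fun i => by push_cast; ring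
  have e0 : s = s + (0 : ℕ) := by simp
  rintro x (rfl | rfl) j h0 hj
  · refine ⟨fun h => ?_, ?_⟩
    · have := add_natCast_inj ((Set.mem_singleton_iff.1 h).trans e0) (by omega) (by omega)
      omega
    · rintro x' (rfl | rfl) i hi h
      · rfl
      · rw [e] at h
        have := add_natCast_inj h (by omega) (by omega)
        omega
  · refine ⟨fun h => ?_, ?_⟩
    · rw [e] at h
      have := add_natCast_inj ((Set.mem_singleton_iff.1 h).trans e0) (by omega) (by omega)
      omega
    · rintro x' (rfl | rfl) i hi h
      · rw [e] at h
        have := add_natCast_inj h (by omega) (by omega)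
        omega
      · rfl

lemma partitionsComplete_profileGraph {ι : Type*} (a : ℕ → ℕ) (J R : ι → Set (ZMod (2 * m + 1)))
    (hJ : ∀ x, ∃! t, x ∈ J t) (hR : ∀ x, ∃! t, x ∈ R t) :
    PartitionsComplete fun t => profileGraph a (J t) (R t) := by
  have hnone : ∀ x, ∃! t, (profileGraph a (J t) (R t)).Adj none (some x) := by
    intro x
    simpa only [profileGraph_adj_none] using hR x
  have hsome : ∀ (x : ZMod (2 * m + 1)) (d : ℕ), 1 ≤ d → d ≤ m →
      ∃! t, (profileGraph a (J t) (R t)).Adj (some x) (some (x + (d : ℕ))) := by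
    intro x d h1 h2
    simpa only [profileGraph_adj_chord h1 h2] using hJ _
  intro u v huv
  match u, v with
  | none, none => exact (huv rfl).elim
  | none, some x => exact hnone x
  | some x, none => simpa only [adj_comm _ (some x)] using hnone x
  | some x, some y =>
    obtain ⟨d, h1, h2, rfl | rfl⟩ := exists_chord (fun h => huv (congrArg some h))
    · exact hsome x d h1 h2
    · simpa only [adj_comm _ (some (y + (d : ZMod (2 * m + 1))))] using hsome y d h1 h2

/-- The family of trees with a given profile: the special tree with longest chord at `0`, and the
rotated trees with longest chords at `t` and `t + m` for `1 ≤ t ≤ m`. -/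
def profileFamily (m : ℕ) (a : ℕ → ℕ) (t : Fin (m + 1)) :
    SimpleGraph (Option (ZMod (2 * m + 1))) :=
  if t = 0 then specialTree a 0 else rotatedTree a (t : ℕ)

lemma partitionsComplete_profileFamily (m : ℕ) (a : ℕ → ℕ) :
    PartitionsComplete (profileFamily m a) := by
  have hval : ∀ t : Fin (m + 1), t ≠ 0 ↔ t.val ≠ 0 := fun t => Fin.val_ne_zero_iff.symm
  have hinj : ∀ {i j : ℕ}, (i : ZMod (2 * m + 1)) = j → i < 2 * m + 1 → j < 2 * m + 1 → i = j :=
    fun h hi hj => natCast_inj hi hj h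
  have heq : profileFamily m a = fun t : Fin (m + 1) => profileGraph a
      (if t = 0 then ({0} : Set (ZMod (2 * m + 1)))
        else {((t : ℕ) : ZMod (2 * m + 1)), ((t : ℕ) : ZMod (2 * m + 1)) + (m : ℕ)})
      (if t = 0 then specialRadii (0 : ZMod (2 * m + 1)) else {((t : ℕ) : ZMod (2 * m + 1))}) := by
    funext t
    unfold profileFamily
    split_ifs <;> rfl
  rw [heq]
  have hidx : ∀ x : ZMod (2 * m + 1), ∃ i : ℕ, i < 2 * m + 1 ∧ x = i := fun x => by
    obtain ⟨i, hi, h⟩ := exists_eq_add 0 x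
    exact ⟨i, hi, by rw [h, zero_add]⟩
  have h0 : ((0 : ℕ) : ZMod (2 * m + 1)) = 0 := Nat.cast_zero
  refine partitionsComplete_profileGraph a _ _ (fun x => ?_) fun x => ?_
  · obtain ⟨i, hi, rfl⟩ := hidx x
    have hmem : ∀ t : Fin (m + 1), ((i : ZMod (2 * m + 1)) ∈
        (if t = 0 then ({0} : Set (ZMod (2 * m + 1)))
        else {((t : ℕ) : ZMod (2 * m + 1)), ((t : ℕ) : ZMod (2 * m + 1)) + (m : ℕ)} :
          Set (ZMod (2 * m + 1)))) ↔ (t.val = 0 ∧ i = 0) ∨ (t.val ≠ 0 ∧ (i = t ∨ i = t + m)) := by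
      intro t
      split_ifs with ht
      · subst ht
        rw [Set.mem_singleton_iff]
        constructor
        · intro h
          exact Or.inl ⟨rfl, hinj (h.trans h0.symm) hi (by omega)⟩
        · rintro (⟨-, rfl⟩ | ⟨h, -⟩)
          · exact h0
          · exact (h rfl).elim
      · have ht' := (hval t).1 ht
        rw [Set.mem_insert_iff, Set.mem_singleton_iff, ← Nat.cast_add]
        constructor
        · rintro (h | h)
          · exact Or.inr ⟨ht', Or.inl (hinj h hi (by omega))⟩
          · exact Or.inr ⟨ht', Or.inr (hinj h hi (by omega))⟩
        · rintro (⟨h, -⟩ | ⟨-, h | h⟩)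
          · exact (ht' h).elim
          · left; rw [← h]
          · right; rw [← h]
    simp only [hmem]
    refine ⟨⟨if i ≤ m then i else i - m, by split_ifs <;> omega⟩, ?_, fun t ht => ?_⟩
    · simp only
      split_ifs <;> omega
    · ext
      simp only
      split_ifs <;> omega
  · obtain ⟨i, hi, rfl⟩ := hidx x
    have hmem : ∀ t : Fin (m + 1), ((i : ZMod (2 * m + 1)) ∈
        (if t = 0 then specialRadii (0 : ZMod (2 * m + 1)) else {((t : ℕ) : ZMod (2 * m + 1))} :
          Set (ZMod (2 * m + 1)))) ↔ (t.val = 0 ∧ (i = 0 ∨ m < i)) ∨ (t.val ≠ 0 ∧ i = t) := by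
      intro t
      split_ifs with ht
      · subst ht
        constructor
        · rintro (h | ⟨j, h1, h2, h⟩)
          · exact Or.inl ⟨rfl, Or.inl (hinj (h.trans h0.symm) hi (by omega))⟩
          · rw [zero_add] at h
            have := hinj h hi h2
            exact Or.inl ⟨rfl, Or.inr (by omega)⟩
        · rintro (⟨-, rfl | h⟩ | ⟨h, -⟩)
          · exact Or.inl h0
          · exact Or.inr ⟨i, h, hi, by rw [zero_add]⟩
          · exact (h rfl).elim
      · have ht' := (hval t).1 ht
        rw [Set.mem_singleton_iff]
        constructor
        · exact fun h => Or.inr ⟨ht', hinj h hi (by omega)⟩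
        · rintro (⟨h, -⟩ | ⟨-, h⟩)
          · exact (ht' h).elim
          · rw [← h]
    simp only [hmem]
    refine ⟨⟨if i ≤ m then i else 0, by split_ifs <;> omega⟩, ?_, fun t ht => ?_⟩
    · simp only
      split_ifs <;> omega
    · ext
      simp only
      split_ifs <;> omega

/-- The rotation of the wheel that maps `0` to `s`. -/
def rotation (s : ZMod (2 * m + 1)) : Option (ZMod (2 * m + 1)) ≃ Option (ZMod (2 * m + 1)) :=
  (Equiv.addRight s).optionCongr

lemma rotatedTree_comap_rotation (a : ℕ → ℕ) (s : ZMod (2 * m + 1)) :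
    (rotatedTree a s).comap (rotation s) = rotatedTree a 0 := by
  refine graph_ext (fun x => ?_) fun x d h1 h2 => ?_
  · rw [profileGraph_adj_none]
    change (rotatedTree a s).Adj none (some (x + s)) ↔ _
    rw [profileGraph_adj_none]
    simp
  · rw [profileGraph_adj_chord h1 h2]
    change (rotatedTree a s).Adj (some (x + s)) (some (x + (d : ℕ) + s)) ↔ _
    rw [add_right_comm, profileGraph_adj_chord h1 h2]
    simp only [Set.mem_insert_iff, Set.mem_singleton_iff]
    constructor
    · rintro (h | h)
      · left; linear_combination h
      · right; linear_combination h
    · rintro (h | h)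
      · left; linear_combination h
      · right; linear_combination h

lemma nonempty_iso_rotatedTree (a : ℕ → ℕ) (s : ZMod (2 * m + 1)) :
    Nonempty (rotatedTree (m := m) a 0 ≃g rotatedTree a s) :=
  ⟨rotatedTree_comap_rotation a s ▸ Iso.comap (rotation s) (rotatedTree a s)⟩

end

/-! ### Geometry of the regular wheel -/

section

variable {m : ℕ}

/-- The position of a vertex of the wheel with centre `c` and with the point `0` at `c + z`. -/
noncomputable def wheelPoint (m : ℕ) (c z : ℂ) : Option (ZMod (2 * m + 1)) → ℂ
  | none => c
  | some x => c + z * (ZMod.toCircle x : ℂ)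

/-- Coordinates in which the circle is the unit circle and the perpendicular bisector of the chord
from `x` to `x + d` is the real axis. -/
noncomputable def chordCoord (c z : ℂ) (x : ZMod (2 * m + 1)) (d : ℕ) (p : ℂ) : ℂ :=
  (p - c) * ((ZMod.toCircle x : ℂ)⁻¹ * Complex.exp ((-(Real.pi * d / (2 * m + 1)) : ℝ) * Complex.I)
    / z)

section

variable {c z : ℂ}

lemma wheelPoint_injective (hz : z ≠ 0) : Function.Injective (wheelPoint m c z) := by
  intro u v h
  match u, v with
  | none, none => rfl
  | none, some x => simp [wheelPoint, hz] at h
  | some x, none => simp [wheelPoint, hz] at h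
  | some x, some y =>
    simp only [wheelPoint, add_right_inj, mul_right_inj' hz] at h
    rw [ZMod.injective_toCircle (Subtype.ext h)]

lemma chordCoord_comb (x : ZMod (2 * m + 1)) (d : ℕ) (u v : ℂ) {s t : ℝ} (hst : s + t = 1) :
    chordCoord c z x d (s • u + t • v) = s • chordCoord c z x d u + t • chordCoord c z x d v := by
  have : (s : ℂ) + t = 1 := by exact_mod_cast hst
  simp only [chordCoord, Complex.real_smul]
  linear_combination (c * ((ZMod.toCircle x : ℂ)⁻¹ *
    Complex.exp ((-(Real.pi * d / (2 * m + 1)) : ℝ) * Complex.I) / z)) * this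

lemma chordCoord_re_comb (x : ZMod (2 * m + 1)) (d : ℕ) (u v : ℂ) {s t : ℝ} (hst : s + t = 1) :
    (chordCoord c z x d (s • u + t • v)).re =
      s * (chordCoord c z x d u).re + t * (chordCoord c z x d v).re := by
  rw [chordCoord_comb x d u v hst]
  simp

lemma norm_chordCoord (x : ZMod (2 * m + 1)) (d : ℕ) (p : ℂ) :
    ‖chordCoord c z x d p‖ = ‖p - c‖ / ‖z‖ := by
  rw [chordCoord, norm_mul, norm_div, norm_mul, Complex.norm_exp_ofReal_mul_I, norm_inv,
    Circle.norm_coe]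
  ring

lemma chordCoord_injective (hz : z ≠ 0) (x : ZMod (2 * m + 1)) (d : ℕ) :
    Function.Injective (chordCoord c z x d) := by
  intro p q h
  have : ‖p - q‖ = 0 := by
    have h1 : chordCoord (p - p + q) z x d p = 0 := by
      rw [chordCoord] at h ⊢
      rw [chordCoord] at h
      have h2 := sub_eq_zero.2 h
      rw [← sub_mul, sub_sub_sub_cancel_right] at h2
      simpa using h2
    have h2 := norm_chordCoord (c := p - p + q) (z := z) x d p
    rw [h1, norm_zero] at h2
    have h3 := (div_eq_zero_iff.1 h2.symm).resolve_right (norm_ne_zero_iff.2 hz)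
    simpa using h3
  exact sub_eq_zero.1 (norm_eq_zero.1 this)

lemma chordCoord_point (hz : z ≠ 0) (x : ZMod (2 * m + 1)) (d j : ℕ) :
    chordCoord c z x d (wheelPoint m c z (some (x + (j : ℕ)))) =
      Complex.exp ((Real.pi * (2 * j - d) / (2 * m + 1) : ℝ) * Complex.I) := by
  have h1 : (ZMod.toCircle (x + (j : ZMod (2 * m + 1))) : ℂ) = ZMod.toCircle x *
      Complex.exp ((Real.pi * (2 * j) / (2 * m + 1) : ℝ) * Complex.I) := by
    rw [AddChar.map_add_eq_mul, Circle.coe_mul, ZMod.toCircle_natCast]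
    congr 2
    push_cast
    ring
  have h2 : Complex.exp ((Real.pi * (2 * j - d) / (2 * m + 1) : ℝ) * Complex.I) =
      Complex.exp ((Real.pi * (2 * j) / (2 * m + 1) : ℝ) * Complex.I) *
        Complex.exp ((-(Real.pi * d / (2 * m + 1)) : ℝ) * Complex.I) := by
    rw [← Complex.exp_add]
    congr 1
    push_cast
    ring
  have h3 : (ZMod.toCircle x : ℂ) ≠ 0 := Circle.coe_ne_zero _
  rw [chordCoord, wheelPoint, h1, h2]
  field_simp
  ring

lemma chordCoord_re_point (hz : z ≠ 0) (x : ZMod (2 * m + 1)) (d j : ℕ) :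
    (chordCoord c z x d (wheelPoint m c z (some (x + (j : ℕ))))).re =
      Real.cos (Real.pi * d / (2 * m + 1)) +
        2 * Real.sin (Real.pi * j / (2 * m + 1)) * Real.sin (Real.pi * (d - j) / (2 * m + 1)) := by
  rw [chordCoord_point hz, Complex.exp_ofReal_mul_I_re,
    show Real.pi * (2 * j - d) / (2 * m + 1) =
      Real.pi * j / (2 * m + 1) - Real.pi * (d - j) / (2 * m + 1) by ring,
    show Real.pi * d / (2 * m + 1) =
      Real.pi * j / (2 * m + 1) + Real.pi * (d - j) / (2 * m + 1) by ring,
    Real.cos_sub, Real.cos_add]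
  ring

lemma sin_pos_of_lt {t : ℝ} (h0 : 0 < t) (h1 : t < 2 * m + 1) :
    0 < Real.sin (Real.pi * t / (2 * m + 1)) := by
  refine Real.sin_pos_of_pos_of_lt_pi (by positivity) ?_
  rw [div_lt_iff₀ (by positivity)]
  exact mul_lt_mul_of_pos_left h1 Real.pi_pos

lemma lt_chordCoord_re (hz : z ≠ 0) (x : ZMod (2 * m + 1)) {d j : ℕ} (h0 : 0 < j) (hj : j < d)
    (hd : d ≤ m) : Real.cos (Real.pi * d / (2 * m + 1)) <
      (chordCoord c z x d (wheelPoint m c z (some (x + (j : ℕ))))).re := by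
  have hj' : (j : ℝ) < d := by exact_mod_cast hj
  have hd' : (d : ℝ) ≤ m := by exact_mod_cast hd
  have h0' : (0 : ℝ) < j := by exact_mod_cast h0
  rw [chordCoord_re_point hz]
  have h1 := sin_pos_of_lt (m := m) (t := j) h0' (by linarith)
  have h2 := sin_pos_of_lt (m := m) (t := d - j) (by linarith) (by linarith)
  have := mul_pos h1 h2
  linarith

lemma chordCoord_re_lt (hz : z ≠ 0) (x : ZMod (2 * m + 1)) {d j : ℕ} (hj : d < j)
    (hj' : j < 2 * m + 1) : (chordCoord c z x d (wheelPoint m c z (some (x + (j : ℕ))))).re <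
      Real.cos (Real.pi * d / (2 * m + 1)) := by
  have h3 : (d : ℝ) < j := by exact_mod_cast hj
  have h4 : (j : ℝ) < 2 * m + 1 := by exact_mod_cast hj'
  have h5 : (0 : ℝ) ≤ d := Nat.cast_nonneg _
  rw [chordCoord_re_point hz]
  have h1 := sin_pos_of_lt (m := m) (t := j) (by linarith) (by linarith)
  have h2 := sin_pos_of_lt (m := m) (t := j - d) (by linarith) (by linarith)
  rw [show Real.pi * ((d : ℝ) - j) / (2 * m + 1) = -(Real.pi * (j - d) / (2 * m + 1)) by ring,
    Real.sin_neg]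
  have := mul_pos h1 h2
  linarith

lemma chordCoord_re_start (hz : z ≠ 0) (x : ZMod (2 * m + 1)) (d : ℕ) :
    (chordCoord c z x d (wheelPoint m c z (some x))).re = Real.cos (Real.pi * d / (2 * m + 1)) := by
  have := chordCoord_re_point (c := c) hz x d 0
  simpa using this

lemma chordCoord_re_end (hz : z ≠ 0) (x : ZMod (2 * m + 1)) (d : ℕ) :
    (chordCoord c z x d (wheelPoint m c z (some (x + (d : ℕ))))).re =
      Real.cos (Real.pi * d / (2 * m + 1)) := by
  have := chordCoord_re_point (c := c) hz x d d
  simpa using this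

lemma chordCoord_re_none (x : ZMod (2 * m + 1)) {d : ℕ} (hd : d ≤ m) :
    (chordCoord c z x d (wheelPoint m c z none)).re < Real.cos (Real.pi * d / (2 * m + 1)) := by
  have h1 : (chordCoord c z x d (wheelPoint m c z none)).re = 0 := by simp [chordCoord, wheelPoint]
  rw [h1]
  have hd' : (d : ℝ) ≤ m := by exact_mod_cast hd
  have hpos : (0 : ℝ) < 2 * m + 1 := by positivity
  refine Real.cos_pos_of_mem_Ioo ⟨?_, ?_⟩
  · have : 0 ≤ Real.pi * d / (2 * m + 1) := by positivity
    linarith [Real.pi_pos]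
  · rw [div_lt_div_iff₀ hpos two_pos]
    nlinarith [Real.pi_pos]

/-- The points of the wheel outside the closed arc from `x` to `x + d` lie below its chord. -/
lemma chordCoord_re_lt_of_ne (hz : z ≠ 0) (x : ZMod (2 * m + 1)) {d : ℕ} (hd : d ≤ m)
    {w : Option (ZMod (2 * m + 1))} (hw : ¬ ∃ i : ℕ, i ≤ d ∧ w = some (x + (i : ℕ))) :
    (chordCoord c z x d (wheelPoint m c z w)).re < Real.cos (Real.pi * d / (2 * m + 1)) := by
  match w with
  | none => exact chordCoord_re_none x hd
  | some y =>
    obtain ⟨i, hi, rfl⟩ := exists_eq_add x y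
    exact chordCoord_re_lt hz x (lt_of_not_ge fun h => hw ⟨i, h, rfl⟩) hi

/-- A point of the open disc on the line through two points of the circle lies between them. -/
lemma mem_openSegment_of_norm_lt (hz : z ≠ 0) (x : ZMod (2 * m + 1)) {d : ℕ} (h1 : 1 ≤ d)
    (hd : d ≤ m) {p : ℂ} (hp : ‖p - c‖ < ‖z‖)
    (hre : (chordCoord c z x d p).re = Real.cos (Real.pi * d / (2 * m + 1))) :
    p ∈ openSegment ℝ (wheelPoint m c z (some x)) (wheelPoint m c z (some (x + (d : ℕ)))) := by
  set θ : ℝ := Real.pi * d / (2 * m + 1) with hθ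
  have hd0 : (1 : ℝ) ≤ d := by exact_mod_cast h1
  have hd' : (d : ℝ) ≤ m := by exact_mod_cast hd
  have hsin : 0 < Real.sin θ := sin_pos_of_lt (by linarith) (by linarith)
  set y := (chordCoord c z x d p).im with hy
  have hnorm : ‖chordCoord c z x d p‖ < 1 := by
    rw [norm_chordCoord, div_lt_one (norm_pos_iff.2 hz)]
    exact hp
  have hsq : y ^ 2 < Real.sin θ ^ 2 := by
    have h2 : ‖chordCoord c z x d p‖ ^ 2 = Real.cos θ ^ 2 + y ^ 2 := by
      rw [← Complex.normSq_eq_norm_sq, Complex.normSq_apply, hre]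
      ring
    have h3 : ‖chordCoord c z x d p‖ ^ 2 < 1 := by
      have := norm_nonneg (chordCoord c z x d p)
      nlinarith
    have h4 := Real.sin_sq_add_cos_sq θ
    linarith
  obtain ⟨h2, h3⟩ := abs_lt.1 (sq_lt_sq.1 hsq)
  rw [abs_of_pos hsin] at h2 h3
  refine ⟨(Real.sin θ - y) / (2 * Real.sin θ), (Real.sin θ + y) / (2 * Real.sin θ),
    div_pos (by linarith) (by linarith), div_pos (by linarith) (by linarith), by field_simp; ring,
    ?_⟩
  apply chordCoord_injective (c := c) hz x d
  rw [chordCoord_comb _ _ _ _ (by field_simp; ring)]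
  have e1 : chordCoord c z x d (wheelPoint m c z (some x)) =
      Complex.exp ((-θ : ℝ) * Complex.I) := by
    have := chordCoord_point (c := c) hz x d 0
    rw [Nat.cast_zero, add_zero] at this
    rw [this]
    congr 3
    rw [hθ]
    push_cast
    ring
  have e2 : chordCoord c z x d (wheelPoint m c z (some (x + (d : ℕ)))) =
      Complex.exp ((θ : ℝ) * Complex.I) := by
    rw [chordCoord_point hz x d d]
    congr 3
    rw [hθ]
    ring
  rw [e1, e2]
  apply Complex.ext
  · simp only [Complex.add_re, Complex.real_smul, Complex.re_ofReal_mul,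
      Complex.exp_ofReal_mul_I_re, Real.cos_neg, hre]
    field_simp
    ring
  · simp only [Complex.add_im, Complex.real_smul, Complex.im_ofReal_mul,
      Complex.exp_ofReal_mul_I_im, Real.sin_neg, ← hy]
    field_simp
    ring

lemma norm_wheelPoint_le (u : Option (ZMod (2 * m + 1))) : ‖wheelPoint m c z u - c‖ ≤ ‖z‖ := by
  match u with
  | none => simp [wheelPoint]
  | some x => simp [wheelPoint, Circle.norm_coe]

/-- An edge from a point strictly inside an arc to a point outside it crosses the chord. -/
lemma exists_mem_openSegment (hz : z ≠ 0) (x : ZMod (2 * m + 1)) {d j : ℕ} (hd : d ≤ m)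
    (h0 : 0 < j) (hj : j < d) {w : Option (ZMod (2 * m + 1))}
    (hw : ¬ ∃ i : ℕ, i ≤ d ∧ w = some (x + (i : ℕ))) :
    ∃ p, p ∈ openSegment ℝ (wheelPoint m c z (some x)) (wheelPoint m c z (some (x + (d : ℕ)))) ∧
      p ∈ openSegment ℝ (wheelPoint m c z (some (x + (j : ℕ)))) (wheelPoint m c z w) := by
  set u := wheelPoint m c z (some (x + (j : ℕ))) with hu
  set v := wheelPoint m c z w with hv
  have h1 := lt_chordCoord_re (c := c) hz x h0 hj hd
  have h2 := chordCoord_re_lt_of_ne (c := c) hz x hd hw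
  rw [← hu] at h1
  rw [← hv] at h2
  set h := Real.cos (Real.pi * d / (2 * m + 1)) with hh
  set hu' := (chordCoord c z x d u).re
  set hv' := (chordCoord c z x d v).re
  have hne : u ≠ v := by
    intro e
    have : hu' = hv' := by simp only [hu', hv', e]
    linarith
  have hpos : 0 < hu' - hv' := by linarith
  have hsum : (h - hv') / (hu' - hv') + (hu' - h) / (hu' - hv') = 1 := by field_simp; ring
  have hmem : ((h - hv') / (hu' - hv')) • u + ((hu' - h) / (hu' - hv')) • v ∈ openSegment ℝ u v :=
    ⟨_, _, div_pos (by linarith) hpos, div_pos (by linarith) hpos, hsum, rfl⟩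
  refine ⟨_, mem_openSegment_of_norm_lt hz x (by omega) hd ?_ ?_, hmem⟩
  · have hball : ∀ u, wheelPoint m c z u ∈ Metric.closedBall c ‖z‖ := fun u => by
      rw [mem_closedBall_iff_norm]; exact norm_wheelPoint_le u
    have := (strictConvex_closedBall ℝ c ‖z‖).openSegment_subset (hball _) (hball w) hne hmem
    rw [interior_closedBall _ (norm_ne_zero_iff.2 hz), mem_ball_iff_norm] at this
    exact this
  · rw [chordCoord_re_comb x d u v hsum]
    change _ * hu' + _ * hv' = h
    field_simp
    ring

lemma disjoint_openSegment_of_re (x : ZMod (2 * m + 1)) (d : ℕ) {u v w w' : ℂ} {h : ℝ}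
    (hu : (chordCoord c z x d u).re = h) (hv : (chordCoord c z x d v).re = h)
    (hw : (h < (chordCoord c z x d w).re ∧ h ≤ (chordCoord c z x d w').re) ∨
      ((chordCoord c z x d w).re < h ∧ (chordCoord c z x d w').re ≤ h)) :
    Disjoint (openSegment ℝ u v) (openSegment ℝ w w') := by
  rw [Set.disjoint_left]
  rintro _ ⟨s, t, hs, ht, hst, rfl⟩ ⟨s', t', hs', ht', hst', e⟩
  have h1 := chordCoord_re_comb (c := c) (z := z) x d u v hst
  rw [← e, chordCoord_re_comb x d w w' hst', hu, hv, ← add_mul, hst, one_mul] at h1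
  have h2 : h = s' * h + t' * h := by rw [← add_mul, hst', one_mul]
  rcases hw with ⟨h3, h4⟩ | ⟨h3, h4⟩
  · nlinarith [mul_lt_mul_of_pos_left h3 hs', mul_le_mul_of_nonneg_left h4 ht'.le]
  · nlinarith [mul_lt_mul_of_pos_left h3 hs', mul_le_mul_of_nonneg_left h4 ht'.le]

/-- In a noncrossing graph no other edge crosses a given chord: its two ends lie on the same side of
the line through the chord. -/
lemma disjoint_openSegment_of_isNoncrossing {G : SimpleGraph (Option (ZMod (2 * m + 1)))}
    (hz : z ≠ 0) (hG : IsNoncrossing G) {x : ZMod (2 * m + 1)} {d : ℕ} (hd : d ≤ m)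
    (hx : G.Adj (some x) (some (x + (d : ℕ)))) {w w' : Option (ZMod (2 * m + 1))} (hw : G.Adj w w')
    (hne : s(some x, some (x + (d : ZMod (2 * m + 1)))) ≠ s(w, w')) :
    Disjoint (openSegment ℝ (wheelPoint m c z (some x)) (wheelPoint m c z (some (x + (d : ℕ)))))
      (openSegment ℝ (wheelPoint m c z w) (wheelPoint m c z w')) := by
  have h1 := chordCoord_re_start (c := c) hz x d
  have h2 := chordCoord_re_end (c := c) hz x d
  -- On the closed arc the coordinate is at least that of the chord.
  have hge : ∀ i : ℕ, i ≤ d → Real.cos (Real.pi * d / (2 * m + 1)) ≤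
      (chordCoord c z x d (wheelPoint m c z (some (x + (i : ℕ))))).re := by
    intro i hi
    rcases Nat.eq_zero_or_pos i with rfl | h0
    · rw [Nat.cast_zero, add_zero, h1]
    rcases eq_or_lt_of_le hi with rfl | hi
    · rw [h2]
    · exact (lt_chordCoord_re hz x h0 hi hd).le
  have inner : ∀ {w w' : Option (ZMod (2 * m + 1))}, G.Adj w w' →
      (∃ j : ℕ, 0 < j ∧ j < d ∧ w = some (x + (j : ℕ))) →
      Disjoint (openSegment ℝ (wheelPoint m c z (some x)) (wheelPoint m c z (some (x + (d : ℕ)))))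
        (openSegment ℝ (wheelPoint m c z w) (wheelPoint m c z w')) := by
    rintro w w' hw ⟨j, h0, hj, rfl⟩
    obtain ⟨i, hi, rfl⟩ := hG x d hd hx j h0 hj w' hw
    exact disjoint_openSegment_of_re x d h1 h2
      (Or.inl ⟨lt_chordCoord_re hz x h0 hj hd, hge i hi⟩)
  by_cases hin : ∃ j : ℕ, 0 < j ∧ j < d ∧ w = some (x + (j : ℕ))
  · exact inner hw hin
  by_cases hin' : ∃ j : ℕ, 0 < j ∧ j < d ∧ w' = some (x + (j : ℕ))
  · rw [openSegment_symm ℝ (wheelPoint m c z w)]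
    exact inner hw.symm hin'
  -- All other points are the ends of the chord or lie strictly below it.
  have hout : ∀ {w}, (¬ ∃ j : ℕ, 0 < j ∧ j < d ∧ w = some (x + (j : ℕ))) →
      (w = some x ∨ w = some (x + (d : ℕ))) ∨
        (chordCoord c z x d (wheelPoint m c z w)).re < Real.cos (Real.pi * d / (2 * m + 1)) := by
    intro w hw
    by_cases h : ∃ i : ℕ, i ≤ d ∧ w = some (x + (i : ℕ))
    · left
      obtain ⟨i, hi, rfl⟩ := h
      rcases Nat.eq_zero_or_pos i with rfl | h0
      · left; simp
      rcases eq_or_lt_of_le hi with rfl | hi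
      · right; rfl
      · exact (hw ⟨i, h0, hi, rfl⟩).elim
    · exact Or.inr (chordCoord_re_lt_of_ne hz x hd h)
  have hends : ∀ {w}, (w = some x ∨ w = some (x + (d : ZMod (2 * m + 1)))) →
      (chordCoord c z x d (wheelPoint m c z w)).re = Real.cos (Real.pi * d / (2 * m + 1)) := by
    rintro w (rfl | rfl)
    · exact h1
    · exact h2
  rcases hout hin with h | h <;> rcases hout hin' with h' | h'
  · exfalso
    rcases h with rfl | rfl <;> rcases h' with rfl | rfl
    · exact hw.ne rfl
    · exact hne rfl
    · exact hne Sym2.eq_swap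
    · exact hw.ne rfl
  · rw [openSegment_symm ℝ (wheelPoint m c z w)]
    exact disjoint_openSegment_of_re x d h1 h2 (Or.inr ⟨h', (hends h).le⟩)
  · exact disjoint_openSegment_of_re x d h1 h2 (Or.inr ⟨h, (hends h').le⟩)
  · exact disjoint_openSegment_of_re x d h1 h2 (Or.inr ⟨h, h'.le⟩)

lemma disjoint_openSegment_radii (hz : z ≠ 0) {x y : ZMod (2 * m + 1)} (hxy : x ≠ y) :
    Disjoint (openSegment ℝ c (wheelPoint m c z (some x)))
      (openSegment ℝ c (wheelPoint m c z (some y))) := by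
  rw [Set.disjoint_left]
  rintro _ ⟨s, t, hs, ht, hst, rfl⟩ ⟨s', t', hs', ht', hst', e⟩
  have e1 : ∀ {s t : ℝ} (x : ZMod (2 * m + 1)), s + t = 1 →
      s • c + t • wheelPoint m c z (some x) = c + t * (z * ZMod.toCircle x) := by
    intro s t x h
    have : (s : ℂ) + t = 1 := by exact_mod_cast h
    simp only [wheelPoint, Complex.real_smul]
    linear_combination c * this
  rw [e1 x hst, e1 y hst', add_right_inj] at e
  have h1 := congrArg norm e
  simp only [norm_mul, Complex.norm_real, Circle.norm_coe, mul_one, Real.norm_eq_abs,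
    abs_of_pos ht, abs_of_pos ht'] at h1
  have h2 : t' = t := mul_right_cancel₀ (norm_ne_zero_iff.2 hz) h1
  subst h2
  have ht0 : (t' : ℂ) ≠ 0 := by exact_mod_cast ht.ne'
  have h3 := mul_left_cancel₀ hz (mul_left_cancel₀ ht0 e)
  exact hxy (ZMod.injective_toCircle (Subtype.ext h3)).symm

/-- Planarity of a geometric graph on the wheel in terms of arcs. -/
theorem forall_disjoint_iff_isNoncrossing (hz : z ≠ 0)
    (G : SimpleGraph (Option (ZMod (2 * m + 1)))) :
    (∀ u v w x, G.Adj u v → G.Adj w x → s(u, v) ≠ s(w, x) →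
      Disjoint (openSegment ℝ (wheelPoint m c z u) (wheelPoint m c z v))
        (openSegment ℝ (wheelPoint m c z w) (wheelPoint m c z x))) ↔ IsNoncrossing G := by
  constructor
  · intro h x d hd hx j h0 hj w hw
    by_contra hno
    obtain ⟨p, hp1, hp2⟩ := exists_mem_openSegment (c := c) hz x hd h0 hj hno
    refine Set.disjoint_left.1 (h _ _ _ _ hx hw ?_) hp1 hp2
    intro e
    rcases Sym2.eq_iff.1 e with ⟨-, e⟩ | ⟨e, -⟩
    · exact hno ⟨d, le_rfl, e.symm⟩
    · exact hno ⟨0, by omega, by simp [← e]⟩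
  · intro hG u v w x huv hwx hne
    have chord : ∀ {y z' : ZMod (2 * m + 1)} {w x}, G.Adj (some y) (some z') → G.Adj w x →
        s(some y, some z') ≠ s(w, x) →
        Disjoint (openSegment ℝ (wheelPoint m c z (some y)) (wheelPoint m c z (some z')))
          (openSegment ℝ (wheelPoint m c z w) (wheelPoint m c z x)) := by
      intro y z' w x hy hw hne
      obtain ⟨d, -, hd, rfl | rfl⟩ := exists_chord (fun h => hy.ne (congrArg some h))
      · exact disjoint_openSegment_of_isNoncrossing hz hG hd hy hw hne
      · rw [openSegment_symm ℝ (wheelPoint m c z (some _))]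
        refine disjoint_openSegment_of_isNoncrossing hz hG hd hy.symm hw ?_
        rwa [Sym2.eq_swap] at hne
    have rad : ∀ {y y' : ZMod (2 * m + 1)}, s(none, some y) ≠ s(none, some y') → y ≠ y' := by
      rintro y y' h rfl
      exact h rfl
    match u, v, w, x with
    | none, none, _, _ => exact (huv.ne rfl).elim
    | _, _, none, none => exact (hwx.ne rfl).elim
    | some y, some y', _, _ => exact chord huv hwx hne
    | _, _, some y, some y' => exact (chord hwx huv hne.symm).symm
    | none, some y, none, some y' => exact disjoint_openSegment_radii hz (rad hne)
    | some y, none, none, some y' =>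
      rw [Sym2.eq_swap] at hne
      rw [openSegment_symm]
      exact disjoint_openSegment_radii hz (rad hne)
    | none, some y, some y', none =>
      rw [Sym2.eq_swap (a := some y')] at hne
      rw [openSegment_symm ℝ (wheelPoint m c z (some y'))]
      exact disjoint_openSegment_radii hz (rad hne)
    | some y, none, some y', none =>
      rw [Sym2.eq_swap, Sym2.eq_swap (a := some y')] at hne
      rw [openSegment_symm, openSegment_symm ℝ (wheelPoint m c z (some y'))]
      exact disjoint_openSegment_radii hz (rad hne)

end

end

/-! ### The boundary of the convex hull of the wheel -/

section

variable {m : ℕ}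

section

variable {c z : ℂ}

lemma sum_toCircle (hm : 1 ≤ m) : ∑ x : ZMod (2 * m + 1), (ZMod.toCircle x : ℂ) = 0 := by
  have h := AddChar.sum_mulShift (1 : ZMod (2 * m + 1)) (ZMod.isPrimitive_stdAddChar (2 * m + 1))
  have h1 : (1 : ZMod (2 * m + 1)) ≠ 0 := fun h => by
    have := natCast_inj (m := m) (i := 1) (j := 0) (by omega) (by omega) (by simpa using h)
    omega
  simpa [h1, ZMod.stdAddChar_apply] using h

lemma sum_toCircle_sq (hm : 1 ≤ m) :
    ∑ x : ZMod (2 * m + 1), (ZMod.toCircle x : ℂ) * ZMod.toCircle x = 0 := by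
  have h := AddChar.sum_mulShift (2 : ZMod (2 * m + 1)) (ZMod.isPrimitive_stdAddChar (2 * m + 1))
  have h1 : (2 : ZMod (2 * m + 1)) ≠ 0 := fun h => by
    have := natCast_inj (m := m) (i := 2) (j := 0) (by omega) (by omega) (by simpa using h)
    omega
  rw [if_neg h1, Nat.cast_zero] at h
  rw [← h]
  refine Finset.sum_congr rfl fun x _ => ?_
  rw [ZMod.stdAddChar_apply, mul_two, AddChar.map_add_eq_mul, Circle.coe_mul]

lemma sum_toCircle_inv (hm : 1 ≤ m) :
    ∑ x : ZMod (2 * m + 1), (ZMod.toCircle x : ℂ)⁻¹ = 0 := by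
  rw [← Equiv.sum_comp (Equiv.neg (ZMod (2 * m + 1))), ← sum_toCircle hm]
  refine Finset.sum_congr rfl fun x _ => ?_
  rw [Equiv.neg_apply, AddChar.map_neg_eq_inv, Circle.coe_inv, inv_inv]

/-- The disc of half the radius lies in the convex hull: with `w = (p - c) / z`, the point `p` is
the convex combination of the points `x` with weights `(1 + 2 Re (ω ^ (-x) w)) / (2 m + 1)`. -/
lemma ball_subset_convexHull (hm : 1 ≤ m) (hz : z ≠ 0) :
    Metric.ball c (‖z‖ / 2) ⊆ convexHull ℝ (Set.range (wheelPoint m c z)) := by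
  intro p hp
  obtain ⟨w, hw⟩ : ∃ w : ℂ, p = c + z * w := ⟨(p - c) / z, by field_simp; ring⟩
  have hw1 : ‖w‖ < 1 / 2 := by
    rw [hw, mem_ball_iff_norm, add_sub_cancel_left, norm_mul] at hp
    have := norm_pos_iff.2 hz
    nlinarith
  have hN : ((2 * m + 1 : ℕ) : ℝ) ≠ 0 := by positivity
  have hNC : ((2 * m + 1 : ℕ) : ℂ) ≠ 0 := by exact_mod_cast hN
  set l : ZMod (2 * m + 1) → ℝ :=
    fun x => (1 + 2 * ((ZMod.toCircle x : ℂ)⁻¹ * w).re) / (2 * m + 1 : ℕ) with hl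
  have hlC : ∀ x, (l x : ℂ) = (1 + (ZMod.toCircle x : ℂ)⁻¹ * w +
      (ZMod.toCircle x : ℂ) * (starRingEnd ℂ) w) / (2 * m + 1 : ℕ) := by
    intro x
    have h1 := Complex.add_conj ((ZMod.toCircle x : ℂ)⁻¹ * w)
    have h2 : (starRingEnd ℂ) (ZMod.toCircle x : ℂ)⁻¹ = ZMod.toCircle x := by
      rw [← Circle.coe_inv, ← Circle.coe_inv_eq_conj, inv_inv]
    rw [map_mul, h2] at h1
    simp only [hl]
    rw [add_assoc, h1]
    push_cast
    ring
  have hl0 : ∀ x ∈ Finset.univ, 0 ≤ l x := by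
    intro x _
    refine div_nonneg ?_ (Nat.cast_nonneg _)
    have h1 := Complex.abs_re_le_norm ((ZMod.toCircle x : ℂ)⁻¹ * w)
    rw [norm_mul, norm_inv, Circle.norm_coe, inv_one, one_mul] at h1
    have := (abs_le.1 h1).1
    linarith
  have hcard : ∑ _x : ZMod (2 * m + 1), (1 : ℂ) = (2 * m + 1 : ℕ) := by simp
  have hl1 : ∑ x, l x = 1 := by
    have : ((∑ x, l x : ℝ) : ℂ) = 1 := by
      rw [Complex.ofReal_sum]
      simp only [hlC]
      rw [← Finset.sum_div, Finset.sum_add_distrib, Finset.sum_add_distrib, ← Finset.sum_mul,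
        ← Finset.sum_mul, sum_toCircle hm, sum_toCircle_inv hm, hcard, zero_mul, zero_mul,
        add_zero, add_zero, div_self hNC]
    exact_mod_cast this
  have hl2 : ∑ x, (l x : ℂ) * ZMod.toCircle x = w := by
    have h3 : ∀ x : ZMod (2 * m + 1), (l x : ℂ) * ZMod.toCircle x = ((ZMod.toCircle x : ℂ) + 1 * w +
        (ZMod.toCircle x : ℂ) * ZMod.toCircle x * (starRingEnd ℂ) w) / (2 * m + 1 : ℕ) := by
      intro x
      have := Circle.coe_ne_zero (ZMod.toCircle x)
      rw [hlC]
      field_simp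
    simp only [h3]
    rw [← Finset.sum_div, Finset.sum_add_distrib, Finset.sum_add_distrib, ← Finset.sum_mul,
      ← Finset.sum_mul, sum_toCircle hm, sum_toCircle_sq hm, hcard, zero_mul, zero_add,
      add_zero, mul_div_cancel_left₀ _ hNC]
  have hp' : p = ∑ x, l x • wheelPoint m c z (some x) := by
    have h4 : ∀ x, l x • wheelPoint m c z (some x) =
        (l x : ℂ) * c + z * ((l x : ℂ) * ZMod.toCircle x) := by
      intro x
      simp only [wheelPoint, Complex.real_smul]
      ring
    simp only [h4]
    rw [Finset.sum_add_distrib, ← Finset.sum_mul, ← Finset.mul_sum, hl2, ← Complex.ofReal_sum, hl1,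
      hw]
    simp
  rw [hp']
  exact (convex_convexHull ℝ _).sum_mem hl0 hl1 fun x _ => subset_convexHull ℝ _ ⟨some x, rfl⟩

lemma center_mem_interior (hm : 1 ≤ m) (hz : z ≠ 0) :
    c ∈ interior (convexHull ℝ (Set.range (wheelPoint m c z))) :=
  interior_mono (ball_subset_convexHull hm hz) <| by
    rw [Metric.isOpen_ball.interior_eq]
    exact Metric.mem_ball_self (by have := norm_pos_iff.2 hz; positivity)

/-- The convex hull lies on one side of the line through two consecutive points of the circle. -/
lemma chordCoord_re_le_of_mem_convexHull (hm : 1 ≤ m) (hz : z ≠ 0) (x : ZMod (2 * m + 1)) {p : ℂ}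
    (hp : p ∈ convexHull ℝ (Set.range (wheelPoint m c z))) :
    (chordCoord c z x 1 p).re ≤ Real.cos (Real.pi * (1 : ℕ) / (2 * m + 1)) := by
  have hconv : Convex ℝ {p : ℂ | (chordCoord c z x 1 p).re ≤
      Real.cos (Real.pi * (1 : ℕ) / (2 * m + 1))} := by
    intro u hu v hv s t hs ht hst
    simp only [Set.mem_ofPred_eq] at hu hv ⊢
    rw [chordCoord_re_comb x 1 u v hst]
    calc _ ≤ s * Real.cos (Real.pi * (1 : ℕ) / (2 * m + 1)) +
          t * Real.cos (Real.pi * (1 : ℕ) / (2 * m + 1)) :=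
          add_le_add (mul_le_mul_of_nonneg_left hu hs) (mul_le_mul_of_nonneg_left hv ht)
      _ = _ := by rw [← add_mul, hst, one_mul]
  refine convexHull_min ?_ hconv hp
  rintro _ ⟨u, rfl⟩
  by_cases h : ∃ i : ℕ, i ≤ 1 ∧ u = some (x + (i : ℕ))
  · obtain ⟨i, hi, rfl⟩ := h
    obtain rfl | rfl : i = 0 ∨ i = 1 := by omega
    · rw [Set.mem_ofPred_eq, Nat.cast_zero, add_zero, chordCoord_re_start hz]
    · exact (chordCoord_re_end hz x 1).le
  · exact (chordCoord_re_lt_of_ne hz x hm h).le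

lemma chordCoord_surjective (hz : z ≠ 0) (x : ZMod (2 * m + 1)) (d : ℕ) :
    Function.Surjective (chordCoord c z x d) := by
  intro q
  have h1 := Circle.coe_ne_zero (ZMod.toCircle x)
  have h2 := Complex.exp_ne_zero ((-(Real.pi * d / (2 * m + 1)) : ℝ) * Complex.I)
  refine ⟨c + q / ((ZMod.toCircle x : ℂ)⁻¹ *
    Complex.exp ((-(Real.pi * d / (2 * m + 1)) : ℝ) * Complex.I) / z), ?_⟩
  rw [chordCoord, add_sub_cancel_left]
  exact div_mul_cancel₀ _ (by positivity)

/-- A side of the regular polygon lies on the boundary of the convex hull. -/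
lemma segment_subset_frontier (hm : 1 ≤ m) (hz : z ≠ 0) (x : ZMod (2 * m + 1)) :
    segment ℝ (wheelPoint m c z (some x)) (wheelPoint m c z (some (x + 1))) ⊆
      frontier (convexHull ℝ (Set.range (wheelPoint m c z))) := by
  intro p hp
  have hmem := (convex_convexHull ℝ _).segment_subset
    (subset_convexHull ℝ _ (Set.mem_range_self (some x)))
    (subset_convexHull ℝ _ (Set.mem_range_self (some (x + 1)))) hp
  refine ⟨subset_closure hmem, fun hint => ?_⟩
  have h1 := chordCoord_re_start (c := c) hz x 1
  have h2 := chordCoord_re_end (c := c) hz x 1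
  rw [Nat.cast_one] at h2
  have hre : (chordCoord c z x 1 p).re = Real.cos (Real.pi * (1 : ℕ) / (2 * m + 1)) := by
    obtain ⟨s, t, -, -, hst, rfl⟩ := hp
    rw [chordCoord_re_comb x 1 _ _ hst, h1, h2, ← add_mul, hst, one_mul]
  -- In an interior point the real part of the coordinate would not be maximal, by moving the
  -- point outwards.
  obtain ⟨v, hv⟩ := chordCoord_surjective (c := c) hz x 1 (chordCoord c z x 1 p + 1)
  have hcont : Filter.Tendsto (fun t : ℝ => (1 - t) • p + t • v) (nhdsWithin 0 (Set.Ioi 0))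
      (nhds p) := by
    have : Continuous fun t : ℝ => (1 - t) • p + t • v := by fun_prop
    have := this.tendsto 0
    simp only [sub_zero, one_smul, zero_smul, add_zero] at this
    exact this.mono_left nhdsWithin_le_nhds
  obtain ⟨t, ht1, ht2⟩ := ((hcont.eventually (mem_interior_iff_mem_nhds.1 hint)).and
    self_mem_nhdsWithin).exists
  have h3 := chordCoord_re_le_of_mem_convexHull hm hz x ht1
  rw [chordCoord_re_comb x 1 _ _ (by ring), hv, Complex.add_re, Complex.one_re, hre] at h3
  have h4 : (0 : ℝ) < t := ht2
  linarith

/-- The edges on the boundary of the convex hull of the wheel are the sides of the regular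
polygon: a longer chord crosses a radius, which contains no boundary point but its end. -/
theorem segment_subset_frontier_iff (hm : 1 ≤ m) (hz : z ≠ 0) {u v : Option (ZMod (2 * m + 1))}
    (huv : u ≠ v) : segment ℝ (wheelPoint m c z u) (wheelPoint m c z v) ⊆
      frontier (convexHull ℝ (Set.range (wheelPoint m c z))) ↔
        ∃ x : ZMod (2 * m + 1), s(u, v) = s(some x, some (x + 1)) := by
  constructor
  · intro h
    have hc := center_mem_interior (c := c) hm hz
    have chord : ∀ (x : ZMod (2 * m + 1)) (d : ℕ), 1 ≤ d → d ≤ m →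
        segment ℝ (wheelPoint m c z (some x)) (wheelPoint m c z (some (x + (d : ℕ)))) ⊆
          frontier (convexHull ℝ (Set.range (wheelPoint m c z))) → d = 1 := by
      intro x d h1 hd hsub
      by_contra hne
      obtain ⟨p, hp1, hp2⟩ := exists_mem_openSegment (c := c) hz x (j := 1) hd (by omega)
        (by omega) (w := none) (by rintro ⟨i, -, hi⟩; cases hi)
      rw [openSegment_symm] at hp2
      exact (hsub (openSegment_subset_segment _ _ _ hp1)).2
        ((convex_convexHull ℝ _).openSegment_interior_self_subset_interior hc
          (subset_convexHull ℝ _ ⟨_, rfl⟩) hp2)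
    match u, v with
    | none, _ => exact ((h (left_mem_segment ℝ _ _)).2 hc).elim
    | some _, none => exact ((h (right_mem_segment ℝ _ _)).2 hc).elim
    | some x, some y =>
      obtain ⟨d, h1, hd, rfl | rfl⟩ := exists_chord (fun h => huv (congrArg some h))
      · obtain rfl := chord x d h1 hd h
        exact ⟨x, by simp⟩
      · rw [segment_symm] at h
        obtain rfl := chord y d h1 hd h
        exact ⟨y, by rw [Sym2.eq_swap]; simp⟩
  · rintro ⟨x, h⟩
    rcases Sym2.eq_iff.1 h with ⟨rfl, rfl⟩ | ⟨rfl, rfl⟩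
    · exact segment_subset_frontier hm hz x
    · rw [segment_symm]
      exact segment_subset_frontier hm hz x

end

end

/-! ### Geometric graphs on a point set in regular wheel configuration -/

section

variable {m : ℕ}

lemma IsRegularWheel.exists_equiv {P : Set ℂ} (hP : IsRegularWheel (m + 1) P) :
    ∃ c z : ℂ, z ≠ 0 ∧ P = Set.range (wheelPoint m c z) ∧
      ∃ q : Option (ZMod (2 * m + 1)) ≃ P, ∀ u, (q u : ℂ) = wheelPoint m c z u := by
  obtain ⟨c, z, hz, hP⟩ := hP
  have hN : 2 * (m + 1) - 1 = 2 * m + 1 := by omega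
  rw [hN] at hP
  have hpoint : ∀ i : ℕ, wheelPoint m c z (some (i : ZMod (2 * m + 1))) =
      c + z * Complex.exp (2 * Real.pi * Complex.I * (i : ℂ) / ((2 * m + 1 : ℕ) : ℂ)) := fun i => by
    rw [wheelPoint, ZMod.toCircle_natCast]
  have hrange : P = Set.range (wheelPoint m c z) := by
    rw [hP]
    ext p
    simp only [Set.mem_insert_iff, Set.mem_range, Option.exists]
    refine or_congr eq_comm ⟨?_, ?_⟩
    · rintro ⟨k, rfl⟩
      exact ⟨_, hpoint k⟩
    · rintro ⟨x, rfl⟩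
      obtain ⟨i, hi, rfl⟩ := exists_eq_add 0 x
      exact ⟨⟨i, hi⟩, by rw [zero_add]; exact (hpoint i).symm⟩
  subst hrange
  exact ⟨c, z, hz, rfl, Equiv.ofInjective _ (wheelPoint_injective hz), fun _ => rfl⟩

section

variable {c z : ℂ} {P : Set ℂ} {q : Option (ZMod (2 * m + 1)) ≃ P}

lemma isPlane_iff_isNoncrossing (hz : z ≠ 0) (hq : ∀ u, (q u : ℂ) = wheelPoint m c z u)
    (T : SimpleGraph P) : IsPlane T ↔ IsNoncrossing (T.comap q) := by
  rw [← forall_disjoint_iff_isNoncrossing (c := c) hz]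
  have hs : ∀ u v w x, s(q u, q v) = s(q w, q x) ↔ s(u, v) = s(w, x) := fun u v w x =>
    (Sym2.map.injective q.injective).eq_iff (a := s(u, v)) (b := s(w, x))
  simp only [IsPlane, q.surjective.forall, hq, ne_eq, hs, comap_adj]

/-- The only side of the polygon in the special tree is its shortest chord. -/
lemma ncard_boundaryEdges (hm : 1 ≤ m) (hz : z ≠ 0) (hP : P = Set.range (wheelPoint m c z))
    (hq : ∀ u, (q u : ℂ) = wheelPoint m c z u)
    {e : Option (ZMod (2 * m + 1)) ≃ Option (ZMod (2 * m + 1))}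
    (he : e = Equiv.refl _ ∨ e = reflection m) {T : SimpleGraph P} {a : ℕ → ℕ}
    {x₀ : ZMod (2 * m + 1)} (hT : (T.comap q).comap e = specialTree a x₀) :
    (boundaryEdges T).ncard = 1 := by
  have hside : ∀ u v, u ≠ v → (segment ℝ (q (e u) : ℂ) (q (e v)) ⊆ frontier (convexHull ℝ P) ↔
      ∃ x : ZMod (2 * m + 1), s(u, v) = s(some x, some (x + 1))) := by
    intro u v huv
    rw [hq, hq, hP, segment_subset_frontier_iff hm hz (e.injective.ne huv)]
    rcases he with rfl | rfl
    · rfl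
    have hs : ∀ x y : ZMod (2 * m + 1), s(reflection m u, reflection m v) = s(some x, some y) ↔
        s(u, v) = s(some (-x), some (-y)) := fun x y => by
      have hr : ∀ u, reflection m (reflection m u) = u := fun u => by cases u <;> simp
      rw [← (Sym2.map.injective (reflection m).injective).eq_iff]
      simp [hr]
    constructor
    · rintro ⟨x, h⟩
      refine ⟨-(x + 1), ?_⟩
      rw [(hs _ _).1 h, Sym2.eq_swap]
      congr 3
      ring
    · rintro ⟨x, h⟩
      refine ⟨-(x + 1), (hs _ _).2 ?_⟩
      rw [h, Sym2.eq_swap]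
      congr 3 <;> ring
  have hadj : ∀ u v, T.Adj (q (e u)) (q (e v)) ↔ (specialTree a x₀).Adj u v := fun u v => by
    rw [← hT]; rfl
  have hone : ∀ y, (specialTree a x₀).Adj (some y) (some (y + 1)) ↔ y = x₀ + (a 1 : ℕ) := by
    intro y
    have := profileGraph_adj_chord (a := a) (J := {x₀}) (R := specialRadii x₀) (y := y) le_rfl hm
    rw [Nat.cast_one] at this
    rw [this, Set.mem_singleton_iff, sub_eq_iff_eq_add]
  rw [Set.ncard_eq_one]
  refine ⟨s(q (e (some (x₀ + (a 1 : ℕ)))), q (e (some (x₀ + (a 1 : ℕ) + 1)))), ?_⟩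
  ext b
  rw [Set.mem_singleton_iff]
  constructor
  · rintro ⟨u, v, rfl, huv, hsub⟩
    obtain ⟨u, rfl⟩ := (e.trans q).surjective u
    obtain ⟨v, rfl⟩ := (e.trans q).surjective v
    simp only [Equiv.trans_apply] at huv hsub ⊢
    rw [hadj] at huv
    obtain ⟨y, hy⟩ := (hside u v huv.ne).1 hsub
    rcases Sym2.eq_iff.1 hy with ⟨rfl, rfl⟩ | ⟨rfl, rfl⟩
    · rw [(hone y).1 huv]
    · rw [(hone y).1 huv.symm, Sym2.eq_swap]
  · rintro rfl
    have h := (hone _).2 rfl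
    exact ⟨_, _, rfl, (hadj _ _).2 h, (hside _ _ h.ne).2 ⟨_, rfl⟩⟩

end

end

end WheelPartition

open WheelPartition

theorem theorem1 (n : ℕ) (hn : 2 ≤ n) (P : Set ℂ) (hP : IsRegularWheel n P) :
    (∀ T : Fin n → SimpleGraph P,
      PartitionsComplete T → (∀ i, (T i).IsTree ∧ IsPlane (T i)) →
        ∃ k : Fin n,
          (∀ i, i ≠ k → IsWCaterpillar (T i)) ∧
          (∀ i j, i ≠ k → j ≠ k → Nonempty (T i ≃g T j)) ∧
          IsCaterpillar (T k) ∧ (boundaryEdges (T k)).ncard = 1) ∧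
    (∀ (V : Type*) (S : SimpleGraph V), Nat.card V = 2 * n → IsWCaterpillar S →
      ∃ T : Fin n → SimpleGraph P,
        PartitionsComplete T ∧ (∀ i, (T i).IsTree ∧ IsPlane (T i)) ∧
          ∃ k : Fin n,
            (∀ i, i ≠ k → Nonempty (T i ≃g S)) ∧
            IsCaterpillar (T k) ∧ (boundaryEdges (T k)).ncard = 1) := by
  obtain ⟨m, rfl⟩ : ∃ m, n = m + 1 := ⟨n - 1, by omega⟩
  have hm : 1 ≤ m := by omega
  obtain ⟨c, z, hz, hrange, q, hq⟩ := IsRegularWheel.exists_equiv hP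
  constructor
  · intro T hpart hT
    have hT' : IsNoncrossingPartition fun t => (T t).comap q :=
      { partitions := fun _ _ huv => hpart _ _ (q.injective.ne huv)
        isTree := fun t => (Iso.comap q (T t)).isTree_iff.2 (hT t).1
        isNoncrossing := fun t => (isPlane_iff_isNoncrossing hz hq _).1 (hT t).2 }
    obtain ⟨e, he, a, k, x₀, ha, hk, hrot⟩ := hT'.exists_normal_form hm
    have hiso : ∀ t, t ≠ k → Nonempty (rotatedTree (m := m) a 0 ≃g T t) := by
      intro t ht
      obtain ⟨s, hs⟩ := hrot t ht
      obtain ⟨f⟩ := nonempty_iso_rotatedTree a s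
      have g : ((T t).comap q).comap e ≃g T t := (Iso.comap e _).trans (Iso.comap q _)
      rw [hs] at g
      exact ⟨f.trans g⟩
    refine ⟨k, fun t ht => ?_, fun i j hi hj => ?_, ?_, ncard_boundaryEdges hm hz hrange hq he hk⟩
    · obtain ⟨s, hs⟩ := hrot t ht
      exact isWCaterpillar_rotated (e.trans q) hm ha hs (hT t).1
    · obtain ⟨f⟩ := hiso i hi
      obtain ⟨g⟩ := hiso j hj
      exact ⟨f.symm.trans g⟩
    · exact isCaterpillar_special (e.trans q) ha hk
  · intro V S hV hS
    obtain ⟨a, ha, ⟨f⟩⟩ := exists_iso_of_isWCaterpillar hm (by omega) hS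
    have hStree : S.IsTree := by
      obtain ⟨_, _, _, _, h, -⟩ := hS
      exact h.1
    have hcomap : ∀ G : SimpleGraph (Option (ZMod (2 * m + 1))),
        (G.comap q.symm).comap q = G := fun G => by
      ext u v
      simp
    have hspecial : IsCaterpillar ((profileFamily m a 0).comap q.symm) := by
      refine isCaterpillar_special q ha (x₀ := 0) ?_
      rw [hcomap, profileFamily, if_pos rfl]
    have hiso : ∀ t, t ≠ 0 → Nonempty ((profileFamily m a t).comap q.symm ≃g S) := by
      intro t ht
      obtain ⟨g⟩ := nonempty_iso_rotatedTree (m := m) a (t : ℕ)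
      rw [profileFamily, if_neg ht]
      exact ⟨(Iso.comap q.symm _).trans (g.symm.trans f)⟩
    refine ⟨fun t => (profileFamily m a t).comap q.symm, fun _ _ huv =>
      partitionsComplete_profileFamily m a _ _ (q.symm.injective.ne huv),
      fun t => ⟨?_, ?_⟩, 0, hiso, hspecial,
      ncard_boundaryEdges hm hz hrange hq (Or.inl rfl) (a := a) (x₀ := 0) ?_⟩
    · by_cases ht : t = 0
      · subst ht
        exact hspecial.1
      · obtain ⟨g⟩ := hiso t ht
        exact g.isTree_iff.2 hStree
    · rw [isPlane_iff_isNoncrossing hz hq, hcomap, profileFamily]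
      split_ifs
      · exact isNoncrossing_specialTree ha 0
      · exact isNoncrossing_rotatedTree ha _
    · rw [hcomap, profileFamily, if_pos rfl]
      rfl
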